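/- Let $S$ be a germ of smooth complex analytic surface, with local algebra $\mathcal{O}\simeq\mathbb{C}\{x,y\}$ and maximal ideal $\mathfrak{m}$. A curve singularity $Z(g)$ on $S$ (with $g\in\mathfrak{m}$, $g\neq 0$, not necessarily reduced) is identified with the ideal $(g)$. A branch is a curve singularity $Z(f)$ with $f$ irreducible; it is a branch of $Z(g)$ if $f$ divides $g$, and it is smooth if $f\notin\mathfrak{m}^2$. Denote by $C\cdot D:=\dim_{\mathbb{C}}\mathcal{O}/(f,g)$ the intersection number of $C=Z(f)$ and $D=Z(g)$. Let $D$ be a curve singularity on $S$, let $\mathcal{F}(D)$ be the set of its branches, and let $L$ be a smooth branch on $S$ with $L\notin\mathcal{F}(D)$. For $A,B\in\mathcal{F}(D)$ put $$u_L(A,B):=\frac{(L\cdot A)\,(L\cdot B)}{A\cdot B}\ \text{ if } A\neq B,\qquad u_L(A,A):=0 .$$ Given a finite ultrametric space $(M,d)$, its associated rooted tree is the Hasse diagram of the set of closed balls $\{p\in M : d(p,a)\le r\}$ ($a\in M$, $r\ge 0$) ordered by inclusion, completed with a root $M\cup\{\omega\}$ ($\omega\notin M$) joined to $M$; the leaf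 labelled by $a\in M$ is $\{a\}$. The rooted tree with labelled leaves underlying the Eggers–Wall tree $\Theta_L(D)$ is defined as follows. Choose local coordinates $(x,y)$ on $S$ with $L=Z(x)$. For $A,B\in\mathcal{F}(D)$, let $k_L(A,B)\in[0,\infty]$ be the maximal order in $x$ of a difference $\xi-\eta$, where $\xi$ and $\eta$ are Newton–Puiseux roots of $A$ and $B$, that is, series in positive powers of $x^{1/n}$ for some $n\geq 1$, without constant term, that are roots in $y$ of a defining function of $A$, respectively of $B$. Then $\Theta_L(D)$ is the topological quotient of the disjoint union of segments $\{A\}\times[0,\infty]$, $A\in\mathcal{F}(D)$, obtained by gluing the origins of all segments to one point, which is the root (labelled $L$), and by identifying $(A,s)$ with $(B,s)$ for all $A,B\in\mathcal{F}(D)$ and all $s\le k_L(A,B)$. Its leaf labelled by $A$ is the point $(A,\infty)$, its vertices are its ends and its ramification points, and two vertices are joined by an edge if the segment between them contains no other vertex. (The exponent and index functions of the Eggers–Wall tree play no role here.) **Theorem.** The function $u_L$ is an ultrametric on $\mathcal{F}(D)$. Moreover, there exist local coordinates $(x,y)$ with $L=Z(x)$ and, for every choice of them, $\Theta_L(D)$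 is a rooted tree whose leaves are labelled bijectively by $\mathcal{F}(D)$, and the rooted tree associated to the ultrametric $u_L$ on $\mathcal{F}(D)$ is isomorphic to $\Theta_L(D)$ as a rooted tree with labelled leaves. -/

import Mathlib

open scoped ENNReal PowerSeries

/-! ### Convergent power series and smooth germs of surfaces -/

/-- The algebra `ℂ{x, y}` of convergent power series in two variables: the formal series which
are absolutely summable on some polydisc of positive radius. -/
def ConvergentSeries : Subalgebra ℂ (MvPowerSeries (Fin 2) ℂ) where
  carrier := {f | ∃ r : ℝ, 0 < r ∧
    Summable fun n : Fin 2 →₀ ℕ => ‖MvPowerSeries.coeff n f‖ * r ^ n.degree}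
  mul_mem' := by
    have mono : ∀ (f : MvPowerSeries (Fin 2) ℂ) (r s : ℝ), 0 < s → s ≤ r →
        (Summable fun n : Fin 2 →₀ ℕ => ‖MvPowerSeries.coeff n f‖ * r ^ n.degree) →
        Summable fun n : Fin 2 →₀ ℕ => ‖MvPowerSeries.coeff n f * (s : ℂ) ^ n.degree‖ := by
      intro f r s hs hsr h
      refine Summable.of_nonneg_of_le (fun n => norm_nonneg _) (fun n => ?_) h
      rw [norm_mul, norm_pow, Complex.norm_real, Real.norm_of_nonneg hs.le]
      gcongr
    rintro f g ⟨r, hr, hf⟩ ⟨s, hs, hg⟩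
    have ht : 0 < min r s := lt_min hr hs
    refine ⟨min r s, ht, ?_⟩
    have hF := mono f r _ ht (min_le_left _ _) hf
    have hG := mono g s _ ht (min_le_right _ _) hg
    have hFG := Summable.mul_of_nonneg hF hG (fun n => norm_nonneg _) (fun n => norm_nonneg _)
    have h := summable_sum_mul_antidiagonal_of_summable_mul (A := Fin 2 →₀ ℕ)
      (f := fun n => ‖MvPowerSeries.coeff n f * ((min r s : ℝ) : ℂ) ^ n.degree‖)
      (g := fun n => ‖MvPowerSeries.coeff n g * ((min r s : ℝ) : ℂ) ^ n.degree‖) hFG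
    refine Summable.of_nonneg_of_le (fun n => by positivity) (fun n => ?_) h
    have e : ∑ kl ∈ Finset.HasAntidiagonal.antidiagonal n,
        (MvPowerSeries.coeff kl.1 f * ((min r s : ℝ) : ℂ) ^ kl.1.degree) *
          (MvPowerSeries.coeff kl.2 g * ((min r s : ℝ) : ℂ) ^ kl.2.degree) =
        MvPowerSeries.coeff n (f * g) * ((min r s : ℝ) : ℂ) ^ n.degree := by
      rw [MvPowerSeries.coeff_mul, Finset.sum_mul]
      refine Finset.sum_congr rfl fun kl hkl => ?_
      rw [← Finset.HasAntidiagonal.mem_antidiagonal.1 hkl, map_add, pow_add]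
      ring
    calc ‖MvPowerSeries.coeff n (f * g)‖ * min r s ^ n.degree
        = ‖MvPowerSeries.coeff n (f * g) * ((min r s : ℝ) : ℂ) ^ n.degree‖ := by
          rw [norm_mul, norm_pow, Complex.norm_real, Real.norm_of_nonneg ht.le]
      _ ≤ _ := by
          rw [← e]
          refine (norm_sum_le _ _).trans (le_of_eq ?_)
          exact Finset.sum_congr rfl fun kl _ => norm_mul _ _
  add_mem' := by
    rintro f g ⟨r, hr, hf⟩ ⟨s, hs, hg⟩
    have ht : 0 < min r s := lt_min hr hs
    refine ⟨min r s, ht, Summable.of_nonneg_of_le (fun n => by positivity) (fun n => ?_)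
      (hf.add hg)⟩
    rw [map_add]
    calc ‖MvPowerSeries.coeff n f + MvPowerSeries.coeff n g‖ * min r s ^ n.degree
        ≤ (‖MvPowerSeries.coeff n f‖ + ‖MvPowerSeries.coeff n g‖) * min r s ^ n.degree := by
          gcongr
          exact norm_add_le _ _
      _ = ‖MvPowerSeries.coeff n f‖ * min r s ^ n.degree
          + ‖MvPowerSeries.coeff n g‖ * min r s ^ n.degree := add_mul _ _ _
      _ ≤ _ := by
          gcongr
          · exact min_le_left _ _
          · exact min_le_right _ _
  algebraMap_mem' := by
    intro c
    refine ⟨1, one_pos, summable_of_ne_finset_zero (s := {0}) fun n hn => ?_⟩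
    rw [MvPowerSeries.algebraMap_apply, MvPowerSeries.coeff_C]
    simp [Finset.notMem_singleton.1 hn]

section Germs

variable (O : Type*) [CommRing O] [Algebra ℂ O]

/-- A local coordinate system `(x, y)` on the germ of surface with local algebra `O`: an
isomorphism of `ℂ`-algebras from `O` to `ℂ{x, y}`. -/
abbrev LocalCoordinates := O ≃ₐ[ℂ] ConvergentSeries

/-- `O` is the local algebra of a germ of smooth complex analytic surface. -/
def IsSmoothSurfaceGerm : Prop := Nonempty (LocalCoordinates O)

end Germs

section Curves

variable {O : Type*} [CommRing O]

/-- A (not necessarily reduced) curve singularity `Z(g)`, represented by the principal ideal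
`(g)` of the local algebra `O` of the surface. -/
def IsCurveSingularity [IsLocalRing O] (D : Ideal O) : Prop :=
  ∃ g ∈ IsLocalRing.maximalIdeal O, g ≠ 0 ∧ D = Ideal.span {g}

/-- A branch: an irreducible curve singularity. -/
def IsBranch (A : Ideal O) : Prop :=
  ∃ f : O, Irreducible f ∧ A = Ideal.span {f}

/-- A smooth branch: a curve singularity with a defining function of multiplicity one. -/
def IsSmoothBranch [IsLocalRing O] (L : Ideal O) : Prop :=
  ∃ f ∈ IsLocalRing.maximalIdeal O, f ∉ IsLocalRing.maximalIdeal O ^ 2 ∧ L = Ideal.span {f}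

/-- The set of branches of the curve singularity `D`: the branches `Z(f)` such that `f` divides
a defining function of `D`. -/
def branchesOf (D : Ideal O) : Set (Ideal O) := {A | IsBranch A ∧ D ≤ A}

/-- The intersection number `C · D = dim_ℂ O / (f, g)` of `C = Z(f)` and `D = Z(g)`. -/
noncomputable def intersectionNumber [Algebra ℂ O] (C D : Ideal O) : ℕ∞ :=
  Cardinal.toENat (Module.rank ℂ (O ⧸ (C ⊔ D)))

open Classical in
/-- The function `u_L(A, B) = (L · A) (L · B) / (A · B)` if `A ≠ B`, and `u_L(A, A) = 0`. -/
noncomputable def uFunction [Algebra ℂ O] (L A B : Ideal O) : ℝ :=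
  if A = B then 0
  else ((intersectionNumber L A).toNat * (intersectionNumber L B).toNat : ℝ) /
    (intersectionNumber A B).toNat

end Curves

/-! ### Rooted trees with labelled vertices, and the tree of an ultrametric -/

/-- A graph with a distinguished vertex (the root) and vertices labelled by `ι`. -/
structure RootedGraph (ι : Type*) where
  V : Type*
  graph : SimpleGraph V
  root : V
  label : ι → V

/-- The graph is a tree and the labelling is a bijection from `ι` onto the set of leaves, that is,
of vertices of valency one distinct from the root. -/
structure RootedGraph.IsLeafLabelledTree {ι : Type*} (T : RootedGraph ι) : Prop where
  isTree : T.graph.IsTree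
  label_injective : Function.Injective T.label
  range_label : Set.range T.label = {v | v ≠ T.root ∧ (T.graph.neighborSet v).encard = 1}

/-- Isomorphisms of rooted graphs which respect the labels. -/
structure RootedGraph.Iso {ι : Type*} (T T' : RootedGraph ι) where
  toIso : T.graph ≃g T'.graph
  map_root : toIso T.root = T'.root
  map_label : ∀ i, toIso (T.label i) = T'.label i

/-- The function `d` is an ultrametric on `M`. -/
def IsUltrametric {M : Type*} (d : M → M → ℝ) : Prop :=
  ∃ _m : MetricSpace M, (∀ a b : M, dist a b = d a b) ∧ IsUltrametricDist M

/-- The closed ball of center `a` and radius `r`, as a subset of `M ∪ {ω}`, with `ω = none`. -/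
def ballIn {M : Type*} (d : M → M → ℝ) (a : M) (r : ℝ) : Set (Option M) :=
  some '' {p | d p a ≤ r}

/-- The closed balls of `(M, d)`, together with the root `M ∪ {ω}`. -/
def ballVertices {M : Type*} (d : M → M → ℝ) : Set (Set (Option M)) :=
  {B | B = Set.univ ∨ ∃ a r, 0 ≤ r ∧ B = ballIn d a r}

/-- The rooted tree associated to a finite ultrametric: the Hasse diagram of the set of closed
balls, ordered by inclusion and completed with the root `M ∪ {ω}`. The leaf with label `a` is the
singleton `{a}`, seen as the ball of center `a` and radius `0`. -/
def ultrametricTree {M : Type*} (d : M → M → ℝ) : RootedGraph M where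
  V := ballVertices d
  graph := SimpleGraph.hasse (ballVertices d)
  root := ⟨Set.univ, Or.inl rfl⟩
  label a := ⟨ballIn d a 0, Or.inr ⟨a, 0, le_rfl, rfl⟩⟩

/-! ### Gluing segments into a topological tree -/

/-- The gluing relation on the disjoint union of a point and of copies `{A} × [0, ∞]` of the
segment `[0, ∞]`, indexed by `A : ι`: the isolated point is glued to the origin of each segment,
and the segments `A`, `B` are glued along their initial segments `[0, k A B]`. -/
inductive GlueRel {ι : Type*} (k : ι → ι → ℝ≥0∞) :
    Unit ⊕ (Σ _ : ι, ℝ≥0∞) → Unit ⊕ (Σ _ : ι, ℝ≥0∞) → Prop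
  | origin (A : ι) : GlueRel k (Sum.inl ()) (Sum.inr ⟨A, 0⟩)
  | segment (A B : ι) (s : ℝ≥0∞) (hs : s ≤ k A B) : GlueRel k (Sum.inr ⟨A, s⟩) (Sum.inr ⟨B, s⟩)

/-- The quotient topological space of the gluing (`Quot` is the quotient by the equivalence
relation generated by the given relation). -/
abbrev GluedTree {ι : Type*} (k : ι → ι → ℝ≥0∞) : Type _ := Quot (GlueRel k)

namespace GluedTree

variable {ι : Type*} (k : ι → ι → ℝ≥0∞)

/-- The root of the glued tree. -/
def root : GluedTree k := Quot.mk _ (Sum.inl ())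

/-- The point of exponent `s` of the segment of index `A`. -/
def point (A : ι) (s : ℝ≥0∞) : GluedTree k := Quot.mk _ (Sum.inr ⟨A, s⟩)

/-- The order determined by the root: `p` lies on the segment which joins the root to `q`. -/
def Precedes (p q : GluedTree k) : Prop :=
  p = root k ∨ ∃ A s t, s ≤ t ∧ p = point k A s ∧ q = point k A t

/-- The valency of a point: the number of connected components of its complement. -/
noncomputable def valency (p : GluedTree k) : ℕ∞ :=
  ENat.card (ConnectedComponents {q : GluedTree k // q ≠ p})

/-- The vertices of the topological tree: its ends (valency one) and its ramification points
(valency at least three). The root and the tips of the segments, which are the ends, are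
listed explicitly so that they are vertices by construction. -/
def vertices : Set (GluedTree k) :=
  {p | p = root k ∨ (∃ A, p = point k A ⊤) ∨ valency k p = 1 ∨ 3 ≤ valency k p}

/-- The combinatorial rooted tree of the topological tree: two distinct vertices are joined by an
edge if one precedes the other and no other vertex lies between them. The label `A` is put at the
tip of the segment of index `A`. -/
def toRootedGraph : RootedGraph ι where
  V := vertices k
  graph := SimpleGraph.fromRel fun v w : vertices k =>
    Precedes k v w ∧ ∀ z : vertices k, Precedes k v z → Precedes k z w → z = v ∨ z = w
  root := ⟨root k, Or.inl rfl⟩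
  label A := ⟨point k A ⊤, Or.inr (Or.inl ⟨A, rfl⟩)⟩

end GluedTree

/-! ### Newton-Puiseux roots and the Eggers-Wall tree -/

section EggersWall

variable {O : Type*} [CommRing O] [Algebra ℂ O]

/-- The coordinate system `φ = (x, y)` is adapted to `L`: one has `L = Z(x)`. -/
def IsAdapted (φ : LocalCoordinates O) (L : Ideal O) : Prop :=
  ∃ x : O, (φ x : MvPowerSeries (Fin 2) ℂ) = MvPowerSeries.X 0 ∧ L = Ideal.span {x}

/-- The Newton-Puiseux roots of `A` with denominator `n ≥ 1`, in the coordinates `φ = (x, y)`: the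
series `ξ(t)` in `t = x ^ (1 / n)`, without constant term, such that `f(t ^ n, ξ(t)) = 0` for the
elements `f(x, y)` of the ideal of `A` (equivalently, for a Weierstrass polynomial `f` in `y` which
defines `A`). -/
def newtonPuiseuxRoots (φ : LocalCoordinates O) (A : Ideal O) (n : ℕ) : Set ℂ⟦X⟧ :=
  {ξ | PowerSeries.constantCoeff ξ = 0 ∧ ∀ f ∈ A,
    MvPowerSeries.subst (![PowerSeries.X ^ n, ξ] : Fin 2 → ℂ⟦X⟧)
      (φ f : MvPowerSeries (Fin 2) ℂ) = (0 : ℂ⟦X⟧)}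

/-- The order of coincidence of `A` and `B`: the maximal order in `x` of a difference of a
Newton-Puiseux root of `A` and of one of `B` (written with a common denominator `n`). -/
noncomputable def coincidence (φ : LocalCoordinates O) (A B : Ideal O) : ℝ≥0∞ :=
  ⨆ (n : ℕ) (_ : 0 < n) (ξ ∈ newtonPuiseuxRoots φ A n) (η ∈ newtonPuiseuxRoots φ B n),
    ((ξ - η).order : ℝ≥0∞) / n

/-- The underlying rooted tree, with leaves labelled by the branches of `D`, of the Eggers-Wall tree
of `D` relative to `L = Z(x)`, computed in the coordinates `φ = (x, y)`. It is obtained from the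
segments `[0, ∞]`, one for each branch of `D`, by gluing those of any two branches along the points
of exponent at most equal to the order of coincidence. -/
noncomputable def eggersWallTree (φ : LocalCoordinates O) (D : Ideal O) :
    RootedGraph (branchesOf D) :=
  GluedTree.toRootedGraph fun A B : branchesOf D => coincidence φ A B

end EggersWall

/-!
Coordinates adapted to `L` exist by the implicit function theorem for convergent series
(`IsSmoothBranch.exists_isAdapted`). In such coordinates, a branch `A ≠ L` has
Newton-Puiseux parametrizations `x = t ^ n`, `y = ξ(t)`: after the substitution `x ↦ x ^ n`, its
equation becomes, up to a unit, a product of distinct factors `y - ξ(x)`, where the convergent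
series `ξ` run through one orbit `Z` of the group of `n`-th roots of unity (`IsPuiseuxModel`,
`exists_isPuiseuxModel`). The existence of a root is obtained from the Newton polygon, by induction
on the order in `y` (`exists_newtonPuiseux_root`). The denominator `n` may be chosen independently
of the branch, as a curve has finitely many of them.

If `Z` and `W` are the sets of roots of two distinct branches `A` and `B`, the additivity of
colengths gives `n (A · B) = ∑ ord (ξ - η)`, where `ξ ∈ Z` and `η ∈ W`, and `L · A = |Z|`
(`IsPuiseuxModel.mul_intersectionNumber`, `IsPuiseuxModel.intersectionNumber_X`). Let `K` be the
maximum of the numbers `ord (ξ - η)` (`contact`), so that `k_L(A, B) = K / n`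
(`IsPuiseuxModel.coincidence_eq`). By the Galois action this maximum is attained at any given root
`η₀` of `B`, and for the corresponding `ξ` one has `ord (ξ - η) = min (K, ord (η₀ - η))`. Hence
`u_L(A, B) = n |W| / ∑ min (K, ord (η₀ - η))`, where `η ∈ W` (`IsPuiseuxModel.uFunction_eq`). For a
fixed branch `B`, this is a strictly decreasing function of `K`, that is, of `k_L(A, B)`
(`uFunction_le_iff_coincidence_le`).

The function `k_L` clearly satisfies `min (k_L(A, B), k_L(B, C)) ≤ k_L(A, C)`. The rest of the
argument uses only this inequality and the monotonicity of `u_L` with respect to `k_L`. They imply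
that `u_L` is an ultrametric, and that the closed ball of center `A` and radius `u_L(A, B)` consists
of the branches `C` whose segment contains the point `(A, k_L(A, B))`. A point different from the
root and from the tips of the segments is a ramification point exactly when it is of this form, as one
sees by counting the components of its complement (`GluedTree.mem_vertices_iff`), and none of these
points has valency one. So the vertices of the Eggers-Wall tree correspond to the closed balls and
to the root, with the order reversed (`GluedTree.bijective_ballAt`,
`GluedTree.precedes_iff_ballAt_subset`), which gives the isomorphism of the Hasse diagrams
(`GluedTree.nonempty_iso_ultrametricTree`). Finally the Hasse diagram of the set of balls is a tree
whose leaves are the balls of radius zero, since the balls which contain a given one form a chain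
(`isTree_hasse_of_isChain_Ici`, `IsUltrametric.isLeafLabelledTree_ultrametricTree`).
-/

/-! ### Weighted norms and convergent power series -/

section WeightedNorm

variable {σ τ : Type*}

/-- The norm `∑ |f_d| r ^ d` of a formal power series for the polyradius `r`, with values in
`[0, ∞]`. It is finite exactly when `f` is absolutely summable on the polydisc of polyradius `r`. -/
noncomputable def weightedNorm (r : σ → ℝ≥0∞) (f : MvPowerSeries σ ℂ) : ℝ≥0∞ :=
  ∑' d : σ →₀ ℕ, ‖MvPowerSeries.coeff d f‖ₑ * d.prod fun i n => r i ^ n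

theorem weightedNorm_add_le (r : σ → ℝ≥0∞) (f g : MvPowerSeries σ ℂ) :
    weightedNorm r (f + g) ≤ weightedNorm r f + weightedNorm r g := by
  unfold weightedNorm
  rw [← ENNReal.tsum_add]
  refine ENNReal.tsum_le_tsum fun d => ?_
  rw [← add_mul, map_add]
  gcongr
  exact enorm_add_le _ _

theorem weightedNorm_smul (r : σ → ℝ≥0∞) (c : ℂ) (f : MvPowerSeries σ ℂ) :
    weightedNorm r (c • f) = ‖c‖ₑ * weightedNorm r f := by
  unfold weightedNorm
  rw [← ENNReal.tsum_mul_left]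
  refine tsum_congr fun d => ?_
  rw [map_smul, smul_eq_mul, enorm_mul, mul_assoc]

theorem weightedNorm_neg (r : σ → ℝ≥0∞) (f : MvPowerSeries σ ℂ) :
    weightedNorm r (-f) = weightedNorm r f := by
  simp [weightedNorm]

theorem weightedNorm_monomial [DecidableEq σ] (r : σ → ℝ≥0∞) (d : σ →₀ ℕ) (c : ℂ) :
    weightedNorm r (MvPowerSeries.monomial d c) = ‖c‖ₑ * d.prod fun i n => r i ^ n := by
  unfold weightedNorm
  rw [tsum_eq_single d]
  · simp
  · intro e he
    rw [MvPowerSeries.coeff_monomial_ne he]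
    simp

theorem weightedNorm_one (r : σ → ℝ≥0∞) : weightedNorm r (1 : MvPowerSeries σ ℂ) = 1 := by
  classical
  rw [← MvPowerSeries.monomial_zero_one, weightedNorm_monomial]
  simp

theorem weightedNorm_X (r : σ → ℝ≥0∞) (i : σ) :
    weightedNorm r (MvPowerSeries.X i : MvPowerSeries σ ℂ) = r i := by
  classical
  rw [MvPowerSeries.X, weightedNorm_monomial]
  simp

theorem weightedNorm_mul_le (r : σ → ℝ≥0∞) (f g : MvPowerSeries σ ℂ) :
    weightedNorm r (f * g) ≤ weightedNorm r f * weightedNorm r g := by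
  classical
  have key : ∀ d : σ →₀ ℕ,
      ‖MvPowerSeries.coeff d (f * g)‖ₑ * (d.prod fun i n => r i ^ n) ≤
      ∑' p : Finset.HasAntidiagonal.antidiagonal d,
        (‖MvPowerSeries.coeff p.1.1 f‖ₑ * p.1.1.prod fun i n => r i ^ n) *
        (‖MvPowerSeries.coeff p.1.2 g‖ₑ * p.1.2.prod fun i n => r i ^ n) := by
    intro d
    rw [Finset.tsum_subtype (Finset.HasAntidiagonal.antidiagonal d) (fun p =>
        (‖MvPowerSeries.coeff p.1 f‖ₑ * p.1.prod fun i n => r i ^ n) *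
        (‖MvPowerSeries.coeff p.2 g‖ₑ * p.2.prod fun i n => r i ^ n)),
      MvPowerSeries.coeff_mul]
    calc _ ≤ (∑ p ∈ Finset.HasAntidiagonal.antidiagonal d,
          ‖MvPowerSeries.coeff p.1 f * MvPowerSeries.coeff p.2 g‖ₑ) *
          (d.prod fun i n => r i ^ n) := by
          gcongr
          exact enorm_sum_le _ _
      _ = _ := by
          rw [Finset.sum_mul]
          refine Finset.sum_congr rfl fun p hp => ?_
          rw [← Finset.HasAntidiagonal.mem_antidiagonal.1 hp, enorm_mul,
            Finsupp.prod_add_index' (by simp) (fun _ _ _ => pow_add _ _ _)]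
          ring
  calc weightedNorm r (f * g) ≤ _ := ENNReal.tsum_le_tsum key
    _ = ∑' p : (σ →₀ ℕ) × (σ →₀ ℕ),
        (‖MvPowerSeries.coeff p.1 f‖ₑ * p.1.prod fun i n => r i ^ n) *
        (‖MvPowerSeries.coeff p.2 g‖ₑ * p.2.prod fun i n => r i ^ n) := by
        rw [← (Finset.HasAntidiagonal.sigmaAntidiagonalEquivProd (A := σ →₀ ℕ)).tsum_eq,
          ENNReal.tsum_sigma']
        rfl
    _ = weightedNorm r f * weightedNorm r g := by
        rw [ENNReal.tsum_prod', weightedNorm.eq_1 r f, ← ENNReal.tsum_mul_right]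
        refine tsum_congr fun d => ?_
        rw [weightedNorm, ← ENNReal.tsum_mul_left]

theorem weightedNorm_pow_le (r : σ → ℝ≥0∞) (f : MvPowerSeries σ ℂ) (n : ℕ) :
    weightedNorm r (f ^ n) ≤ weightedNorm r f ^ n := by
  induction n with
  | zero => simp [weightedNorm_one]
  | succ n ih =>
    rw [pow_succ, pow_succ]
    exact (weightedNorm_mul_le _ _ _).trans (by gcongr)

theorem weightedNorm_prod_le {ι : Type*} (r : σ → ℝ≥0∞) (s : Finset ι)
    (f : ι → MvPowerSeries σ ℂ) :
    weightedNorm r (∏ i ∈ s, f i) ≤ ∏ i ∈ s, weightedNorm r (f i) := by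
  classical
  induction s using Finset.induction_on with
  | empty => simp [weightedNorm_one]
  | insert i s hi ih =>
    rw [Finset.prod_insert hi, Finset.prod_insert hi]
    exact (weightedNorm_mul_le _ _ _).trans (by gcongr)

theorem weightedNorm_mono {r s : σ → ℝ≥0∞} (h : ∀ i, r i ≤ s i) (f : MvPowerSeries σ ℂ) :
    weightedNorm r f ≤ weightedNorm s f := by
  refine ENNReal.tsum_le_tsum fun d => ?_
  gcongr
  exact Finset.prod_le_prod' fun i _ => pow_le_pow_left' (h i) _

/-- The norm of a substitution `f(a)` is controlled by the norms of the series `a i`. -/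
theorem weightedNorm_subst_le {a : σ → MvPowerSeries τ ℂ} (ha : MvPowerSeries.HasSubst a)
    {r : τ → ℝ≥0∞} {R : σ → ℝ≥0∞} (h : ∀ i, weightedNorm r (a i) ≤ R i)
    (f : MvPowerSeries σ ℂ) :
    weightedNorm r (MvPowerSeries.subst a f) ≤ weightedNorm R f := by
  have key : ∀ e : τ →₀ ℕ, ‖MvPowerSeries.coeff e (MvPowerSeries.subst a f)‖ₑ ≤
      ∑' d : σ →₀ ℕ, ‖MvPowerSeries.coeff d f‖ₑ *
        ‖MvPowerSeries.coeff e (d.prod fun s n => a s ^ n)‖ₑ := by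
    intro e
    have hfin := MvPowerSeries.coeff_subst_finite ha f e
    rw [MvPowerSeries.coeff_subst ha, finsum_eq_sum _ hfin]
    calc _ ≤ ∑ d ∈ hfin.toFinset, ‖MvPowerSeries.coeff d f •
          MvPowerSeries.coeff e (d.prod fun s n => a s ^ n)‖ₑ := enorm_sum_le _ _
      _ = ∑ d ∈ hfin.toFinset, ‖MvPowerSeries.coeff d f‖ₑ *
          ‖MvPowerSeries.coeff e (d.prod fun s n => a s ^ n)‖ₑ := by
          simp [enorm_mul]
      _ ≤ _ := ENNReal.sum_le_tsum _
  calc weightedNorm r (MvPowerSeries.subst a f)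
      ≤ ∑' e : τ →₀ ℕ, (∑' d : σ →₀ ℕ, ‖MvPowerSeries.coeff d f‖ₑ *
        ‖MvPowerSeries.coeff e (d.prod fun s n => a s ^ n)‖ₑ) * e.prod fun i n => r i ^ n :=
        ENNReal.tsum_le_tsum fun e => by gcongr; exact key e
    _ = ∑' d : σ →₀ ℕ, ‖MvPowerSeries.coeff d f‖ₑ *
        weightedNorm r (d.prod fun s n => a s ^ n) := by
        simp_rw [← ENNReal.tsum_mul_right]
        rw [ENNReal.tsum_comm]
        refine tsum_congr fun d => ?_
        rw [weightedNorm, ← ENNReal.tsum_mul_left]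
        simp_rw [mul_assoc]
    _ ≤ weightedNorm R f := by
        refine ENNReal.tsum_le_tsum fun d => ?_
        gcongr
        refine (weightedNorm_prod_le _ _ _).trans (Finset.prod_le_prod' fun i _ => ?_)
        exact (weightedNorm_pow_le _ _ _).trans (pow_le_pow_left' (h i) _)

/-- A formal power series converges if it is absolutely summable on a polydisc of positive
radius. -/
def Converges (f : MvPowerSeries σ ℂ) : Prop :=
  ∃ r : ℝ≥0∞, 0 < r ∧ weightedNorm (fun _ => r) f < ⊤

theorem Converges.exists_le {f : MvPowerSeries σ ℂ} (hf : Converges f) {s : ℝ≥0∞} (hs : 0 < s) :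
    ∃ r : ℝ≥0∞, 0 < r ∧ r ≤ s ∧ weightedNorm (fun _ => r) f < ⊤ := by
  obtain ⟨r, hr, h⟩ := hf
  exact ⟨min r s, lt_min hr hs, min_le_right _ _,
    (weightedNorm_mono (fun _ => min_le_left _ _) f).trans_lt h⟩

theorem prod_pow_const (d : σ →₀ ℕ) (r : ℝ≥0∞) : (d.prod fun _ n => r ^ n) = r ^ d.degree := by
  rw [Finsupp.prod, Finset.prod_pow_eq_pow_sum, Finsupp.degree_apply]

theorem weightedNorm_mul_const_le {f : MvPowerSeries σ ℂ}
    (h0 : MvPowerSeries.constantCoeff f = 0) {c : ℝ≥0∞} (hc : c ≤ 1) (r : ℝ≥0∞) :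
    weightedNorm (fun _ => c * r) f ≤ c * weightedNorm (fun _ => r) f := by
  unfold weightedNorm
  rw [← ENNReal.tsum_mul_left]
  refine ENNReal.tsum_le_tsum fun d => ?_
  rw [prod_pow_const, prod_pow_const]
  rcases eq_or_ne d 0 with rfl | hd
  · rw [MvPowerSeries.coeff_zero_eq_constantCoeff_apply, h0]
    simp
  · have hd' : d.degree ≠ 0 := by simpa [Finsupp.degree_eq_zero_iff] using hd
    rw [mul_pow]
    calc _ = c ^ d.degree * (‖MvPowerSeries.coeff d f‖ₑ * r ^ d.degree) := by ring
      _ ≤ c * _ := by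
        gcongr
        exact pow_le_of_le_one (zero_le) hc hd'

/-- A convergent series without constant term is arbitrarily small on small polydiscs. -/
theorem Converges.exists_small {f : MvPowerSeries σ ℂ} (hf : Converges f)
    (h0 : MvPowerSeries.constantCoeff f = 0) {ε : ℝ≥0∞} (hε : 0 < ε) :
    ∃ r : ℝ≥0∞, 0 < r ∧ ∀ s ≤ r, weightedNorm (fun _ => s) f ≤ ε := by
  obtain ⟨r, hr, hr1, h⟩ := hf.exists_le one_pos
  set N := weightedNorm (fun _ => r) f
  have hN : N + 1 ≠ ⊤ := by simp [h.ne]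
  have hN0 : N + 1 ≠ 0 := by simp
  set c := min 1 (ε / (N + 1))
  have hc : 0 < c := lt_min one_pos (ENNReal.div_pos hε.ne' hN)
  refine ⟨c * r, ENNReal.mul_pos hc.ne' hr.ne', fun s hs => ?_⟩
  refine (weightedNorm_mono (fun _ => hs) f).trans ?_
  refine (weightedNorm_mul_const_le h0 (min_le_left _ _) r).trans ?_
  calc c * N ≤ (ε / (N + 1)) * (N + 1) := by
        gcongr
        · exact min_le_right _ _
        · exact le_self_add
    _ = ε := ENNReal.div_mul_cancel hN0 hN

theorem Converges.add {f g : MvPowerSeries σ ℂ} (hf : Converges f) (hg : Converges g) :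
    Converges (f + g) := by
  obtain ⟨r, hr, h⟩ := hf
  obtain ⟨s, hs, hsr, h'⟩ := hg.exists_le hr
  exact ⟨s, hs, (weightedNorm_add_le _ _ _).trans_lt
    (ENNReal.add_lt_top.2 ⟨(weightedNorm_mono (fun _ => hsr) f).trans_lt h, h'⟩)⟩

theorem Converges.mul {f g : MvPowerSeries σ ℂ} (hf : Converges f) (hg : Converges g) :
    Converges (f * g) := by
  obtain ⟨r, hr, h⟩ := hf
  obtain ⟨s, hs, hsr, h'⟩ := hg.exists_le hr
  exact ⟨s, hs, (weightedNorm_mul_le _ _ _).trans_lt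
    (ENNReal.mul_lt_top ((weightedNorm_mono (fun _ => hsr) f).trans_lt h) h')⟩

theorem Converges.neg {f : MvPowerSeries σ ℂ} (hf : Converges f) : Converges (-f) := by
  obtain ⟨r, hr, h⟩ := hf
  exact ⟨r, hr, by rwa [weightedNorm_neg]⟩

theorem Converges.sub {f g : MvPowerSeries σ ℂ} (hf : Converges f) (hg : Converges g) :
    Converges (f - g) := sub_eq_add_neg f g ▸ hf.add hg.neg

theorem Converges.smul {f : MvPowerSeries σ ℂ} (hf : Converges f) (c : ℂ) :
    Converges (c • f) := by
  obtain ⟨r, hr, h⟩ := hf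
  exact ⟨r, hr, by
    rw [weightedNorm_smul]
    exact ENNReal.mul_lt_top enorm_lt_top h⟩

theorem converges_one : Converges (1 : MvPowerSeries σ ℂ) :=
  ⟨1, one_pos, by simp [weightedNorm_one]⟩

theorem converges_C (c : ℂ) : Converges (MvPowerSeries.C c : MvPowerSeries σ ℂ) := by
  have := (converges_one (σ := σ)).smul c
  rwa [MvPowerSeries.smul_eq_C_mul, mul_one] at this

theorem converges_zero : Converges (0 : MvPowerSeries σ ℂ) := by
  simpa using (converges_one (σ := σ)).smul 0

theorem converges_X (i : σ) : Converges (MvPowerSeries.X i : MvPowerSeries σ ℂ) :=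
  ⟨1, one_pos, by simp [weightedNorm_X]⟩

theorem Converges.pow {f : MvPowerSeries σ ℂ} (hf : Converges f) (n : ℕ) :
    Converges (f ^ n) := by
  induction n with
  | zero => simpa using converges_one
  | succ n ih => rw [pow_succ]; exact ih.mul hf

theorem Converges.subst [Finite σ] {a : σ → MvPowerSeries τ ℂ} {f : MvPowerSeries σ ℂ}
    (hf : Converges f) (ha : ∀ i, Converges (a i))
    (h0 : ∀ i, MvPowerSeries.constantCoeff (a i) = 0) :
    Converges (MvPowerSeries.subst a f) := by
  obtain ⟨R, hR, h⟩ := hf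
  choose r hr hr' using fun i => (ha i).exists_small (h0 i) hR
  have : Fintype σ := Fintype.ofFinite σ
  obtain ⟨s, hs, hs'⟩ : ∃ s : ℝ≥0∞, 0 < s ∧ ∀ i, s ≤ r i := by
    refine ⟨Finset.univ.inf r, ?_, fun i => Finset.inf_le (Finset.mem_univ i)⟩
    exact (Finset.lt_inf_iff ENNReal.zero_lt_top).2 fun i _ => hr i
  exact ⟨s, hs, (weightedNorm_subst_le (MvPowerSeries.hasSubst_of_constantCoeff_zero h0)
    (fun i => hr' i s (hs' i)) f).trans_lt h⟩

/-- A series whose coefficients, up to a shift of the exponents and a geometric factor, are bounded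
by those of a convergent series converges. -/
theorem Converges.of_coeff_le {f : MvPowerSeries σ ℂ} {g : MvPowerSeries τ ℂ} (hf : Converges f)
    (φ : (τ →₀ ℕ) → (σ →₀ ℕ)) (hφ : Function.Injective φ) (m : ℕ)
    (hm : ∀ d, (φ d).degree ≤ m * d.degree + m) (c : ℝ≥0∞) (hc : c ≠ ⊤)
    (h : ∀ d, ‖MvPowerSeries.coeff d g‖ₑ ≤ c ^ d.degree * ‖MvPowerSeries.coeff (φ d) f‖ₑ) :
    Converges g := by
  obtain ⟨r, hr, hr1, hN⟩ := hf.exists_le one_pos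
  have hrt : r ≠ ⊤ := (hr1.trans_lt ENNReal.one_lt_top).ne
  have hc1 : c + 1 ≠ ⊤ := by simp [hc]
  refine ⟨r ^ m / (c + 1), ENNReal.div_pos (pow_ne_zero m hr.ne') hc1, ?_⟩
  have hb : c * (r ^ m / (c + 1)) ≤ r ^ m := by
    calc c * (r ^ m / (c + 1)) ≤ (c + 1) * (r ^ m / (c + 1)) := by gcongr; exact le_self_add
      _ = r ^ m := ENNReal.mul_div_cancel (by simp) hc1
  have hrm0 : r ^ m ≠ 0 := (pow_ne_zero m hr.ne')
  have hrmt : r ^ m ≠ ⊤ := ENNReal.pow_ne_top hrt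
  have key : weightedNorm (fun _ => r ^ m / (c + 1)) g ≤
      (r ^ m)⁻¹ * weightedNorm (fun _ => r) f := by
    unfold weightedNorm
    calc _ ≤ ∑' d : τ →₀ ℕ, (r ^ m)⁻¹ * (‖MvPowerSeries.coeff (φ d) f‖ₑ *
          ((φ d).prod fun _ n => r ^ n)) := by
          refine ENNReal.tsum_le_tsum fun d => ?_
          rw [prod_pow_const, prod_pow_const]
          calc _ ≤ (c ^ d.degree * ‖MvPowerSeries.coeff (φ d) f‖ₑ) *
                (r ^ m / (c + 1)) ^ d.degree := by gcongr; exact h d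
            _ = ‖MvPowerSeries.coeff (φ d) f‖ₑ * (c * (r ^ m / (c + 1))) ^ d.degree := by
                rw [mul_pow]; ring
            _ ≤ ‖MvPowerSeries.coeff (φ d) f‖ₑ * (r ^ m) ^ d.degree := by gcongr
            _ = ‖MvPowerSeries.coeff (φ d) f‖ₑ * ((r ^ m)⁻¹ * r ^ (m * d.degree + m)) := by
                rw [pow_add, ← pow_mul, mul_comm (r ^ (m * d.degree)), ← mul_assoc (r ^ m)⁻¹,
                  ENNReal.inv_mul_cancel hrm0 hrmt, one_mul]
            _ ≤ ‖MvPowerSeries.coeff (φ d) f‖ₑ * ((r ^ m)⁻¹ * r ^ (φ d).degree) := by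
                gcongr _ * (_ * ?_)
                exact pow_le_pow_right_of_le_one' hr1 (hm d)
            _ = _ := by ring
      _ = (r ^ m)⁻¹ * ∑' d : τ →₀ ℕ, (‖MvPowerSeries.coeff (φ d) f‖ₑ *
          ((φ d).prod fun _ n => r ^ n)) := ENNReal.tsum_mul_left
      _ ≤ _ := by
          gcongr
          exact ENNReal.tsum_comp_le_tsum_of_injective hφ
            (fun d : σ →₀ ℕ => ‖MvPowerSeries.coeff d f‖ₑ * (d.prod fun _ n => r ^ n))
  exact key.trans_lt (ENNReal.mul_lt_top (ENNReal.inv_lt_top.2 (pos_iff_ne_zero.2 hrm0)) hN)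

theorem Converges.of_X_pow_mul {f : MvPowerSeries σ ℂ} {i : σ} {k : ℕ}
    (hf : Converges (MvPowerSeries.X i ^ k * f)) : Converges f := by
  classical
  refine hf.of_coeff_le (fun d => Finsupp.single i k + d) (add_right_injective _) (k + 1) ?_ 1
    (by simp) fun d => ?_
  · intro d
    simp only [map_add, Finsupp.degree_single]
    nlinarith
  · rw [MvPowerSeries.X_pow_eq, MvPowerSeries.coeff_add_monomial_mul]
    simp

theorem Converges.pderiv {f : MvPowerSeries σ ℂ} (hf : Converges f) (i : σ) :
    Converges (MvPowerSeries.pderiv ℂ i f) := by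
  refine hf.of_coeff_le (fun d => d + Finsupp.single i 1) (add_left_injective _) 1 ?_ 2
    (by simp) fun d => ?_
  · intro d
    simp
  · rw [MvPowerSeries.coeff_pderiv, enorm_mul, mul_comm]
    gcongr
    have h1 : ‖((d i : ℂ) + 1)‖ₑ = ((d i + 1 : ℕ) : ℝ≥0∞) := by
      have : ((d i : ℂ) + 1) = ((d i + 1 : ℕ) : ℂ) := by push_cast; rfl
      rw [this, ← ofReal_norm, Complex.norm_natCast, ENNReal.ofReal_natCast]
    rw [h1]
    have h2 : d i + 1 ≤ 2 ^ d.degree :=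
      (Nat.lt_two_pow_self).trans_le (Nat.pow_le_pow_right two_pos (Finsupp.le_degree i d))
    exact_mod_cast h2

theorem mem_convergentSeries_iff {f : MvPowerSeries (Fin 2) ℂ} :
    f ∈ ConvergentSeries ↔ Converges f := by
  have key : ∀ r : ℝ, 0 < r →
      ((Summable fun n : Fin 2 →₀ ℕ => ‖MvPowerSeries.coeff n f‖ * r ^ n.degree) ↔
        weightedNorm (fun _ => ENNReal.ofReal r) f < ⊤) := by
    intro r hr
    rw [weightedNorm, lt_top_iff_ne_top, ← summable_norm_iff]
    have : ∀ n : Fin 2 →₀ ℕ, ‖MvPowerSeries.coeff n f‖ₑ *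
        (n.prod fun _ m => ENNReal.ofReal r ^ m) =
        ((‖(‖MvPowerSeries.coeff n f‖ * r ^ n.degree)‖₊ : NNReal) : ℝ≥0∞) := by
      intro n
      rw [prod_pow_const, ← enorm_eq_nnnorm, enorm_mul, enorm_pow, enorm_norm,
        Real.enorm_of_nonneg hr.le]
    simp_rw [this]
    rw [ENNReal.tsum_coe_ne_top_iff_summable, ← NNReal.summable_coe]
    rfl
  constructor
  · rintro ⟨r, hr, h⟩
    exact ⟨ENNReal.ofReal r, by simpa using hr, (key r hr).1 h⟩
  · intro hf
    obtain ⟨r, hr, hr1, h⟩ := hf.exists_le one_pos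
    have hrt : r ≠ ⊤ := (hr1.trans_lt ENNReal.one_lt_top).ne
    have hr' : 0 < r.toReal := ENNReal.toReal_pos hr.ne' hrt
    refine ⟨r.toReal, hr', (key _ hr').2 ?_⟩
    rwa [ENNReal.ofReal_toReal hrt]

end WeightedNorm

/-! ### Substitutions and the implicit function theorem -/

section Substitution

variable {τ υ : Type*}

theorem hasSubst_pair {a b : MvPowerSeries τ ℂ} (ha : MvPowerSeries.constantCoeff a = 0)
    (hb : MvPowerSeries.constantCoeff b = 0) : MvPowerSeries.HasSubst ![a, b] :=
  MvPowerSeries.hasSubst_of_constantCoeff_zero (Fin.forall_fin_two.2 ⟨ha, hb⟩)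

theorem subst_pair_X_zero {a b : MvPowerSeries τ ℂ} (ha : MvPowerSeries.constantCoeff a = 0)
    (hb : MvPowerSeries.constantCoeff b = 0) :
    MvPowerSeries.subst ![a, b] (MvPowerSeries.X 0 : MvPowerSeries (Fin 2) ℂ) = a := by
  rw [MvPowerSeries.subst_X (hasSubst_pair ha hb)]; rfl

theorem subst_pair_X_one {a b : MvPowerSeries τ ℂ} (ha : MvPowerSeries.constantCoeff a = 0)
    (hb : MvPowerSeries.constantCoeff b = 0) :
    MvPowerSeries.subst ![a, b] (MvPowerSeries.X 1 : MvPowerSeries (Fin 2) ℂ) = b := by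
  rw [MvPowerSeries.subst_X (hasSubst_pair ha hb)]; rfl

theorem constantCoeff_subst_of_zero {σ : Type*} [Finite σ] {a : σ → MvPowerSeries τ ℂ}
    (ha : ∀ i, MvPowerSeries.constantCoeff (a i) = 0) (f : MvPowerSeries σ ℂ) :
    MvPowerSeries.constantCoeff (MvPowerSeries.subst a f) = MvPowerSeries.constantCoeff f := by
  have h := MvPowerSeries.hasSubst_of_constantCoeff_zero ha
  have h2 : f = (f - MvPowerSeries.C (MvPowerSeries.constantCoeff f)) +
      MvPowerSeries.C (MvPowerSeries.constantCoeff f) := by ring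
  conv_lhs => rw [h2]
  rw [MvPowerSeries.subst_add h, MvPowerSeries.subst_C, map_add,
    MvPowerSeries.constantCoeff_subst_eq_zero h ha (by simp)]
  simp

theorem subst_subst_pair {a b : MvPowerSeries τ ℂ} (ha : MvPowerSeries.constantCoeff a = 0)
    (hb : MvPowerSeries.constantCoeff b = 0) {c : τ → MvPowerSeries υ ℂ}
    (hc : MvPowerSeries.HasSubst c) (f : MvPowerSeries (Fin 2) ℂ) :
    MvPowerSeries.subst c (MvPowerSeries.subst ![a, b] f) =
      MvPowerSeries.subst ![MvPowerSeries.subst c a, MvPowerSeries.subst c b] f := by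
  rw [MvPowerSeries.subst_comp_subst_apply (hasSubst_pair ha hb) hc]
  congr 1
  funext i
  fin_cases i <;> rfl

theorem subst_pair_self (f : MvPowerSeries (Fin 2) ℂ) :
    MvPowerSeries.subst ![MvPowerSeries.X 0, MvPowerSeries.X 1] f = f := by
  have : (![MvPowerSeries.X 0, MvPowerSeries.X 1] : Fin 2 → MvPowerSeries (Fin 2) ℂ) =
      MvPowerSeries.X := by
    funext i
    fin_cases i <;> rfl
  rw [this, MvPowerSeries.subst_self]
  rfl

theorem subst_powerSeries_subst {σ : Type*} {a : MvPowerSeries σ ℂ}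
    (ha : MvPowerSeries.constantCoeff a = 0) {c : σ → MvPowerSeries υ ℂ}
    (hc : MvPowerSeries.HasSubst c) (ξ : ℂ⟦X⟧) :
    MvPowerSeries.subst c (PowerSeries.subst a ξ) =
      PowerSeries.subst (MvPowerSeries.subst c a) ξ := by
  unfold PowerSeries.subst
  rw [MvPowerSeries.subst_comp_subst_apply
    (MvPowerSeries.hasSubst_of_constantCoeff_zero fun _ => ha) hc]

theorem Converges.subst_pair {a b : MvPowerSeries τ ℂ} {f : MvPowerSeries (Fin 2) ℂ}
    (hf : Converges f) (ha : Converges a) (hb : Converges b)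
    (ha0 : MvPowerSeries.constantCoeff a = 0) (hb0 : MvPowerSeries.constantCoeff b = 0) :
    Converges (MvPowerSeries.subst ![a, b] f) :=
  hf.subst (Fin.forall_fin_two.2 ⟨ha, hb⟩) (Fin.forall_fin_two.2 ⟨ha0, hb0⟩)

theorem Converges.powerSeries_subst {a : MvPowerSeries τ ℂ} {ξ : ℂ⟦X⟧}
    (hξ : Converges ξ) (ha : Converges a) (ha0 : MvPowerSeries.constantCoeff a = 0) :
    Converges (PowerSeries.subst a ξ) :=
  Converges.subst hξ (fun _ => ha) (fun _ => ha0)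

theorem constantCoeff_powerSeries_subst {a : MvPowerSeries τ ℂ} (ξ : ℂ⟦X⟧)
    (ha0 : MvPowerSeries.constantCoeff a = 0) :
    MvPowerSeries.constantCoeff (PowerSeries.subst a ξ) = PowerSeries.constantCoeff ξ :=
  constantCoeff_subst_of_zero (σ := Unit) (fun _ => ha0) ξ

theorem prod_pair (a : Fin 2 → MvPowerSeries τ ℂ) (d : Fin 2 →₀ ℕ) :
    (d.prod fun s e => a s ^ e) = a 0 ^ d 0 * a 1 ^ d 1 := by
  rw [Finsupp.prod_fintype _ _ (by simp), Fin.prod_univ_two]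

theorem coeff_subst_pair {a b : MvPowerSeries τ ℂ} (ha : MvPowerSeries.constantCoeff a = 0)
    (hb : MvPowerSeries.constantCoeff b = 0) (f : MvPowerSeries (Fin 2) ℂ) (e : τ →₀ ℕ) :
    MvPowerSeries.coeff e (MvPowerSeries.subst ![a, b] f) =
      ∑ᶠ d : Fin 2 →₀ ℕ, MvPowerSeries.coeff d f * MvPowerSeries.coeff e (a ^ d 0 * b ^ d 1) := by
  rw [MvPowerSeries.coeff_subst (hasSubst_pair ha hb)]
  simp_rw [prod_pair, smul_eq_mul]
  rfl

theorem coeff_subst_pair_finite {a b : MvPowerSeries τ ℂ}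
    (ha : MvPowerSeries.constantCoeff a = 0) (hb : MvPowerSeries.constantCoeff b = 0)
    (f : MvPowerSeries (Fin 2) ℂ) (e : τ →₀ ℕ) :
    (Function.support fun d : Fin 2 →₀ ℕ =>
      MvPowerSeries.coeff d f * MvPowerSeries.coeff e (a ^ d 0 * b ^ d 1)).Finite := by
  have := MvPowerSeries.coeff_subst_finite (hasSubst_pair ha hb) f e
  simp_rw [prod_pair, smul_eq_mul] at this
  exact this

end Substitution

section ImplicitFunction

/-- If `G` has no term of degree one in `y` alone, then `y ↦ G(x, y)` is contracting for the
`x`-adic topology on series without constant term. -/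
theorem X_pow_succ_dvd_subst_sub {G : MvPowerSeries (Fin 2) ℂ}
    (h1 : MvPowerSeries.coeff (Finsupp.single 1 1) G = 0) {u v : ℂ⟦X⟧}
    (hu : PowerSeries.constantCoeff u = 0) (hv : PowerSeries.constantCoeff v = 0) {m : ℕ}
    (h : (PowerSeries.X : ℂ⟦X⟧) ^ m ∣ u - v) :
    (PowerSeries.X : ℂ⟦X⟧) ^ (m + 1) ∣
      (MvPowerSeries.subst ![(PowerSeries.X : ℂ⟦X⟧), u] G : ℂ⟦X⟧) -
        (MvPowerSeries.subst ![(PowerSeries.X : ℂ⟦X⟧), v] G : ℂ⟦X⟧) := by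
  have hX : PowerSeries.constantCoeff (PowerSeries.X : ℂ⟦X⟧) = 0 := by simp
  have key : ∀ d : Fin 2 →₀ ℕ, MvPowerSeries.coeff d G = 0 ∨ (PowerSeries.X : ℂ⟦X⟧) ^ (m + 1) ∣
      PowerSeries.X ^ d 0 * u ^ d 1 - PowerSeries.X ^ d 0 * v ^ d 1 := by
    intro d
    rw [← mul_sub]
    rcases Nat.eq_zero_or_pos (d 0) with h0 | h0
    · rw [h0, pow_zero, one_mul]
      rcases Nat.lt_trichotomy (d 1) 1 with h2 | h2 | h2
      · right
        have : d 1 = 0 := by omega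
        simp [this]
      · left
        have : d = Finsupp.single 1 1 := by
          ext i
          fin_cases i
          · simpa using h0
          · simpa using h2
        rw [this, h1]
      · right
        obtain ⟨k, hk⟩ : ∃ k, d 1 = k + 2 := ⟨d 1 - 2, by omega⟩
        have hxu : (PowerSeries.X : ℂ⟦X⟧) ∣ u := PowerSeries.X_dvd_iff.2 hu
        have hxv : (PowerSeries.X : ℂ⟦X⟧) ∣ v := PowerSeries.X_dvd_iff.2 hv
        have e : u ^ (k + 2) - v ^ (k + 2) =
            (u ^ (k + 1) - v ^ (k + 1)) * u + v ^ (k + 1) * (u - v) := by ring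
        rw [hk, e, pow_succ]
        refine dvd_add (mul_dvd_mul (h.trans (sub_dvd_pow_sub_pow _ _ _)) hxu) ?_
        rw [mul_comm]
        exact mul_dvd_mul (hxv.trans (dvd_pow_self v (by omega))) h
    · right
      rw [pow_succ']
      exact mul_dvd_mul (dvd_pow_self _ (by omega)) (h.trans (sub_dvd_pow_sub_pow _ _ _))
  rw [PowerSeries.X_pow_dvd_iff]
  intro k hk
  rw [map_sub]
  unfold PowerSeries.coeff
  rw [coeff_subst_pair hX hu, coeff_subst_pair hX hv,
    ← finsum_sub_distrib (coeff_subst_pair_finite hX hu G _)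
      (coeff_subst_pair_finite hX hv G _)]
  refine finsum_eq_zero_of_forall_eq_zero fun d => ?_
  rw [← mul_sub, ← map_sub]
  rcases key d with h0 | h0
  · rw [h0, zero_mul]
  · exact mul_eq_zero_of_right _ (PowerSeries.X_pow_dvd_iff.1 h0 k hk)

/-- A series `G` without terms `1` and `y` maps a suitable polydisc `|x| ≤ r`, `|y| ≤ s` to
`|G| ≤ s`. This is where the weights `2` of `x` and `1` of `y` make all the terms of `G` small. -/
theorem exists_weightedNorm_pair_le {G : MvPowerSeries (Fin 2) ℂ} (hG : Converges G)
    (h0 : MvPowerSeries.constantCoeff G = 0)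
    (h1 : MvPowerSeries.coeff (Finsupp.single 1 1) G = 0) :
    ∃ r s : ℝ≥0∞, 0 < r ∧ s < ⊤ ∧ weightedNorm ![r, s] G ≤ s := by
  obtain ⟨ρ, hρ, hρ1, hN⟩ := hG.exists_le one_pos
  have hρt : ρ ≠ ⊤ := (hρ1.trans_lt ENNReal.one_lt_top).ne
  set N := weightedNorm (fun _ => ρ) G
  have hN' : N + 1 ≠ ⊤ := by simp [hN.ne]
  set ε := min 1 (ρ / (N + 1))
  have hε : 0 < ε := lt_min one_pos (ENNReal.div_pos hρ.ne' hN')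
  have hε1 : ε ≤ 1 := min_le_left _ _
  refine ⟨ε ^ 2 * ρ, ε * ρ, ENNReal.mul_pos (pow_ne_zero 2 hε.ne') hρ.ne',
    ENNReal.mul_lt_top (hε1.trans_lt ENNReal.one_lt_top) hρt.lt_top, ?_⟩
  have key : weightedNorm ![ε ^ 2 * ρ, ε * ρ] G ≤ ε ^ 2 * N := by
    rw [show N = weightedNorm (fun _ => ρ) G from rfl]
    unfold weightedNorm
    rw [← ENNReal.tsum_mul_left]
    refine ENNReal.tsum_le_tsum fun d => ?_
    rw [Finsupp.prod_fintype _ _ (by simp), Finsupp.prod_fintype _ _ (by simp),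
      Fin.prod_univ_two, Fin.prod_univ_two]
    by_cases hd : 2 ≤ 2 * d 0 + d 1
    · simp only [Matrix.cons_val_zero, Matrix.cons_val_one]
      calc _ = ε ^ (2 * d 0 + d 1) * (‖MvPowerSeries.coeff d G‖ₑ * (ρ ^ d 0 * ρ ^ d 1)) := by
            rw [mul_pow, mul_pow, ← pow_mul, pow_add]; ring
        _ ≤ _ := by
            gcongr ?_ * _
            exact pow_le_pow_right_of_le_one' hε1 hd
    · have : MvPowerSeries.coeff d G = 0 := by
        have h00 : d 0 = 0 := by omega
        rcases Nat.eq_zero_or_pos (d 1) with h11 | h11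
        · have : d = 0 := by
            ext i
            fin_cases i
            · simpa using h00
            · simpa using h11
          rw [this, MvPowerSeries.coeff_zero_eq_constantCoeff_apply, h0]
        · have : d = Finsupp.single 1 1 := by
            ext i
            fin_cases i
            · simpa using h00
            · simp; omega
          rw [this, h1]
      simp [this]
  refine key.trans ?_
  calc ε ^ 2 * N = ε * (ε * N) := by ring
    _ ≤ ε * (ρ / (N + 1) * (N + 1)) := by
        gcongr
        · exact min_le_right _ _
        · exact le_self_add
    _ = ε * ρ := by rw [ENNReal.div_mul_cancel (by simp) hN']

/-- The fixed point of `y ↦ G(x, y)`, for `G` convergent without terms `1` and `y`. It is the limit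
of the iterates of `0`, whose norms stay bounded on a fixed disc. -/
theorem exists_fixed_point {G : MvPowerSeries (Fin 2) ℂ} (hG : Converges G)
    (h0 : MvPowerSeries.constantCoeff G = 0)
    (h1 : MvPowerSeries.coeff (Finsupp.single 1 1) G = 0) :
    ∃ ξ : ℂ⟦X⟧, Converges ξ ∧ PowerSeries.constantCoeff ξ = 0 ∧
      (MvPowerSeries.subst ![(PowerSeries.X : ℂ⟦X⟧), ξ] G : ℂ⟦X⟧) = ξ := by
  have hX : PowerSeries.constantCoeff (PowerSeries.X : ℂ⟦X⟧) = 0 := by simp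
  let T : ℂ⟦X⟧ → ℂ⟦X⟧ := fun u => MvPowerSeries.subst ![(PowerSeries.X : ℂ⟦X⟧), u] G
  let u : ℕ → ℂ⟦X⟧ := fun n => T^[n] 0
  have hu_succ : ∀ n, u (n + 1) = T (u n) := fun n => Function.iterate_succ_apply' T n 0
  have hu0 : ∀ n, PowerSeries.constantCoeff (u n) = 0 := by
    intro n
    induction n with
    | zero => simp [u]
    | succ n ih =>
      rw [hu_succ]
      exact (constantCoeff_subst_of_zero (Fin.forall_fin_two.2 ⟨hX, ih⟩) G).trans h0
  have hstep : ∀ n, (PowerSeries.X : ℂ⟦X⟧) ^ (n + 1) ∣ u (n + 1) - u n := by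
    intro n
    induction n with
    | zero =>
      rw [zero_add, pow_one, PowerSeries.X_dvd_iff, map_sub, hu0, hu0, sub_zero]
    | succ n ih =>
      rw [hu_succ (n + 1)]
      nth_rw 2 [hu_succ n]
      exact X_pow_succ_dvd_subst_sub h1 (hu0 _) (hu0 _) ih
  -- The coefficient of degree `m` is constant from the `m`-th iterate on.
  have hcoeff : ∀ m n, m ≤ n → PowerSeries.coeff m (u n) = PowerSeries.coeff m (u m) := by
    intro m n hmn
    induction n, hmn using Nat.le_induction with
    | base => rfl
    | succ n hmn ih =>
      have := PowerSeries.X_pow_dvd_iff.1 (hstep n) m (by omega)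
      rw [map_sub, sub_eq_zero] at this
      rw [this, ih]
  let ξ : ℂ⟦X⟧ := PowerSeries.mk fun n => PowerSeries.coeff n (u n)
  have hξ : ∀ m n, m ≤ n → PowerSeries.coeff m (u n) = PowerSeries.coeff m ξ := by
    intro m n hmn
    rw [hcoeff m n hmn, PowerSeries.coeff_mk]
  have hξ0 : PowerSeries.constantCoeff ξ = 0 := by
    rw [← PowerSeries.coeff_zero_eq_constantCoeff_apply, ← hξ 0 0 le_rfl,
      PowerSeries.coeff_zero_eq_constantCoeff_apply, hu0]
  refine ⟨ξ, ?_, hξ0, ?_⟩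
  · obtain ⟨r, s, hr, hs, hrs⟩ := exists_weightedNorm_pair_le hG h0 h1
    have hbound : ∀ n, weightedNorm (fun _ => r) (u n) ≤ s := by
      intro n
      induction n with
      | zero => simp [u, weightedNorm]
      | succ n ih =>
        rw [hu_succ]
        refine (weightedNorm_subst_le (hasSubst_pair hX (hu0 n)) ?_ G).trans hrs
        exact Fin.forall_fin_two.2 ⟨(weightedNorm_X (σ := Unit) _ ()).le, ih⟩
    refine ⟨r, hr, lt_of_le_of_lt ?_ hs⟩
    -- Each partial sum of the norm of `ξ` is a partial sum of the norm of some iterate.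
    rw [weightedNorm, ENNReal.tsum_eq_iSup_sum]
    refine iSup_le fun S => ?_
    refine le_trans (le_of_eq ?_) ((ENNReal.sum_le_tsum S).trans (hbound (S.sup fun d => d ())))
    refine Finset.sum_congr rfl fun d hd => ?_
    have hd' : Finsupp.single () (d ()) = d := by ext; simp
    have := hξ (d ()) _ (Finset.le_sup (f := fun d : Unit →₀ ℕ => d ()) hd)
    unfold PowerSeries.coeff at this
    rw [hd'] at this
    rw [this]
  · ext n
    have hdvd : (PowerSeries.X : ℂ⟦X⟧) ^ (n + 1) ∣ ξ - u n := by
      rw [PowerSeries.X_pow_dvd_iff]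
      intro m hm
      rw [map_sub, hξ m n (by omega), sub_self]
    have h2 := PowerSeries.X_pow_dvd_iff.1
      (X_pow_succ_dvd_subst_sub h1 hξ0 (hu0 n) hdvd) n (by omega)
    rw [map_sub, sub_eq_zero] at h2
    rw [h2, ← hξ n (n + 1) (by omega), hu_succ]

/-- The implicit function theorem for convergent power series. -/
theorem exists_implicit_function {F : MvPowerSeries (Fin 2) ℂ} (hF : Converges F)
    (h0 : MvPowerSeries.constantCoeff F = 0)
    (h1 : MvPowerSeries.coeff (Finsupp.single 1 1) F ≠ 0) :
    ∃ ξ : ℂ⟦X⟧, Converges ξ ∧ PowerSeries.constantCoeff ξ = 0 ∧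
      (MvPowerSeries.subst ![(PowerSeries.X : ℂ⟦X⟧), ξ] F : ℂ⟦X⟧) = 0 := by
  have hX : PowerSeries.constantCoeff (PowerSeries.X : ℂ⟦X⟧) = 0 := by simp
  set b := MvPowerSeries.coeff (Finsupp.single 1 1) F with hb
  obtain ⟨ξ, hξ, hξ0, h⟩ := exists_fixed_point (G := MvPowerSeries.X 1 - b⁻¹ • F)
    ((converges_X 1).sub (hF.smul _)) (by simp [h0])
    (by
      rw [map_sub, map_smul, smul_eq_mul, ← hb, inv_mul_cancel₀ h1, MvPowerSeries.coeff_X]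
      simp)
  refine ⟨ξ, hξ, hξ0, ?_⟩
  rw [MvPowerSeries.subst_sub (hasSubst_pair hX hξ0), subst_pair_X_one hX hξ0,
    MvPowerSeries.subst_smul (hasSubst_pair hX hξ0), sub_eq_self] at h
  exact (smul_eq_zero.1 h).resolve_left (inv_ne_zero h1)

end ImplicitFunction

/-! ### Existence of Newton-Puiseux roots -/

section NewtonPuiseux

/-- The one-variable series `ξ(x)`, seen as a series in `x` and `y`. -/
noncomputable def ofX (ξ : ℂ⟦X⟧) : MvPowerSeries (Fin 2) ℂ :=
  PowerSeries.subst (MvPowerSeries.X 0 : MvPowerSeries (Fin 2) ℂ) ξ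

/-- The series `F(x, y + α(x))`. -/
noncomputable def translateY (α : ℂ⟦X⟧) (F : MvPowerSeries (Fin 2) ℂ) : MvPowerSeries (Fin 2) ℂ :=
  MvPowerSeries.subst ![MvPowerSeries.X 0, MvPowerSeries.X 1 + ofX α] F

theorem constantCoeff_ofX (ξ : ℂ⟦X⟧) :
    MvPowerSeries.constantCoeff (ofX ξ) = PowerSeries.constantCoeff ξ :=
  constantCoeff_powerSeries_subst ξ (by simp)

theorem Converges.ofX {ξ : ℂ⟦X⟧} (hξ : Converges ξ) : Converges (ofX ξ) :=
  hξ.powerSeries_subst (converges_X 0) (by simp)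

theorem subst_ofX {υ : Type*} {a b : MvPowerSeries υ ℂ}
    (ha : MvPowerSeries.constantCoeff a = 0) (hb : MvPowerSeries.constantCoeff b = 0) (ξ : ℂ⟦X⟧) :
    MvPowerSeries.subst ![a, b] (ofX ξ) = PowerSeries.subst a ξ := by
  rw [ofX, subst_powerSeries_subst (by simp) (hasSubst_pair ha hb), subst_pair_X_zero ha hb]

theorem constantCoeff_X_one_add_ofX {α : ℂ⟦X⟧} (h : PowerSeries.constantCoeff α = 0) :
    MvPowerSeries.constantCoeff (MvPowerSeries.X 1 + ofX α) = 0 := by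
  rw [map_add, constantCoeff_ofX, h]; simp

theorem Converges.translateY {α : ℂ⟦X⟧} {F : MvPowerSeries (Fin 2) ℂ} (hF : Converges F)
    (hα : Converges α) (h : PowerSeries.constantCoeff α = 0) : Converges (translateY α F) :=
  hF.subst_pair (converges_X 0) ((converges_X 1).add hα.ofX) (by simp)
    (constantCoeff_X_one_add_ofX h)

theorem subst_translateY {υ : Type*} {a b : MvPowerSeries υ ℂ}
    (ha : MvPowerSeries.constantCoeff a = 0) (hb : MvPowerSeries.constantCoeff b = 0)
    {α : ℂ⟦X⟧} (h : PowerSeries.constantCoeff α = 0) (F : MvPowerSeries (Fin 2) ℂ) :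
    MvPowerSeries.subst ![a, b] (translateY α F) =
      MvPowerSeries.subst ![a, b + PowerSeries.subst a α] F := by
  rw [translateY, subst_subst_pair (by simp) (constantCoeff_X_one_add_ofX h) (hasSubst_pair ha hb),
    MvPowerSeries.subst_add (hasSubst_pair ha hb), subst_pair_X_zero ha hb,
    subst_pair_X_one ha hb, subst_ofX ha hb]

theorem coeff_ofX (ξ : ℂ⟦X⟧) (d : Fin 2 →₀ ℕ) :
    MvPowerSeries.coeff d (ofX ξ) = if d 1 = 0 then PowerSeries.coeff (d 0) ξ else 0 := by
  classical
  rw [ofX, PowerSeries.coeff_subst_single]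
  congr 1
  rw [eq_iff_iff]
  constructor
  · intro h; rw [h]; simp
  · intro h
    ext i
    fin_cases i <;> simp [h]

theorem pderiv_ofX (ξ : ℂ⟦X⟧) : MvPowerSeries.pderiv ℂ 1 (ofX ξ) = 0 := by
  ext d
  rw [MvPowerSeries.coeff_pderiv, coeff_ofX]
  simp

theorem finsum_comp_add_single {M : Type*} [AddCommMonoid M] (g : (Fin 2 →₀ ℕ) → M)
    (h : ∀ d, d 1 = 0 → g d = 0) : ∑ᶠ d, g (d + Finsupp.single 1 1) = ∑ᶠ d, g d := by
  rw [← finsum_mem_range (f := g) (add_left_injective (Finsupp.single (1 : Fin 2) 1)),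
    finsum_mem_def]
  congr 1
  rw [Set.indicator_eq_self]
  intro d hd
  refine ⟨d - Finsupp.single 1 1, ?_⟩
  have : d 1 ≠ 0 := fun h1 => hd (h d h1)
  exact tsub_add_cancel_of_le (Finsupp.single_le_iff.2 (by omega))

/-- Differentiation with respect to `y` commutes with the translations `y ↦ y + α(x)`. -/
theorem pderiv_translateY {α : ℂ⟦X⟧} (h : PowerSeries.constantCoeff α = 0)
    (F : MvPowerSeries (Fin 2) ℂ) :
    MvPowerSeries.pderiv ℂ 1 (translateY α F) = translateY α (MvPowerSeries.pderiv ℂ 1 F) := by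
  have h0 : MvPowerSeries.constantCoeff (MvPowerSeries.X 0 : MvPowerSeries (Fin 2) ℂ) = 0 := by
    simp
  ext e
  rw [MvPowerSeries.coeff_pderiv, translateY, translateY,
    coeff_subst_pair h0 (constantCoeff_X_one_add_ofX h),
    coeff_subst_pair h0 (constantCoeff_X_one_add_ofX h),
    finsum_mul' _ _ (coeff_subst_pair_finite h0 (constantCoeff_X_one_add_ofX h) _ _)]
  have key : ∀ d : Fin 2 →₀ ℕ, MvPowerSeries.pderiv ℂ 1
      ((MvPowerSeries.X 0 : MvPowerSeries (Fin 2) ℂ) ^ d 0 * (MvPowerSeries.X 1 + ofX α) ^ d 1) =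
      d 1 • (MvPowerSeries.X 0 ^ d 0 * (MvPowerSeries.X 1 + ofX α) ^ (d 1 - 1)) := by
    intro d
    rw [Derivation.leibniz, Derivation.leibniz_pow, Derivation.leibniz_pow, map_add, pderiv_ofX,
      MvPowerSeries.pderiv_X_self, MvPowerSeries.pderiv_X_of_ne (by decide)]
    simp only [smul_eq_mul, add_zero, mul_one, mul_zero, smul_zero, nsmul_eq_mul]
    ring
  rw [← finsum_comp_add_single]
  · refine finsum_congr fun d => ?_
    rw [mul_assoc, ← MvPowerSeries.coeff_pderiv, key, MvPowerSeries.coeff_pderiv]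
    rw [LinearMap.map_smul_of_tower, nsmul_eq_mul]
    simp [mul_assoc]
  · intro d hd
    rw [mul_assoc, ← MvPowerSeries.coeff_pderiv, key, hd]
    simp

theorem pderiv_iterate_translateY {α : ℂ⟦X⟧} (h : PowerSeries.constantCoeff α = 0) (k : ℕ)
    (F : MvPowerSeries (Fin 2) ℂ) :
    (MvPowerSeries.pderiv ℂ 1)^[k] (translateY α F) =
      translateY α ((MvPowerSeries.pderiv ℂ 1)^[k] F) := by
  induction k with
  | zero => rfl
  | succ k ih => rw [Function.iterate_succ_apply', Function.iterate_succ_apply', ih,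
      pderiv_translateY h]

theorem Converges.pderiv_iterate {F : MvPowerSeries (Fin 2) ℂ} (hF : Converges F) (k : ℕ) :
    Converges ((MvPowerSeries.pderiv ℂ 1)^[k] F) := by
  induction k with
  | zero => exact hF
  | succ k ih => rw [Function.iterate_succ_apply']; exact ih.pderiv 1

theorem coeff_pderiv_iterate (k : ℕ) (d : Fin 2 →₀ ℕ) :
    ∃ c : ℂ, c ≠ 0 ∧ ∀ F : MvPowerSeries (Fin 2) ℂ,
      MvPowerSeries.coeff d ((MvPowerSeries.pderiv ℂ 1)^[k] F) =
        MvPowerSeries.coeff (d + Finsupp.single 1 k) F * c := by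
  induction k generalizing d with
  | zero => exact ⟨1, one_ne_zero, by simp⟩
  | succ k ih =>
    obtain ⟨c, hc, h⟩ := ih (d + Finsupp.single 1 1)
    refine ⟨c * (d 1 + 1), mul_ne_zero hc (Nat.cast_add_one_ne_zero _), fun F => ?_⟩
    rw [Function.iterate_succ_apply', MvPowerSeries.coeff_pderiv, h, add_assoc,
      ← Finsupp.single_add, add_comm 1 k, mul_assoc]

theorem coeff_subst_X_zero (F : MvPowerSeries (Fin 2) ℂ) (i : ℕ) :
    PowerSeries.coeff i
      (MvPowerSeries.subst ![(PowerSeries.X : ℂ⟦X⟧), (0 : ℂ⟦X⟧)] F : ℂ⟦X⟧) =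
      MvPowerSeries.coeff (Finsupp.single 0 i) F := by
  have hX : PowerSeries.constantCoeff (PowerSeries.X : ℂ⟦X⟧) = 0 := by simp
  unfold PowerSeries.coeff
  rw [coeff_subst_pair hX (by simp), finsum_eq_single _ (Finsupp.single 0 i)]
  · have := PowerSeries.coeff_X_pow_self (R := ℂ) i
    unfold PowerSeries.coeff at this
    simp [this]
  · intro d hd
    rcases Nat.eq_zero_or_pos (d 1) with h | h
    · have h0 : d 0 ≠ i := by
        rintro rfl
        apply hd
        ext j
        fin_cases j <;> simp [h]
      have := PowerSeries.coeff_X_pow (R := ℂ) i (d 0)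
      rw [if_neg (Ne.symm h0)] at this
      unfold PowerSeries.coeff at this
      rw [h, pow_zero, mul_one, this, mul_zero]
    · rw [zero_pow (by omega), mul_zero, map_zero, mul_zero]

theorem coeff_subst_zero_X (F : MvPowerSeries (Fin 2) ℂ) (i : ℕ) :
    PowerSeries.coeff i
      (MvPowerSeries.subst ![(0 : ℂ⟦X⟧), (PowerSeries.X : ℂ⟦X⟧)] F : ℂ⟦X⟧) =
      MvPowerSeries.coeff (Finsupp.single 1 i) F := by
  have hX : PowerSeries.constantCoeff (PowerSeries.X : ℂ⟦X⟧) = 0 := by simp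
  unfold PowerSeries.coeff
  rw [coeff_subst_pair (by simp) hX, finsum_eq_single _ (Finsupp.single 1 i)]
  · have := PowerSeries.coeff_X_pow_self (R := ℂ) i
    unfold PowerSeries.coeff at this
    simp [this]
  · intro d hd
    rcases Nat.eq_zero_or_pos (d 0) with h | h
    · have h0 : d 1 ≠ i := by
        rintro rfl
        apply hd
        ext j
        fin_cases j <;> simp [h]
      have := PowerSeries.coeff_X_pow (R := ℂ) i (d 1)
      rw [if_neg (Ne.symm h0)] at this
      unfold PowerSeries.coeff at this
      rw [h, pow_zero, one_mul, this, mul_zero]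
    · rw [zero_pow (by omega), zero_mul, map_zero, mul_zero]

theorem coeff_single_one_translateY {α : ℂ⟦X⟧} (h : PowerSeries.constantCoeff α = 0)
    (F : MvPowerSeries (Fin 2) ℂ) (j : ℕ) :
    MvPowerSeries.coeff (Finsupp.single 1 j) (translateY α F) =
      MvPowerSeries.coeff (Finsupp.single 1 j) F := by
  have hX : PowerSeries.constantCoeff (PowerSeries.X : ℂ⟦X⟧) = 0 := by simp
  rw [← coeff_subst_zero_X, ← coeff_subst_zero_X, subst_translateY (by simp) hX h,
    PowerSeries.subst_zero_of_constantCoeff_zero h, add_zero]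

/-- Tschirnhausen transformation: a translation `y ↦ y + α(x)` kills the coefficient of
`y ^ (m - 1)` of a series `F` whose restriction to `x = 0` has order `m`. -/
theorem exists_tschirnhausen {F : MvPowerSeries (Fin 2) ℂ} (hF : Converges F) {m : ℕ}
    (hm : 1 ≤ m) (hlow : ∀ j < m, MvPowerSeries.coeff (Finsupp.single 1 j) F = 0)
    (hne : MvPowerSeries.coeff (Finsupp.single 1 m) F ≠ 0) :
    ∃ α : ℂ⟦X⟧, Converges α ∧ PowerSeries.constantCoeff α = 0 ∧
      ∀ d : Fin 2 →₀ ℕ, d 1 = m - 1 → MvPowerSeries.coeff d (translateY α F) = 0 := by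
  have hX : PowerSeries.constantCoeff (PowerSeries.X : ℂ⟦X⟧) = 0 := by simp
  obtain ⟨α, hα, hα0, h⟩ := exists_implicit_function (hF.pderiv_iterate (m - 1))
    (by
      obtain ⟨c, -, hc⟩ := coeff_pderiv_iterate (m - 1) 0
      rw [← MvPowerSeries.coeff_zero_eq_constantCoeff_apply, hc, zero_add, hlow _ (by omega),
        zero_mul])
    (by
      obtain ⟨c, hc0, hc⟩ := coeff_pderiv_iterate (m - 1) (Finsupp.single 1 1)
      rw [hc, ← Finsupp.single_add, show 1 + (m - 1) = m by omega]
      exact mul_ne_zero hne hc0)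
  refine ⟨α, hα, hα0, fun d hd => ?_⟩
  obtain ⟨c, hc0, hc⟩ := coeff_pderiv_iterate (m - 1) (Finsupp.single 0 (d 0))
  have hd' : Finsupp.single 0 (d 0) + Finsupp.single 1 (m - 1) = d := by
    ext i
    fin_cases i <;> simp [hd]
  have h1 := hc (translateY α F)
  rw [hd', pderiv_iterate_translateY hα0, ← coeff_subst_X_zero, subst_translateY hX (by simp) hα0,
    zero_add, PowerSeries.X_subst, h, map_zero] at h1
  exact (mul_eq_zero.1 h1.symm).resolve_right hc0

/-- The first edge of the Newton polygon: `p / q` is the minimum of `i / (m - j)` over the exponents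
`(i, j)` of `F` with `j < m`. -/
theorem exists_slope {F : MvPowerSeries (Fin 2) ℂ} {m : ℕ}
    (h : ∃ d : Fin 2 →₀ ℕ, d 1 < m ∧ MvPowerSeries.coeff d F ≠ 0) :
    ∃ d : Fin 2 →₀ ℕ, d 1 < m ∧ MvPowerSeries.coeff d F ≠ 0 ∧
      ∀ e : Fin 2 →₀ ℕ, MvPowerSeries.coeff e F ≠ 0 →
        d 0 * m ≤ (m - d 1) * e 0 + d 0 * e 1 := by
  -- The slope `i / (m - j)` is multiplied by `m!`, so as to be an integer.
  let φ : (Fin 2 →₀ ℕ) → ℕ := fun d => d 0 * (m.factorial / (m - d 1))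
  obtain ⟨d, ⟨hd1, hd2⟩, hd3⟩ := WellFounded.has_min (measure φ).wf
    {d | d 1 < m ∧ MvPowerSeries.coeff d F ≠ 0} h
  refine ⟨d, hd1, hd2, fun e he => ?_⟩
  rcases lt_or_ge (e 1) m with h1 | h1
  · have h2 : φ d ≤ φ e := not_lt.1 (hd3 e ⟨h1, he⟩)
    have h3 : ∀ k : ℕ, 0 < m - k → (m.factorial / (m - k)) * (m - k) = m.factorial := fun k hk =>
      Nat.div_mul_cancel (Nat.dvd_factorial hk (by omega))
    have hd := h3 (d 1) (by omega)
    have he' := h3 (e 1) (by omega)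
    have h4 : m.factorial * (d 0 * (m - e 1)) ≤ m.factorial * (e 0 * (m - d 1)) := by
      calc m.factorial * (d 0 * (m - e 1)) = φ d * ((m - d 1) * (m - e 1)) := by
            rw [← hd]; simp only [φ]; ring
        _ ≤ φ e * ((m - d 1) * (m - e 1)) := by gcongr
        _ = m.factorial * (e 0 * (m - d 1)) := by
            rw [← he']; simp only [φ]; ring
    have h5 := Nat.le_of_mul_le_mul_left h4 (Nat.factorial_pos m)
    calc d 0 * m = d 0 * (m - e 1) + d 0 * e 1 := by rw [← mul_add]; congr 1; omega
      _ ≤ _ := by rw [mul_comm (m - d 1)]; gcongr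
  · calc d 0 * m ≤ d 0 * e 1 := by gcongr
      _ ≤ _ := Nat.le_add_left _ _

theorem coeff_X_zero_pow_mul_aeval (a : ℕ) (P : Polynomial ℂ) (e : Fin 2 →₀ ℕ) :
    MvPowerSeries.coeff e ((MvPowerSeries.X 0 : MvPowerSeries (Fin 2) ℂ) ^ a *
      Polynomial.aeval (MvPowerSeries.X 1 : MvPowerSeries (Fin 2) ℂ) P) =
      if e 0 = a then P.coeff (e 1) else 0 := by
  classical
  induction P using Polynomial.induction_on' with
  | add P Q hP hQ =>
    rw [map_add, mul_add, map_add, hP, hQ, Polynomial.coeff_add]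
    split_ifs <;> simp
  | monomial n r =>
    have h1 : (MvPowerSeries.X 0 : MvPowerSeries (Fin 2) ℂ) ^ a *
        Polynomial.aeval (MvPowerSeries.X 1 : MvPowerSeries (Fin 2) ℂ) (Polynomial.monomial n r) =
        MvPowerSeries.monomial (Finsupp.single 0 a + Finsupp.single 1 n) r := by
      rw [Polynomial.aeval_monomial, MvPowerSeries.X_pow_eq, MvPowerSeries.X_pow_eq,
        MvPowerSeries.algebraMap_apply, Algebra.algebraMap_self, RingHom.id_apply,
        ← MvPowerSeries.monomial_zero_eq_C_apply, MvPowerSeries.monomial_mul_monomial,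
        MvPowerSeries.monomial_mul_monomial]
      simp
    have h2 : e = Finsupp.single 0 a + Finsupp.single 1 n ↔ e 0 = a ∧ n = e 1 := by
      constructor
      · rintro rfl; simp
      · rintro ⟨h, h'⟩
        ext i
        fin_cases i <;> simp [h, h']
    rw [h1, MvPowerSeries.coeff_monomial, Polynomial.coeff_monomial]
    simp only [h2, ite_and]

theorem coeff_X_zero_pow_mul (c : ℂ) (a b : ℕ) (e : Fin 2 →₀ ℕ) :
    MvPowerSeries.coeff e ((MvPowerSeries.X 0 : MvPowerSeries (Fin 2) ℂ) ^ a *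
      (MvPowerSeries.X 1 + MvPowerSeries.C c) ^ b) =
      if e 0 = a then ((Polynomial.X + Polynomial.C c) ^ b : Polynomial ℂ).coeff (e 1) else 0 := by
  rw [← coeff_X_zero_pow_mul_aeval]
  simp [MvPowerSeries.algebraMap_apply]

/-- A polynomial of degree `m` without term of degree `m - 1`, and which is not a monomial, has a
root of multiplicity smaller than `m`. The multiplicity is read off as the order at `0` of the
translated polynomial. -/
theorem exists_root_multiplicity_lt {P : Polynomial ℂ} {m : ℕ} (hm : P.natDegree = m)
    (hm1 : 1 ≤ m) (h1 : P.coeff (m - 1) = 0) {j : ℕ} (hj : j < m) (hPj : P.coeff j ≠ 0) :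
    ∃ (c : ℂ) (k : ℕ), 1 ≤ k ∧ k < m ∧
      (P.comp (Polynomial.X + Polynomial.C c)).coeff k ≠ 0 ∧
      ∀ l < k, (P.comp (Polynomial.X + Polynomial.C c)).coeff l = 0 := by
  have hP0 : P ≠ 0 := by rintro rfl; simp at hPj
  obtain ⟨c, hc⟩ := IsAlgClosed.exists_root P
    (by rw [Polynomial.degree_eq_natDegree hP0, hm]; exact_mod_cast (by omega : m ≠ 0))
  have hQ0 : P.comp (Polynomial.X + Polynomial.C c) ≠ 0 := by
    rw [Ne, Polynomial.comp_X_add_C_eq_zero_iff]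
    exact hP0
  refine ⟨c, P.rootMultiplicity c, (Polynomial.rootMultiplicity_pos hP0).2 hc, ?_, ?_, ?_⟩
  · refine lt_of_le_of_ne ?_ fun h => ?_
    · have h2 := Polynomial.pow_rootMultiplicity_dvd P c
      have h3 := Polynomial.natDegree_le_of_dvd h2 hP0
      rw [Polynomial.natDegree_pow, Polynomial.natDegree_X_sub_C, mul_one] at h3
      omega
    · -- Otherwise `P = b (z - c) ^ m`, and the vanishing of its second coefficient forces `c = 0`.
      obtain ⟨Q, hQ⟩ := Polynomial.pow_rootMultiplicity_dvd P c
      rw [h] at hQ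
      have hQ1 : Q ≠ 0 := by rintro rfl; simp [hP0] at hQ
      have hdeg : Q.natDegree = 0 := by
        have := congrArg Polynomial.natDegree hQ
        rw [Polynomial.natDegree_mul (pow_ne_zero _ (Polynomial.X_sub_C_ne_zero c)) hQ1,
          Polynomial.natDegree_pow, Polynomial.natDegree_X_sub_C, hm] at this
        omega
      obtain ⟨b, rfl⟩ := Polynomial.natDegree_eq_zero.1 hdeg
      have hb : b ≠ 0 := by rintro rfl; simp at hQ1
      have hcoeff : ∀ i, P.coeff i = (-c) ^ (m - i) * (m.choose i : ℂ) * b := by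
        intro i
        rw [hQ, Polynomial.coeff_mul_C, sub_eq_add_neg, ← Polynomial.C_neg,
          Polynomial.coeff_X_add_C_pow]
      have hc0 : c = 0 := by
        have := hcoeff (m - 1)
        rw [h1, show m - (m - 1) = 1 by omega, pow_one] at this
        have hch : ((m.choose (m - 1) : ℕ) : ℂ) ≠ 0 := by
          exact_mod_cast (Nat.choose_pos (by omega)).ne'
        have h4 := this.symm
        simp only [mul_eq_zero, neg_eq_zero, hb, hch, or_false] at h4
        exact h4
      apply hPj
      rw [hcoeff, hc0, neg_zero, zero_pow (by omega)]
      simp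
  · rw [Polynomial.rootMultiplicity_eq_natTrailingDegree]
    exact Polynomial.trailingCoeff_nonzero_iff_nonzero.2 hQ0
  · intro l hl
    rw [Polynomial.rootMultiplicity_eq_natTrailingDegree] at hl
    exact Polynomial.coeff_eq_zero_of_lt_natTrailingDegree hl

theorem single_add_single (d : Fin 2 →₀ ℕ) :
    Finsupp.single 0 (d 0) + Finsupp.single 1 (d 1) = d := by
  ext i
  fin_cases i <;> simp

/-- One step of the Newton algorithm: after a Tschirnhausen transformation and the blow-up
`x = t ^ q`, `y = t ^ p (z + c)`, the order `m` of `F(0, y)` drops. -/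
theorem exists_newton_step {F : MvPowerSeries (Fin 2) ℂ} (hF : Converges F) {m : ℕ} (hm : 1 ≤ m)
    (hlow : ∀ j < m, MvPowerSeries.coeff (Finsupp.single 1 j) F = 0)
    (hne : MvPowerSeries.coeff (Finsupp.single 1 m) F ≠ 0)
    (h1 : ∀ d : Fin 2 →₀ ℕ, d 1 = m - 1 → MvPowerSeries.coeff d F = 0)
    (h : ∃ d : Fin 2 →₀ ℕ, d 1 < m ∧ MvPowerSeries.coeff d F ≠ 0) :
    ∃ (p q N : ℕ) (c : ℂ) (k : ℕ) (G : MvPowerSeries (Fin 2) ℂ), 0 < p ∧ 0 < q ∧ 1 ≤ k ∧ k < m ∧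
      Converges G ∧ MvPowerSeries.coeff (Finsupp.single 1 k) G ≠ 0 ∧
      (∀ l < k, MvPowerSeries.coeff (Finsupp.single 1 l) G = 0) ∧
      MvPowerSeries.subst ![MvPowerSeries.X 0 ^ q,
        MvPowerSeries.X 0 ^ p * (MvPowerSeries.X 1 + MvPowerSeries.C c)] F =
        MvPowerSeries.X 0 ^ N * G := by
  classical
  obtain ⟨d₀, hd1, hd2, hd3⟩ := exists_slope h
  set p := d₀ 0
  set q := m - d₀ 1
  have hq : 0 < q := by omega
  have hp : 0 < p := by
    refine Nat.pos_of_ne_zero fun hp => hd2 ?_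
    rw [← single_add_single d₀, show d₀ 0 = 0 from hp, Finsupp.single_zero, zero_add]
    exact hlow _ hd1
  have hS : {d : Fin 2 →₀ ℕ | q * d 0 + p * d 1 = p * m}.Finite := by
    refine (Set.finite_Iic (Finsupp.single 0 (p * m) + Finsupp.single 1 (p * m))).subset ?_
    intro d hd i
    have hd' : q * d 0 + p * d 1 = p * m := hd
    have e0 : d 0 ≤ q * d 0 := Nat.le_mul_of_pos_left _ hq
    have e1 : d 1 ≤ p * d 1 := Nat.le_mul_of_pos_left _ hp
    fin_cases i
    · simp; omega
    · simp; omega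
  set S := hS.toFinset
  have memS : ∀ d, d ∈ S ↔ q * d 0 + p * d 1 = p * m := fun d => by simp [S]
  -- The polynomial of the first edge of the Newton polygon.
  let P : Polynomial ℂ := ∑ d ∈ S, Polynomial.monomial (d 1) (MvPowerSeries.coeff d F)
  have hPcoeff : ∀ d ∈ S, P.coeff (d 1) = MvPowerSeries.coeff d F := by
    intro d hd
    rw [Polynomial.finsetSum_coeff, Finset.sum_eq_single_of_mem d hd, Polynomial.coeff_monomial,
      if_pos rfl]
    intro e he hed
    rw [Polynomial.coeff_monomial, if_neg]
    intro h2
    apply hed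
    have e1 := (memS d).1 hd
    have e2 := (memS e).1 he
    have e3 : e 0 = d 0 := by
      rw [h2] at e2
      exact Nat.eq_of_mul_eq_mul_left hq (by omega)
    rw [← single_add_single e, ← single_add_single d, e3, h2]
  have hPzero : ∀ j, (∀ d ∈ S, d 1 = j → MvPowerSeries.coeff d F = 0) → P.coeff j = 0 := by
    intro j hj
    rw [Polynomial.finsetSum_coeff]
    refine Finset.sum_eq_zero fun d hd => ?_
    rw [Polynomial.coeff_monomial]
    split_ifs with h2
    · exact hj d hd h2
    · rfl
  have hmS : Finsupp.single 1 m ∈ S := by rw [memS]; simp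
  have hd₀S : d₀ ∈ S := by
    rw [memS, show d₀ 0 = p from rfl, mul_comm q, ← mul_add]
    congr 1; omega
  have hPm : P.coeff m ≠ 0 := by
    have := hPcoeff _ hmS
    rw [Finsupp.single_eq_same] at this
    rwa [this]
  have hdeg : P.natDegree = m := by
    refine Polynomial.natDegree_eq_of_le_of_coeff_ne_zero ?_ hPm
    rw [Polynomial.natDegree_le_iff_coeff_eq_zero]
    intro j hj
    refine hPzero j fun d hd hdj => ?_
    have e1 := (memS d).1 hd
    have : p * d 1 ≤ p * m := by omega
    have := Nat.le_of_mul_le_mul_left this hp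
    omega
  obtain ⟨c, k, hk1, hkm, hkne, hklow⟩ := exists_root_multiplicity_lt hdeg hm
    (hPzero _ fun d _ hd => h1 d hd) hd1 (by rw [hPcoeff d₀ hd₀S]; exact hd2)
  have hqc :
      MvPowerSeries.constantCoeff ((MvPowerSeries.X 0 : MvPowerSeries (Fin 2) ℂ) ^ q) = 0 := by
    rw [map_pow, MvPowerSeries.constantCoeff_X, zero_pow hq.ne']
  have hpc : MvPowerSeries.constantCoeff ((MvPowerSeries.X 0 : MvPowerSeries (Fin 2) ℂ) ^ p *
      (MvPowerSeries.X 1 + MvPowerSeries.C c)) = 0 := by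
    rw [map_mul, map_pow, MvPowerSeries.constantCoeff_X, zero_pow hp.ne', zero_mul]
  have hterm : ∀ d e : Fin 2 →₀ ℕ, MvPowerSeries.coeff e
      (((MvPowerSeries.X 0 : MvPowerSeries (Fin 2) ℂ) ^ q) ^ d 0 *
        (MvPowerSeries.X 0 ^ p * (MvPowerSeries.X 1 + MvPowerSeries.C c)) ^ d 1) =
      if e 0 = q * d 0 + p * d 1 then
        ((Polynomial.X + Polynomial.C c) ^ d 1 : Polynomial ℂ).coeff (e 1) else 0 := by
    intro d e
    rw [← coeff_X_zero_pow_mul, mul_pow, ← pow_mul, ← pow_mul, ← mul_assoc, ← pow_add]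
  obtain ⟨G, hG⟩ : (MvPowerSeries.X 0 : MvPowerSeries (Fin 2) ℂ) ^ (p * m) ∣
      MvPowerSeries.subst ![MvPowerSeries.X 0 ^ q,
        MvPowerSeries.X 0 ^ p * (MvPowerSeries.X 1 + MvPowerSeries.C c)] F := by
    rw [MvPowerSeries.X_pow_dvd_iff]
    intro e he
    rw [coeff_subst_pair hqc hpc]
    refine finsum_eq_zero_of_forall_eq_zero fun d => ?_
    rw [hterm]
    by_cases hd : MvPowerSeries.coeff d F = 0
    · rw [hd, zero_mul]
    · rw [if_neg, mul_zero]
      have := hd3 d hd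
      omega
  -- Only the terms of `F` on the edge contribute to `G(0, z)`.
  have hGcoeff : ∀ l, MvPowerSeries.coeff (Finsupp.single 1 l) G =
      (P.comp (Polynomial.X + Polynomial.C c)).coeff l := by
    intro l
    have e1 : MvPowerSeries.coeff (Finsupp.single 1 l) G = MvPowerSeries.coeff
        (Finsupp.single 0 (p * m) + Finsupp.single 1 l) (MvPowerSeries.X 0 ^ (p * m) * G) := by
      rw [MvPowerSeries.X_pow_eq, MvPowerSeries.coeff_add_monomial_mul, one_mul]
    rw [e1, ← hG, coeff_subst_pair hqc hpc, Polynomial.sum_comp, Polynomial.finsetSum_coeff,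
      finsum_eq_sum_of_support_subset (s := S)]
    · refine Finset.sum_congr rfl fun d hd => ?_
      rw [hterm, Polynomial.monomial_comp, Polynomial.coeff_C_mul, if_pos]
      · simp
      · simp [(memS d).1 hd]
    · intro d hd
      rw [Function.mem_support, hterm] at hd
      rw [Finset.mem_coe, memS]
      by_contra hne'
      apply hd
      rw [if_neg, mul_zero]
      simpa using Ne.symm hne'
  refine ⟨p, q, p * m, c, k, G, hp, hq, hk1, hkm, ?_, by rwa [hGcoeff], fun l hl => ?_, hG⟩
  · refine Converges.of_X_pow_mul (i := 0) (k := p * m) ?_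
    rw [← hG]
    exact hF.subst_pair ((converges_X 0).pow q)
      (((converges_X 0).pow p).mul ((converges_X 1).add (converges_C c))) hqc hpc
  · rw [hGcoeff, hklow l hl]

/-- The Newton-Puiseux theorem: a convergent series `F(x, y)` such that `F(0, y)` vanishes at `0` to
a finite order has a convergent root `y = ξ(x ^ (1 / n))`. -/
theorem exists_newtonPuiseux_root (m : ℕ) : ∀ F : MvPowerSeries (Fin 2) ℂ, Converges F → 1 ≤ m →
    (∀ j < m, MvPowerSeries.coeff (Finsupp.single 1 j) F = 0) →
    MvPowerSeries.coeff (Finsupp.single 1 m) F ≠ 0 →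
    ∃ (n : ℕ) (ξ : ℂ⟦X⟧), 0 < n ∧ Converges ξ ∧ PowerSeries.constantCoeff ξ = 0 ∧
      (MvPowerSeries.subst ![(PowerSeries.X : ℂ⟦X⟧) ^ n, ξ] F : ℂ⟦X⟧) = 0 := by
  induction m using Nat.strong_induction_on with
  | _ m ih =>
  intro F hF hm hlow hne
  have hX : PowerSeries.constantCoeff (PowerSeries.X : ℂ⟦X⟧) = 0 := by simp
  have hXn : ∀ {n : ℕ}, 0 < n → PowerSeries.constantCoeff ((PowerSeries.X : ℂ⟦X⟧) ^ n) = 0 :=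
    fun {n} hn => by simp [hn.ne']
  obtain ⟨α, hα, hα0, hT⟩ := exists_tschirnhausen hF hm hlow hne
  by_cases h : ∃ d : Fin 2 →₀ ℕ, d 1 < m ∧ MvPowerSeries.coeff d (translateY α F) ≠ 0
  · obtain ⟨p, q, N, c, k, G, hp, hq, hk1, hkm, hG, hGk, hGl, hGF⟩ :=
      exists_newton_step (hF.translateY hα hα0) hm
        (fun j hj => by rw [coeff_single_one_translateY hα0, hlow j hj])
        (by rwa [coeff_single_one_translateY hα0]) hT h
    obtain ⟨n, η, hn, hη, hη0, hroot⟩ := ih k hkm G hG hk1 hGl hGk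
    have hqc : MvPowerSeries.constantCoeff ((MvPowerSeries.X 0 : MvPowerSeries (Fin 2) ℂ) ^ q) =
        0 := by
      rw [map_pow, MvPowerSeries.constantCoeff_X, zero_pow hq.ne']
    have hpc : MvPowerSeries.constantCoeff ((MvPowerSeries.X 0 : MvPowerSeries (Fin 2) ℂ) ^ p *
        (MvPowerSeries.X 1 + MvPowerSeries.C c)) = 0 := by
      rw [map_mul, map_pow, MvPowerSeries.constantCoeff_X, zero_pow hp.ne', zero_mul]
    have hs := hasSubst_pair (hXn hn) hη0
    have e := congrArg (MvPowerSeries.subst ![(PowerSeries.X : ℂ⟦X⟧) ^ n, η]) hGF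
    rw [MvPowerSeries.subst_mul hs, hroot, mul_zero, subst_subst_pair hqc hpc hs,
      MvPowerSeries.subst_mul hs, MvPowerSeries.subst_pow hs, MvPowerSeries.subst_pow hs,
      MvPowerSeries.subst_add hs, MvPowerSeries.subst_C, subst_pair_X_zero (hXn hn) hη0,
      subst_pair_X_one (hXn hn) hη0, ← pow_mul, ← pow_mul] at e
    have hnp : PowerSeries.constantCoeff
        ((PowerSeries.X : ℂ⟦X⟧) ^ (n * p) * (η + MvPowerSeries.C c)) = 0 := by
      rw [map_mul, hXn (Nat.mul_pos hn hp), zero_mul]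
    rw [subst_translateY (hXn (Nat.mul_pos hn hq)) hnp hα0] at e
    -- The root is `t ^ (n p) (η(t) + c) + α(t ^ (n q))`, with `x = t ^ (n q)`.
    refine ⟨n * q, _, Nat.mul_pos hn hq, ?_, ?_, e⟩
    · exact ((((converges_X (σ := Unit) ()).pow _).mul (hη.add (converges_C c))).add
        (hα.powerSeries_subst ((converges_X (σ := Unit) ()).pow _) (hXn (Nat.mul_pos hn hq))))
    · rw [map_add, hnp, zero_add]
      exact (constantCoeff_powerSeries_subst α (hXn (Nat.mul_pos hn hq))).trans hα0
  · -- Here `F(x, y + α(x))` is divisible by `y ^ m`, hence `y = α(x)` is a root.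
    push Not at h
    refine ⟨1, α, one_pos, hα, hα0, ?_⟩
    have e := subst_translateY hX (map_zero _) hα0 F
    rw [zero_add, PowerSeries.X_subst] at e
    rw [pow_one, ← e]
    ext i
    rw [coeff_subst_X_zero, map_zero]
    exact h _ (by simp; omega)

end NewtonPuiseux

/-! ### Substitution homomorphisms of the ring of convergent series -/

section SubstHom

theorem constantCoeff_PX : PowerSeries.constantCoeff (PowerSeries.X : ℂ⟦X⟧) = 0 := by simp

theorem constantCoeff_PX_pow {n : ℕ} (hn : 0 < n) :
    PowerSeries.constantCoeff ((PowerSeries.X : ℂ⟦X⟧) ^ n) = 0 := by simp [hn.ne']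

theorem constantCoeff_X_zero_pow {n : ℕ} (hn : 0 < n) :
    MvPowerSeries.constantCoeff ((MvPowerSeries.X 0 : MvPowerSeries (Fin 2) ℂ) ^ n) = 0 := by
  simp [hn.ne']

theorem converges_coe (F : ConvergentSeries) :
    Converges (F : MvPowerSeries (Fin 2) ℂ) := mem_convergentSeries_iff.1 F.2

/-- A power series `f`, if convergent, as an element of `ℂ{x, y}`. -/
def Converges.toSeries {f : MvPowerSeries (Fin 2) ℂ} (hf : Converges f) : ConvergentSeries :=
  ⟨f, mem_convergentSeries_iff.2 hf⟩

@[simp] theorem Converges.coe_toSeries {f : MvPowerSeries (Fin 2) ℂ} (hf : Converges f) :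
    (hf.toSeries : MvPowerSeries (Fin 2) ℂ) = f := rfl

/-- The coordinate `x` of `ℂ{x, y}`. -/
noncomputable def seriesX : ConvergentSeries := (converges_X 0).toSeries

/-- The coordinate `y` of `ℂ{x, y}`. -/
noncomputable def seriesY : ConvergentSeries := (converges_X 1).toSeries

@[simp] theorem coe_seriesX : (seriesX : MvPowerSeries (Fin 2) ℂ) = MvPowerSeries.X 0 := rfl

@[simp] theorem coe_seriesY : (seriesY : MvPowerSeries (Fin 2) ℂ) = MvPowerSeries.X 1 := rfl

/-- The endomorphism `F ↦ F(a, b)` of `ℂ{x, y}`. -/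
noncomputable def substHom (a b : ConvergentSeries)
    (ha : MvPowerSeries.constantCoeff (a : MvPowerSeries (Fin 2) ℂ) = 0)
    (hb : MvPowerSeries.constantCoeff (b : MvPowerSeries (Fin 2) ℂ) = 0) :
    ConvergentSeries →ₐ[ℂ] ConvergentSeries :=
  ((MvPowerSeries.substAlgHom (hasSubst_pair ha hb)).comp ConvergentSeries.val).codRestrict
    ConvergentSeries fun F => mem_convergentSeries_iff.2 (by
      simpa using (converges_coe F).subst_pair (converges_coe a) (converges_coe b) ha hb)

theorem coe_substHom {a b : ConvergentSeries}
    (ha : MvPowerSeries.constantCoeff (a : MvPowerSeries (Fin 2) ℂ) = 0)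
    (hb : MvPowerSeries.constantCoeff (b : MvPowerSeries (Fin 2) ℂ) = 0) (F : ConvergentSeries) :
    (substHom a b ha hb F : MvPowerSeries (Fin 2) ℂ) =
      MvPowerSeries.subst ![(a : MvPowerSeries (Fin 2) ℂ), b] (F : MvPowerSeries (Fin 2) ℂ) := by
  simp [substHom]

/-- The homomorphism `F ↦ F(a, b)` from `ℂ{x, y}` to formal power series in one variable. -/
noncomputable def evalHom (a b : ℂ⟦X⟧) (ha : PowerSeries.constantCoeff a = 0)
    (hb : PowerSeries.constantCoeff b = 0) : ConvergentSeries →ₐ[ℂ] ℂ⟦X⟧ :=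
  (MvPowerSeries.substAlgHom (hasSubst_pair (τ := Unit) ha hb)).comp ConvergentSeries.val

theorem evalHom_apply {a b : ℂ⟦X⟧} (ha : PowerSeries.constantCoeff a = 0)
    (hb : PowerSeries.constantCoeff b = 0) (F : ConvergentSeries) :
    evalHom a b ha hb F = MvPowerSeries.subst ![a, b] (F : MvPowerSeries (Fin 2) ℂ) := by
  simp [evalHom]

/-- The ramification `F(x, y) ↦ F(x ^ n, y)`. -/
noncomputable def ramify {n : ℕ} (hn : 0 < n) : ConvergentSeries →ₐ[ℂ] ConvergentSeries :=
  substHom (seriesX ^ n) seriesY (by simp [hn.ne']) (by simp)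

theorem coe_ramify {n : ℕ} (hn : 0 < n) (F : ConvergentSeries) :
    (ramify hn F : MvPowerSeries (Fin 2) ℂ) =
      MvPowerSeries.subst ![MvPowerSeries.X 0 ^ n, MvPowerSeries.X 1]
        (F : MvPowerSeries (Fin 2) ℂ) := by
  rw [ramify, coe_substHom]
  simp

theorem ramify_X {n : ℕ} (hn : 0 < n) : ramify hn seriesX = seriesX ^ n := by
  apply Subtype.ext
  rw [coe_ramify, coe_seriesX, subst_pair_X_zero (constantCoeff_X_zero_pow hn) (by simp)]
  simp

theorem ramify_ramify {n k : ℕ} (hn : 0 < n) (hk : 0 < k) (F : ConvergentSeries) :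
    ramify hk (ramify hn F) = ramify (Nat.mul_pos hn hk) F := by
  apply Subtype.ext
  have h := hasSubst_pair (constantCoeff_X_zero_pow hk)
    (MvPowerSeries.constantCoeff_X (1 : Fin 2) (R := ℂ))
  rw [coe_ramify, coe_ramify, coe_ramify, subst_subst_pair (constantCoeff_X_zero_pow hn)
    (by simp) h, MvPowerSeries.subst_pow h,
    subst_pair_X_zero (constantCoeff_X_zero_pow hk) (by simp),
    subst_pair_X_one (constantCoeff_X_zero_pow hk) (by simp), ← pow_mul, mul_comm k n]

theorem coeff_ramify {n : ℕ} (hn : 0 < n) (F : ConvergentSeries) (d : Fin 2 →₀ ℕ) :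
    MvPowerSeries.coeff d (ramify hn F : MvPowerSeries (Fin 2) ℂ) =
      if n ∣ d 0 then MvPowerSeries.coeff (Finsupp.single 0 (d 0 / n) + Finsupp.single 1 (d 1))
        (F : MvPowerSeries (Fin 2) ℂ) else 0 := by
  have hterm : ∀ e : Fin 2 →₀ ℕ, MvPowerSeries.coeff d
      (((MvPowerSeries.X 0 : MvPowerSeries (Fin 2) ℂ) ^ n) ^ e 0 * MvPowerSeries.X 1 ^ e 1) =
      if d 0 = n * e 0 ∧ d 1 = e 1 then 1 else 0 := by
    intro e
    have := coeff_X_zero_pow_mul_aeval (n * e 0) (Polynomial.X ^ e 1) d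
    rw [map_pow, Polynomial.aeval_X, Polynomial.coeff_X_pow] at this
    rw [← pow_mul, this, ite_and]
  rw [coe_ramify, coeff_subst_pair (constantCoeff_X_zero_pow hn) (by simp)]
  simp_rw [hterm]
  split_ifs with h
  · obtain ⟨k, hk⟩ := h
    rw [finsum_eq_single _ (Finsupp.single 0 (d 0 / n) + Finsupp.single 1 (d 1))]
    · rw [if_pos, mul_one]
      simp [hk, hn]
    · intro e he
      rw [if_neg, mul_zero]
      rintro ⟨h1, h2⟩
      apply he
      rw [h1, h2, Nat.mul_div_cancel_left _ hn, single_add_single]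
  · refine finsum_eq_zero_of_forall_eq_zero fun e => ?_
    rw [if_neg, mul_zero]
    rintro ⟨h1, -⟩
    exact h ⟨_, h1⟩

theorem ramify_injective {n : ℕ} (hn : 0 < n) : Function.Injective (ramify hn) := by
  intro F G h
  apply Subtype.ext
  ext d
  have := congrArg (fun H : ConvergentSeries => MvPowerSeries.coeff
    (Finsupp.single 0 (n * d 0) + Finsupp.single 1 (d 1)) (H : MvPowerSeries (Fin 2) ℂ)) h
  simp only [coeff_ramify] at this
  simpa [hn, single_add_single] using this

/-- The series obtained from `F` by keeping only the monomials `x ^ (n i + k) y ^ j`, as the series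
of the `x ^ i y ^ j`. -/
noncomputable def extractPart {n : ℕ} (hn : 0 < n) (k : ℕ) (F : ConvergentSeries) :
    ConvergentSeries :=
  Converges.toSeries (f := fun d => MvPowerSeries.coeff
    (Finsupp.single 0 (n * d 0 + k) + Finsupp.single 1 (d 1)) (F : MvPowerSeries (Fin 2) ℂ))
    (by
      refine (converges_coe F).of_coeff_le (fun d => Finsupp.single 0 (n * d 0 + k) +
        Finsupp.single 1 (d 1)) ?_ (n + k) ?_ 1 (by simp) fun d => ?_
      · intro d e h
        have h0 := DFunLike.congr_fun h 0
        have h1 := DFunLike.congr_fun h 1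
        simp only [Finsupp.add_apply, Finsupp.single_eq_same, ne_eq, zero_ne_one, one_ne_zero,
          not_false_eq_true, Finsupp.single_eq_of_ne, add_zero, zero_add] at h0 h1
        rw [← single_add_single d, ← single_add_single e, h1,
          Nat.eq_of_mul_eq_mul_left hn (by omega : n * d 0 = n * e 0)]
      · intro d
        simp only [map_add, Finsupp.degree_single]
        have : d.degree = d 0 + d 1 := by
          rw [Finsupp.degree_eq_sum, Fin.sum_univ_two]
        rw [this]
        nlinarith [Nat.zero_le (k * (d 0 + d 1))]
      · rw [one_pow, one_mul]
        exact le_rfl)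

theorem coeff_extractPart {n : ℕ} (hn : 0 < n) (k : ℕ) (F : ConvergentSeries) (d : Fin 2 →₀ ℕ) :
    MvPowerSeries.coeff d (extractPart hn k F : MvPowerSeries (Fin 2) ℂ) =
      MvPowerSeries.coeff (Finsupp.single 0 (n * d 0 + k) + Finsupp.single 1 (d 1))
        (F : MvPowerSeries (Fin 2) ℂ) := rfl

/-- The rotation `F(x, y) ↦ F(ζ x, y)`. -/
noncomputable def rotate (ζ : ℂ) : ConvergentSeries →ₐ[ℂ] ConvergentSeries :=
  substHom (ζ • seriesX) seriesY (by simp) (by simp)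

theorem coe_rotate (ζ : ℂ) (F : ConvergentSeries) :
    (rotate ζ F : MvPowerSeries (Fin 2) ℂ) =
      MvPowerSeries.rescale ![ζ, 1] (F : MvPowerSeries (Fin 2) ℂ) := by
  rw [rotate, coe_substHom, MvPowerSeries.rescale_eq_subst]
  congr 1
  funext i
  fin_cases i <;> simp

theorem coeff_rotate (ζ : ℂ) (F : ConvergentSeries) (d : Fin 2 →₀ ℕ) :
    MvPowerSeries.coeff d (rotate ζ F : MvPowerSeries (Fin 2) ℂ) =
      ζ ^ d 0 * MvPowerSeries.coeff d (F : MvPowerSeries (Fin 2) ℂ) := by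
  rw [coe_rotate, MvPowerSeries.coeff_rescale, Finsupp.prod_fintype _ _ (by simp),
    Fin.prod_univ_two]
  simp

theorem rotate_ramify {n : ℕ} (hn : 0 < n) {ζ : ℂ} (hζ : ζ ^ n = 1) (F : ConvergentSeries) :
    rotate ζ (ramify hn F) = ramify hn F := by
  apply Subtype.ext
  ext d
  rw [coeff_rotate, coeff_ramify]
  split_ifs with h
  · obtain ⟨k, hk⟩ := h
    rw [hk, pow_mul, hζ, one_pow, one_mul]
  · rw [mul_zero]

/-- A series invariant under the rotations of order `n` is a series in `x ^ n` and `y`. -/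
theorem exists_ramify_eq {n : ℕ} (hn : 0 < n) {F : ConvergentSeries}
    (h : ∀ ζ : ℂ, ζ ^ n = 1 → rotate ζ F = F) : ∃ G, ramify hn G = F := by
  refine ⟨extractPart hn 0 F, ?_⟩
  apply Subtype.ext
  ext d
  rw [coeff_ramify, coeff_extractPart]
  split_ifs with hd
  · congr 2
    rw [← single_add_single d]
    simp [Nat.mul_div_cancel' hd]
  · have hζ := Complex.isPrimitiveRoot_exp n hn.ne'
    have h1 := congrArg (fun H : ConvergentSeries => MvPowerSeries.coeff d
      (H : MvPowerSeries (Fin 2) ℂ)) (h _ hζ.pow_eq_one)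
    simp only [coeff_rotate] at h1
    by_contra h2
    have h3 := mul_right_cancel₀ (Ne.symm h2) (h1.trans (one_mul _).symm)
    exact hd (hζ.dvd_of_pow_eq_one _ h3)

end SubstHom

/-! ### Smooth branches transverse to the axis `x = 0` -/

section Arcs

/-- The convergent series in one variable without constant term. -/
abbrev ConvergentArc : Type :=
  {η : ℂ⟦X⟧ // Converges η ∧ PowerSeries.constantCoeff η = 0}

/-- The equation `y - η(x)`. -/
noncomputable def arcFactor (η : ConvergentArc) : ConvergentSeries :=
  ((converges_X 1).sub η.2.1.ofX).toSeries

/-- The evaluation `F(x, y) ↦ F(x, η(x))`. -/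
noncomputable def evalArc (η : ConvergentArc) : ConvergentSeries →ₐ[ℂ] ℂ⟦X⟧ :=
  evalHom PowerSeries.X η.1 constantCoeff_PX η.2.2

theorem evalArc_apply (η : ConvergentArc) (F : ConvergentSeries) :
    evalArc η F = MvPowerSeries.subst ![(PowerSeries.X : ℂ⟦X⟧), η.1]
      (F : MvPowerSeries (Fin 2) ℂ) := evalHom_apply _ _ _

theorem evalArc_X (η : ConvergentArc) : evalArc η seriesX = PowerSeries.X := by
  rw [evalArc_apply, coe_seriesX, subst_pair_X_zero constantCoeff_PX η.2.2]

theorem subst_arcFactor {υ : Type*} {a b : MvPowerSeries υ ℂ}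
    (ha : MvPowerSeries.constantCoeff a = 0) (hb : MvPowerSeries.constantCoeff b = 0)
    (ξ : ConvergentArc) :
    MvPowerSeries.subst ![a, b] (arcFactor ξ : MvPowerSeries (Fin 2) ℂ) =
      b - PowerSeries.subst a ξ.1 := by
  rw [arcFactor, Converges.coe_toSeries, MvPowerSeries.subst_sub (hasSubst_pair ha hb),
    subst_pair_X_one ha hb, subst_ofX ha hb]

theorem evalArc_arcFactor (η ξ : ConvergentArc) : evalArc η (arcFactor ξ) = η.1 - ξ.1 := by
  rw [evalArc_apply, subst_arcFactor constantCoeff_PX η.2.2, PowerSeries.X_subst]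

/-- The one-variable convergent series `ξ(x)` as an element of `ℂ{x, y}`. -/
noncomputable def seriesOfX {ξ : ℂ⟦X⟧} (hξ : Converges ξ) : ConvergentSeries := hξ.ofX.toSeries

theorem evalArc_seriesOfX (η : ConvergentArc) {ξ : ℂ⟦X⟧} (hξ : Converges ξ) :
    evalArc η (seriesOfX hξ) = ξ := by
  rw [evalArc_apply, seriesOfX, Converges.coe_toSeries, subst_ofX constantCoeff_PX η.2.2,
    PowerSeries.X_subst]

theorem converges_evalArc (η : ConvergentArc) (F : ConvergentSeries) :
    Converges (evalArc η F) := by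
  rw [evalArc_apply]
  exact (converges_coe F).subst_pair (converges_X (σ := Unit) ()) η.2.1 constantCoeff_PX η.2.2

theorem constantCoeff_arcFactor (η : ConvergentArc) :
    MvPowerSeries.constantCoeff (arcFactor η : MvPowerSeries (Fin 2) ℂ) = 0 := by
  rw [arcFactor, Converges.coe_toSeries, map_sub, constantCoeff_ofX, η.2.2]
  simp

/-- The automorphism `F(x, y) ↦ F(x, y + α(x))`. -/
noncomputable def translateHom (α : ConvergentArc) : ConvergentSeries →ₐ[ℂ] ConvergentSeries :=
  substHom seriesX (seriesY + seriesOfX α.2.1) (by simp)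
    (by
      rw [Subalgebra.coe_add]
      exact constantCoeff_X_one_add_ofX α.2.2)

theorem coe_translateHom (α : ConvergentArc) (F : ConvergentSeries) :
    (translateHom α F : MvPowerSeries (Fin 2) ℂ) = translateY α.1 F := by
  rw [translateHom, coe_substHom]
  rfl

noncomputable instance : Neg ConvergentArc :=
  ⟨fun α => ⟨-α.1, α.2.1.neg, by rw [map_neg, α.2.2, neg_zero]⟩⟩

theorem translateY_zero (F : MvPowerSeries (Fin 2) ℂ) : translateY 0 F = F := by
  have : ofX 0 = 0 := by
    ext d
    rw [coeff_ofX]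
    simp
  rw [translateY, this, add_zero, subst_pair_self]

theorem translateY_translateY {α β : ℂ⟦X⟧} (hα : PowerSeries.constantCoeff α = 0)
    (hβ : PowerSeries.constantCoeff β = 0) (F : MvPowerSeries (Fin 2) ℂ) :
    translateY β (translateY α F) = translateY (β + α) F := by
  have h0 : MvPowerSeries.constantCoeff (MvPowerSeries.X 0 : MvPowerSeries (Fin 2) ℂ) = 0 := by
    simp
  rw [translateY.eq_1 β, subst_translateY h0 (constantCoeff_X_one_add_ofX hβ) hα, translateY]
  congr 1
  rw [add_assoc]
  have : ofX β + PowerSeries.subst (MvPowerSeries.X 0 : MvPowerSeries (Fin 2) ℂ) α =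
      ofX (β + α) := by
    rw [ofX, ofX, PowerSeries.subst_add (PowerSeries.HasSubst.X 0)]
  rw [this]

theorem translateHom_neg_translateHom (α : ConvergentArc) (F : ConvergentSeries) :
    translateHom (-α) (translateHom α F) = F := by
  apply Subtype.ext
  rw [coe_translateHom, coe_translateHom, translateY_translateY α.2.2 (-α).2.2]
  have : (-α).1 + α.1 = 0 := neg_add_cancel α.1
  rw [this, translateY_zero]

theorem translateHom_translateHom_neg (α : ConvergentArc) (F : ConvergentSeries) :
    translateHom α (translateHom (-α) F) = F := by
  apply Subtype.ext
  rw [coe_translateHom, coe_translateHom, translateY_translateY (-α).2.2 α.2.2]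
  have : α.1 + (-α).1 = 0 := add_neg_cancel α.1
  rw [this, translateY_zero]

theorem translateHom_arcFactor (α : ConvergentArc) : translateHom α (arcFactor α) = seriesY := by
  apply Subtype.ext
  rw [coe_translateHom, translateY, subst_arcFactor (by simp) (constantCoeff_X_one_add_ofX α.2.2)]
  rw [← ofX, add_sub_cancel_right, coe_seriesY]

theorem dvd_of_X_pow_dvd {i : Fin 2} {k : ℕ} {F : ConvergentSeries}
    (h : (MvPowerSeries.X i : MvPowerSeries (Fin 2) ℂ) ^ k ∣ F) :
    (converges_X i).toSeries ^ k ∣ F := by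
  obtain ⟨G, hG⟩ := h
  have hGc : Converges G := by
    refine Converges.of_X_pow_mul (i := i) (k := k) ?_
    rw [← hG]
    exact converges_coe F
  exact ⟨hGc.toSeries, Subtype.ext (by simpa using hG)⟩

/-- The series vanishing on the arc `y = η(x)` are the multiples of `y - η(x)`. -/
theorem arcFactor_dvd_iff {η : ConvergentArc} {F : ConvergentSeries} :
    arcFactor η ∣ F ↔ evalArc η F = 0 := by
  constructor
  · rintro ⟨G, rfl⟩
    rw [map_mul, evalArc_arcFactor, sub_self, zero_mul]
  · intro h
    have h1 : seriesY ∣ translateHom η F := by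
      rw [← pow_one seriesY]
      refine dvd_of_X_pow_dvd ?_
      rw [pow_one, MvPowerSeries.X_dvd_iff]
      intro d hd
      have hd' : d = Finsupp.single 0 (d 0) := by
        conv_lhs => rw [← single_add_single d, hd]
        simp
      rw [hd', coe_translateHom, ← coeff_subst_X_zero,
        subst_translateY constantCoeff_PX (by simp) η.2.2, zero_add, PowerSeries.X_subst,
        ← evalArc_apply, h, map_zero]
    have h2 := map_dvd (translateHom (-η)) h1
    rwa [← translateHom_arcFactor η, translateHom_neg_translateHom,
      translateHom_neg_translateHom] at h2

theorem arcFactor_ne_zero (η : ConvergentArc) : arcFactor η ≠ 0 := by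
  intro h
  have h1 := translateHom_arcFactor η
  rw [h, map_zero] at h1
  have h2 := congrArg (fun H : ConvergentSeries => MvPowerSeries.coeff (Finsupp.single 1 1)
    (H : MvPowerSeries (Fin 2) ℂ)) h1
  simp at h2

theorem prime_arcFactor (η : ConvergentArc) : Prime (arcFactor η) := by
  refine ⟨arcFactor_ne_zero η, fun h => ?_, fun F G h => ?_⟩
  · have := h.map (evalArc η)
    rw [evalArc_arcFactor, sub_self] at this
    exact not_isUnit_zero this
  · rw [arcFactor_dvd_iff, map_mul, mul_eq_zero] at h
    simpa only [arcFactor_dvd_iff] using h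

theorem arcFactor_dvd_arcFactor_iff {η ξ : ConvergentArc} :
    arcFactor η ∣ arcFactor ξ ↔ η = ξ := by
  rw [arcFactor_dvd_iff, evalArc_arcFactor, sub_eq_zero, Subtype.ext_iff]

/-- The arc `η(ζ x)`. -/
noncomputable def ConvergentArc.rotate (ζ : ℂ) (η : ConvergentArc) : ConvergentArc :=
  ⟨PowerSeries.rescale ζ η.1, by
    rw [PowerSeries.rescale_eq_subst]
    exact η.2.1.powerSeries_subst ((converges_X (σ := Unit) ()).smul ζ)
      (by
        rw [MvPowerSeries.smul_eq_C_mul, map_mul]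
        exact mul_eq_zero_of_right _ constantCoeff_PX), by
    rw [← PowerSeries.coeff_zero_eq_constantCoeff_apply, PowerSeries.coeff_rescale,
      PowerSeries.coeff_zero_eq_constantCoeff_apply, η.2.2, mul_zero]⟩

/-- The arc `η(x ^ k)`. -/
noncomputable def ConvergentArc.expand {k : ℕ} (hk : 0 < k) (η : ConvergentArc) : ConvergentArc :=
  ⟨PowerSeries.subst ((PowerSeries.X : ℂ⟦X⟧) ^ k) η.1,
    η.2.1.powerSeries_subst ((converges_X (σ := Unit) ()).pow k) (constantCoeff_PX_pow hk),
    (constantCoeff_powerSeries_subst η.1 (constantCoeff_PX_pow hk)).trans η.2.2⟩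

theorem ConvergentArc.rotate_rotate (ζ ω : ℂ) (η : ConvergentArc) :
    (η.rotate ζ).rotate ω = η.rotate (ζ * ω) := by
  apply Subtype.ext
  simp only [ConvergentArc.rotate]
  rw [PowerSeries.rescale_rescale]

theorem ConvergentArc.rotate_one (η : ConvergentArc) : η.rotate 1 = η := by
  apply Subtype.ext
  simp [ConvergentArc.rotate]

theorem ConvergentArc.coeff_expand {k : ℕ} (hk : 0 < k) (η : ConvergentArc) (n : ℕ) :
    PowerSeries.coeff n (η.expand hk).1 = if k ∣ n then PowerSeries.coeff (n / k) η.1 else 0 := by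
  rw [ConvergentArc.expand, PowerSeries.coeff_subst_X_pow hk.ne']
  rfl

theorem ConvergentArc.expand_injective {k : ℕ} (hk : 0 < k) :
    Function.Injective (ConvergentArc.expand hk) := by
  intro η ξ h
  apply Subtype.ext
  ext n
  have := congrArg (fun α : ConvergentArc => PowerSeries.coeff (k * n) α.1) h
  simpa [ConvergentArc.coeff_expand, hk] using this

theorem ConvergentArc.rotate_expand {k : ℕ} (hk : 0 < k) (ζ : ℂ) (η : ConvergentArc) :
    (η.expand hk).rotate ζ = (η.rotate (ζ ^ k)).expand hk := by
  apply Subtype.ext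
  ext n
  rw [ConvergentArc.coeff_expand]
  simp only [ConvergentArc.rotate]
  rw [PowerSeries.coeff_rescale, ConvergentArc.coeff_expand]
  split_ifs with h
  · rw [PowerSeries.coeff_rescale, ← pow_mul, Nat.mul_div_cancel' h]
  · rw [mul_zero]

theorem rotate_arcFactor (ζ : ℂ) (η : ConvergentArc) :
    rotate ζ (arcFactor η) = arcFactor (η.rotate ζ) := by
  apply Subtype.ext
  ext d
  rw [coeff_rotate, arcFactor, arcFactor, Converges.coe_toSeries, Converges.coe_toSeries, map_sub,
    map_sub, coeff_ofX, coeff_ofX, ConvergentArc.rotate, PowerSeries.coeff_rescale, mul_sub]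
  congr 1
  · classical
    rw [MvPowerSeries.coeff_X]
    split_ifs with h
    · rw [h]; simp
    · simp
  · split_ifs <;> simp

theorem ramify_arcFactor {k : ℕ} (hk : 0 < k) (η : ConvergentArc) :
    ramify hk (arcFactor η) = arcFactor (η.expand hk) := by
  apply Subtype.ext
  rw [coe_ramify, subst_arcFactor (constantCoeff_X_zero_pow hk) (by simp), arcFactor,
    Converges.coe_toSeries, ofX, ConvergentArc.expand]
  congr 1
  rw [PowerSeries.subst_comp_subst_apply (PowerSeries.HasSubst.X_pow hk.ne')
    (PowerSeries.HasSubst.X 0), PowerSeries.subst_pow (PowerSeries.HasSubst.X 0),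
    PowerSeries.subst_X (PowerSeries.HasSubst.X 0)]

end Arcs

/-! ### Conjugate Newton-Puiseux roots of a branch -/

section PuiseuxModel

instance : IsDomain ConvergentSeries := NoZeroDivisors.to_isDomain _

theorem finset_prod_dvd_of_prime {ι M : Type*} [CommMonoidWithZero M] (s : Finset ι) (p : ι → M)
    (n : M) (hp : ∀ i ∈ s, Prime (p i)) (hdiv : ∀ i ∈ s, p i ∣ n)
    (hne : ∀ i ∈ s, ∀ j ∈ s, i ≠ j → ¬ p i ∣ p j) : ∏ i ∈ s, p i ∣ n := by
  classical
  induction s using Finset.induction_on generalizing n with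
  | empty => simp
  | insert i s hi ih =>
    obtain ⟨k, rfl⟩ := hdiv i (Finset.mem_insert_self i s)
    rw [Finset.prod_insert hi]
    refine mul_dvd_mul_left _ (ih k (fun j hj => hp j (Finset.mem_insert_of_mem hj)) ?_ ?_)
    · intro j hj
      refine ((hp j (Finset.mem_insert_of_mem hj)).dvd_or_dvd
        (hdiv j (Finset.mem_insert_of_mem hj))).resolve_left ?_
      refine hne j (Finset.mem_insert_of_mem hj) i (Finset.mem_insert_self i s) ?_
      rintro rfl
      exact hi hj
    · intro j hj l hl
      exact hne j (Finset.mem_insert_of_mem hj) l (Finset.mem_insert_of_mem hl)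

theorem isUnit_iff_constantCoeff [IsLocalRing ConvergentSeries] {F : ConvergentSeries} :
    IsUnit F ↔ MvPowerSeries.constantCoeff (F : MvPowerSeries (Fin 2) ℂ) ≠ 0 := by
  have key : ∀ G : ConvergentSeries, IsUnit G →
      MvPowerSeries.constantCoeff (G : MvPowerSeries (Fin 2) ℂ) ≠ 0 := fun G hG =>
    ((hG.map ConvergentSeries.val).map MvPowerSeries.constantCoeff).ne_zero
  refine ⟨key F, fun h => ?_⟩
  by_contra hF
  have h1 : ¬ IsUnit (algebraMap ℂ ConvergentSeries
      (MvPowerSeries.constantCoeff (F : MvPowerSeries (Fin 2) ℂ)) - F) := fun h1 => by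
    apply key _ h1
    rw [Subalgebra.coe_sub, map_sub, Subalgebra.coe_algebraMap, MvPowerSeries.algebraMap_apply]
    simp
  have h2 := IsLocalRing.nonunits_add (a := F) hF h1
  rw [add_sub_cancel] at h2
  exact h2 ((IsUnit.mk0 _ h).map (algebraMap ℂ ConvergentSeries))

theorem evalArc_ramify {n : ℕ} (hn : 0 < n) (η : ConvergentArc) (F : ConvergentSeries) :
    evalArc η (ramify hn F) =
      MvPowerSeries.subst ![(PowerSeries.X : ℂ⟦X⟧) ^ n, η.1] (F : MvPowerSeries (Fin 2) ℂ) := by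
  have h := hasSubst_pair (τ := Unit) constantCoeff_PX η.2.2
  rw [evalArc_apply, coe_ramify, subst_subst_pair (constantCoeff_X_zero_pow hn) (by simp) h,
    MvPowerSeries.subst_pow h, subst_pair_X_zero (τ := Unit) constantCoeff_PX η.2.2,
    subst_pair_X_one (τ := Unit) constantCoeff_PX η.2.2]

/-- The finite set `Z` of arcs is the set of the Newton-Puiseux roots of the branch `A`, written
as series in `x ^ (1 / n)`: it is an orbit of the group of `n`-th roots of unity, and the product
of the factors `y - η(x)`, where `η` runs through `Z`, is `h(x ^ n, y)` for some generator `h` of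
the ideal `A`. The integer `n` is any common denominator of the exponents. -/
structure IsPuiseuxModel (A : Ideal ConvergentSeries) (n : ℕ) (Z : Finset ConvergentArc) :
    Prop where
  pos : 0 < n
  nonempty : Z.Nonempty
  rotate_mem : ∀ ξ ∈ Z, ∀ ζ : ℂ, ζ ^ n = 1 → ξ.rotate ζ ∈ Z
  exists_rotate : ∀ ξ ∈ Z, ∀ η ∈ Z, ∃ ζ : ℂ, ζ ^ n = 1 ∧ η = ξ.rotate ζ
  exists_generator : ∃ h, A = Ideal.span {h} ∧ ramify pos h = ∏ η ∈ Z, arcFactor η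

theorem rotate_prod_arcFactor {n : ℕ} (hn : 0 < n) {Z : Finset ConvergentArc}
    (hZ : ∀ ξ ∈ Z, ∀ ζ : ℂ, ζ ^ n = 1 → ξ.rotate ζ ∈ Z) {ζ : ℂ} (hζ : ζ ^ n = 1) :
    rotate ζ (∏ η ∈ Z, arcFactor η) = ∏ η ∈ Z, arcFactor η := by
  have hζ0 : ζ ≠ 0 := by
    rintro rfl
    rw [zero_pow hn.ne'] at hζ
    exact zero_ne_one hζ
  rw [map_prod]
  simp_rw [rotate_arcFactor]
  refine Finset.prod_nbij' (fun η => η.rotate ζ) (fun η => η.rotate ζ⁻¹)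
    (fun η h => hZ η h ζ hζ) (fun η h => hZ η h _ (by rw [inv_pow, hζ, inv_one])) ?_ ?_
    (fun _ _ => rfl)
  · intro η _
    rw [ConvergentArc.rotate_rotate, mul_inv_cancel₀ hζ0, ConvergentArc.rotate_one]
  · intro η _
    rw [ConvergentArc.rotate_rotate, inv_mul_cancel₀ hζ0, ConvergentArc.rotate_one]

theorem exists_coeff_ne_zero_of_not_dvd {F : ConvergentSeries} (hF : ¬ seriesX ∣ F) :
    ∃ m, MvPowerSeries.coeff (Finsupp.single 1 m) (F : MvPowerSeries (Fin 2) ℂ) ≠ 0 := by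
  by_contra! h
  apply hF
  rw [← pow_one seriesX]
  refine dvd_of_X_pow_dvd ?_
  rw [pow_one, MvPowerSeries.X_dvd_iff]
  intro d hd
  rw [← single_add_single d, hd, Finsupp.single_zero, zero_add]
  exact h _

/-- A non-unit of `ℂ{x, y}` which `x` does not divide has a Newton-Puiseux root. -/
theorem exists_arcFactor_dvd_ramify {F : ConvergentSeries} (hF : ¬ seriesX ∣ F)
    (h0 : MvPowerSeries.constantCoeff (F : MvPowerSeries (Fin 2) ℂ) = 0) :
    ∃ (n : ℕ) (hn : 0 < n) (η : ConvergentArc), arcFactor η ∣ ramify hn F := by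
  classical
  have hex := exists_coeff_ne_zero_of_not_dvd hF
  have hm : 1 ≤ Nat.find hex := by
    rw [Nat.one_le_iff_ne_zero]
    intro h
    apply Nat.find_spec hex
    rw [h, Finsupp.single_zero, MvPowerSeries.coeff_zero_eq_constantCoeff_apply, h0]
  obtain ⟨n, ξ, hn, hξ, hξ0, h⟩ := exists_newtonPuiseux_root (Nat.find hex) F (converges_coe F) hm
    (fun j hj => not_not.1 (Nat.find_min hex hj)) (Nat.find_spec hex)
  exact ⟨n, hn, ⟨ξ, hξ, hξ0⟩, by rw [arcFactor_dvd_iff, evalArc_ramify]; exact h⟩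

/-- Each branch other than `Z(x)` has a finite set of conjugate Newton-Puiseux roots. The product of
the factors `y - ξ(ζ x)` over the conjugates of one root is a series in `x ^ n` and `y`, which
divides the irreducible equation of the branch. -/
theorem exists_isPuiseuxModel [IsLocalRing ConvergentSeries] {f : ConvergentSeries}
    (hf : Irreducible f) (hx : ¬ seriesX ∣ f) :
    ∃ n Z, IsPuiseuxModel (Ideal.span {f}) n Z := by
  classical
  obtain ⟨n, hn, ξ, hξ⟩ := exists_arcFactor_dvd_ramify hx
    (not_not.1 (isUnit_iff_constantCoeff.not.1 hf.not_isUnit))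
  let Z := (Polynomial.nthRootsFinset n (1 : ℂ)).image fun ζ => ξ.rotate ζ
  have memZ : ∀ η, η ∈ Z ↔ ∃ ζ : ℂ, ζ ^ n = 1 ∧ ξ.rotate ζ = η := by
    intro η
    simp only [Z, Finset.mem_image, Polynomial.mem_nthRootsFinset hn]
  have hrot : ∀ η ∈ Z, ∀ ζ : ℂ, ζ ^ n = 1 → η.rotate ζ ∈ Z := by
    intro η hη ζ hζ
    obtain ⟨ω, hω, rfl⟩ := (memZ _).1 hη
    refine (memZ _).2 ⟨ω * ζ, by rw [mul_pow, hω, hζ, one_mul], ?_⟩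
    rw [ConvergentArc.rotate_rotate]
  have hne : Z.Nonempty := ⟨ξ, (memZ _).2 ⟨1, one_pow n, ξ.rotate_one⟩⟩
  have hdvd : ∏ η ∈ Z, arcFactor η ∣ ramify hn f := by
    refine finset_prod_dvd_of_prime Z arcFactor _ (fun η _ => prime_arcFactor η) (fun η hη => ?_)
      (fun η _ ξ _ h => by rwa [arcFactor_dvd_arcFactor_iff])
    obtain ⟨ζ, hζ, rfl⟩ := (memZ _).1 hη
    rw [← rotate_arcFactor, ← rotate_ramify hn hζ f]
    exact map_dvd (rotate ζ) hξ
  obtain ⟨h, hh⟩ := exists_ramify_eq hn (F := ∏ η ∈ Z, arcFactor η)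
    fun ζ hζ => rotate_prod_arcFactor hn hrot hζ
  have hprod0 : ∏ η ∈ Z, arcFactor η ≠ 0 := Finset.prod_ne_zero_iff.2 fun η _ => arcFactor_ne_zero η
  obtain ⟨Q, hQ⟩ := hdvd
  -- The cofactor is invariant under the rotations too, so `h` divides `f` before ramification.
  obtain ⟨Q', hQ'⟩ := exists_ramify_eq hn (F := Q) fun ζ hζ => by
    have := congrArg (rotate ζ) hQ
    rw [map_mul, rotate_ramify hn hζ, rotate_prod_arcFactor hn hrot hζ, hQ] at this
    exact (mul_left_cancel₀ hprod0 this).symm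
  have hfh : f = h * Q' := ramify_injective hn (by rw [map_mul, hh, hQ', hQ])
  have hhu : ¬ IsUnit h := fun hu => by
    have hu' := hu.map (ramify hn)
    rw [hh] at hu'
    obtain ⟨η, hη⟩ := hne
    exact (prime_arcFactor η).not_isUnit (isUnit_of_dvd_unit (Finset.dvd_prod_of_mem _ hη) hu')
  refine ⟨n, Z, hn, hne, hrot, ?_, h, ?_, hh⟩
  · intro η hη θ hθ
    obtain ⟨ζ, hζ, rfl⟩ := (memZ _).1 hη
    obtain ⟨ω, hω, rfl⟩ := (memZ _).1 hθ
    have hζ0 : ζ ≠ 0 := by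
      rintro rfl
      rw [zero_pow hn.ne'] at hζ
      exact zero_ne_one hζ
    refine ⟨ζ⁻¹ * ω, by rw [mul_pow, inv_pow, hζ, hω]; simp, ?_⟩
    rw [ConvergentArc.rotate_rotate, mul_inv_cancel_left₀ hζ0]
  · rw [Ideal.span_singleton_eq_span_singleton]
    have hu := (hf.isUnit_or_isUnit hfh).resolve_left hhu
    rw [hfh]
    exact ⟨hu.unit⁻¹, by rw [mul_assoc, hu.mul_val_inv, mul_one]⟩

/-- The exponents of the Newton-Puiseux roots may be written with any multiple of the
denominator. -/
theorem IsPuiseuxModel.expand {A : Ideal ConvergentSeries} {n : ℕ} {Z : Finset ConvergentArc}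
    (h : IsPuiseuxModel A n Z) {k : ℕ} (hk : 0 < k) : ∃ Z', IsPuiseuxModel A (n * k) Z' := by
  classical
  refine ⟨Z.image (ConvergentArc.expand hk), Nat.mul_pos h.pos hk, h.nonempty.image _, ?_, ?_, ?_⟩
  · intro ξ hξ ζ hζ
    obtain ⟨η, hη, rfl⟩ := Finset.mem_image.1 hξ
    rw [ConvergentArc.rotate_expand]
    refine Finset.mem_image_of_mem _ (h.rotate_mem η hη _ ?_)
    rw [← pow_mul, mul_comm, hζ]
  · intro ξ hξ θ hθ
    obtain ⟨η, hη, rfl⟩ := Finset.mem_image.1 hξ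
    obtain ⟨η', hη', rfl⟩ := Finset.mem_image.1 hθ
    obtain ⟨ω, hω, rfl⟩ := h.exists_rotate η hη η' hη'
    obtain ⟨ζ, hζ⟩ := IsAlgClosed.exists_pow_nat_eq ω hk
    refine ⟨ζ, by rw [mul_comm, pow_mul, hζ, hω], ?_⟩
    rw [ConvergentArc.rotate_expand, hζ]
  · obtain ⟨g, hA, hg⟩ := h.exists_generator
    refine ⟨g, hA, ?_⟩
    rw [← ramify_ramify h.pos hk, hg, map_prod,
      Finset.prod_image (ConvergentArc.expand_injective hk).injOn]
    simp_rw [ramify_arcFactor]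

variable {A B : Ideal ConvergentSeries} {n : ℕ} {Z W : Finset ConvergentArc}

/-- A series vanishes on a branch as soon as it vanishes at one of its Newton-Puiseux roots. -/
theorem IsPuiseuxModel.mem_iff (h : IsPuiseuxModel A n Z) {η : ConvergentArc} (hη : η ∈ Z)
    (F : ConvergentSeries) : F ∈ A ↔ arcFactor η ∣ ramify h.pos F := by
  obtain ⟨g, hA, hg⟩ := h.exists_generator
  constructor
  · intro hF
    rw [hA, Ideal.mem_span_singleton] at hF
    refine dvd_trans ?_ (map_dvd (ramify h.pos) hF)
    rw [hg]
    exact Finset.dvd_prod_of_mem _ hη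
  · intro hF
    -- By conjugation all the factors divide, and the cofactor is again invariant.
    have hdvd : ∏ η ∈ Z, arcFactor η ∣ ramify h.pos F := by
      refine finset_prod_dvd_of_prime Z arcFactor _ (fun η _ => prime_arcFactor η)
        (fun ξ hξ => ?_) (fun η _ ξ _ h => by rwa [arcFactor_dvd_arcFactor_iff])
      obtain ⟨ζ, hζ, rfl⟩ := h.exists_rotate η hη ξ hξ
      rw [← rotate_arcFactor, ← rotate_ramify h.pos hζ F]
      exact map_dvd (_root_.rotate ζ) hF
    obtain ⟨Q, hQ⟩ := hdvd
    have hprod0 : ∏ η ∈ Z, arcFactor η ≠ 0 :=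
      Finset.prod_ne_zero_iff.2 fun η _ => arcFactor_ne_zero η
    obtain ⟨Q', hQ'⟩ := exists_ramify_eq h.pos (F := Q) fun ζ hζ => by
      have := congrArg (_root_.rotate ζ) hQ
      rw [map_mul, rotate_ramify h.pos hζ, rotate_prod_arcFactor h.pos h.rotate_mem hζ, hQ] at this
      exact (mul_left_cancel₀ hprod0 this).symm
    rw [hA, Ideal.mem_span_singleton]
    exact ⟨Q', ramify_injective h.pos (by rw [map_mul, hg, hQ', hQ])⟩

theorem IsPuiseuxModel.isPrime (h : IsPuiseuxModel A n Z) : A.IsPrime := by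
  obtain ⟨η, hη⟩ := h.nonempty
  rw [Ideal.isPrime_iff]
  constructor
  · rw [Ne, Ideal.eq_top_iff_one, h.mem_iff hη, map_one]
    exact fun h1 => (prime_arcFactor η).not_isUnit (isUnit_of_dvd_one h1)
  · intro F G hFG
    rw [h.mem_iff hη, map_mul] at hFG
    simpa only [h.mem_iff hη] using (prime_arcFactor η).dvd_or_dvd hFG

theorem IsPuiseuxModel.eq_of_mem (hA : IsPuiseuxModel A n Z) (hB : IsPuiseuxModel B n W)
    {η : ConvergentArc} (hη : η ∈ Z) (hη' : η ∈ W) : A = B := by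
  ext F
  rw [hA.mem_iff hη, hB.mem_iff hη']

/-- The power series `ξ(x ^ (1 / m))` which are roots of the branch `A` come from the arcs of the
finite set `Z`. -/
theorem IsPuiseuxModel.exists_of_root (h : IsPuiseuxModel A n Z) {m : ℕ} (hm : 0 < m) {ξ : ℂ⟦X⟧}
    (hξ0 : PowerSeries.constantCoeff ξ = 0)
    (hξ : ∀ F ∈ A, (MvPowerSeries.subst ![(PowerSeries.X : ℂ⟦X⟧) ^ m, ξ]
      (F : MvPowerSeries (Fin 2) ℂ) : ℂ⟦X⟧) = 0) :
    ∃ η ∈ Z, PowerSeries.subst ((PowerSeries.X : ℂ⟦X⟧) ^ n) ξ =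
      PowerSeries.subst ((PowerSeries.X : ℂ⟦X⟧) ^ m) η.1 := by
  obtain ⟨g, hA, hg⟩ := h.exists_generator
  have h0 := hξ g (by rw [hA]; exact Ideal.mem_span_singleton_self g)
  have hn := h.pos
  have hξn : PowerSeries.constantCoeff
      (PowerSeries.subst ((PowerSeries.X : ℂ⟦X⟧) ^ n) ξ : ℂ⟦X⟧) = 0 :=
    (constantCoeff_powerSeries_subst ξ (constantCoeff_PX_pow hn)).trans hξ0
  have hs : PowerSeries.HasSubst ((PowerSeries.X : ℂ⟦X⟧) ^ n) := PowerSeries.HasSubst.X_pow hn.ne'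
  have hs' := hasSubst_pair (τ := Unit) (constantCoeff_PX_pow hm) hξn
  have h1 : evalHom (PowerSeries.X ^ m) (PowerSeries.subst ((PowerSeries.X : ℂ⟦X⟧) ^ n) ξ)
      (constantCoeff_PX_pow hm) hξn (ramify hn g) = 0 := by
    have hz : PowerSeries.subst ((PowerSeries.X : ℂ⟦X⟧) ^ n) (0 : ℂ⟦X⟧) = (0 : ℂ⟦X⟧) := by
      rw [← PowerSeries.coe_substAlgHom hs, map_zero]
    have e := congrArg (PowerSeries.subst ((PowerSeries.X : ℂ⟦X⟧) ^ n)) h0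
    rw [PowerSeries.subst, subst_subst_pair (constantCoeff_PX_pow hm) hξ0 hs.const,
      ← PowerSeries.subst, ← PowerSeries.subst, PowerSeries.subst_pow hs, PowerSeries.subst_X hs,
      hz] at e
    rw [evalHom_apply, coe_ramify, subst_subst_pair (constantCoeff_X_zero_pow hn) (by simp) hs',
      MvPowerSeries.subst_pow hs', subst_pair_X_zero (τ := Unit) (constantCoeff_PX_pow hm) hξn,
      subst_pair_X_one (τ := Unit) (constantCoeff_PX_pow hm) hξn, ← pow_mul, mul_comm m n, pow_mul]
    exact e
  rw [hg, map_prod, Finset.prod_eq_zero_iff] at h1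
  obtain ⟨η, hη, h2⟩ := h1
  refine ⟨η, hη, ?_⟩
  rw [evalHom_apply, subst_arcFactor (υ := Unit) (constantCoeff_PX_pow hm) hξn, sub_eq_zero] at h2
  exact h2

theorem IsPuiseuxModel.isRoot (h : IsPuiseuxModel A n Z) {η : ConvergentArc} (hη : η ∈ Z)
    {F : ConvergentSeries} (hF : F ∈ A) :
    (MvPowerSeries.subst ![(PowerSeries.X : ℂ⟦X⟧) ^ n, η.1]
      (F : MvPowerSeries (Fin 2) ℂ) : ℂ⟦X⟧) = 0 := by
  rw [← evalArc_ramify h.pos, ← arcFactor_dvd_iff]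
  exact (h.mem_iff hη F).1 hF

end PuiseuxModel

/-! ### Intersection numbers -/

section Colength

variable {S : Type*} [CommRing S] [Algebra ℂ S]

/-- The dimension of `S / (f, g)`. -/
noncomputable def colength (f g : S) : ℕ∞ := Module.length ℂ (S ⧸ Ideal.span {f, g})

theorem intersectionNumber_span (f g : S) :
    intersectionNumber (Ideal.span {f}) (Ideal.span {g}) = colength f g := by
  rw [intersectionNumber, colength, ← Module.length_eq_rank, Ideal.span_insert]

theorem colength_comm (f g : S) : colength f g = colength g f := by
  rw [colength, colength, Ideal.span_pair_comm]

theorem colength_one_left (g : S) : colength 1 g = 0 := by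
  have : Ideal.span {1, g} = (⊤ : Ideal S) :=
    (Ideal.eq_top_iff_one _).2 (Ideal.subset_span (Set.mem_insert _ _))
  have h : Subsingleton (S ⧸ Ideal.span {1, g}) := by
    rw [this]
    exact Ideal.Quotient.subsingleton_iff.2 rfl
  rw [colength, Module.length_eq_zero_iff]
  exact h

/-- Additivity of the colength, from the exact sequence
`0 → S / (f, g) → S / (p f, g) → S / (p, g) → 0` whose first map is the multiplication by `p`. -/
theorem colength_mul_left [IsDomain S] {p : S} (hp : p ≠ 0) (f g : S)
    (hpg : ∀ c, p ∣ g * c → p ∣ c) : colength (p * f) g = colength f g + colength p g := by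
  have h1 : Ideal.span {f, g} ≤
      Submodule.comap (LinearMap.mulLeft S p) (Ideal.span {p * f, g}) := by
    rw [Ideal.span_le]
    rintro x (rfl | rfl)
    · change p * x ∈ Ideal.span {p * x, g}
      exact Ideal.subset_span (Set.mem_insert _ _)
    · change p * x ∈ Ideal.span {p * f, x}
      exact Ideal.mul_mem_left _ _ (Ideal.subset_span (Set.mem_insert_of_mem _ rfl))
  have h2 : Ideal.span {p * f, g} ≤
      Submodule.comap (LinearMap.id : S →ₗ[S] S) (Ideal.span {p, g}) := by
    rw [Ideal.span_le]
    rintro x (rfl | rfl)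
    · change p * f ∈ Ideal.span {p, g}
      exact Ideal.mul_mem_right _ _ (Ideal.subset_span (Set.mem_insert _ _))
    · change x ∈ Ideal.span {p, x}
      exact Ideal.subset_span (Set.mem_insert_of_mem _ rfl)
  refine Module.length_eq_add_of_exact
    ((Submodule.mapQ _ _ (LinearMap.mulLeft S p) h1).restrictScalars ℂ)
    ((Submodule.mapQ _ _ LinearMap.id h2).restrictScalars ℂ) ?_ ?_ ?_
  · rw [LinearMap.coe_restrictScalars, ← LinearMap.ker_eq_bot, LinearMap.ker_eq_bot']
    intro x hx
    obtain ⟨a, rfl⟩ := Submodule.Quotient.mk_surjective _ x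
    rw [Submodule.mapQ_apply, Submodule.Quotient.mk_eq_zero, LinearMap.mulLeft_apply,
      Ideal.mem_span_pair] at hx
    obtain ⟨b, c, hbc⟩ := hx
    obtain ⟨c', rfl⟩ := hpg c ⟨a - b * f, by linear_combination hbc⟩
    rw [Submodule.Quotient.mk_eq_zero, Ideal.mem_span_pair]
    refine ⟨b, c', mul_left_cancel₀ hp ?_⟩
    linear_combination hbc
  · intro x
    obtain ⟨a, rfl⟩ := Submodule.Quotient.mk_surjective _ x
    exact ⟨Submodule.Quotient.mk a, rfl⟩
  · intro x
    obtain ⟨a, rfl⟩ := Submodule.Quotient.mk_surjective _ x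
    rw [LinearMap.coe_restrictScalars, LinearMap.coe_restrictScalars, Submodule.mapQ_apply,
      Submodule.Quotient.mk_eq_zero, LinearMap.id_apply, Ideal.mem_span_pair]
    constructor
    · rintro ⟨b, c, rfl⟩
      refine ⟨Submodule.Quotient.mk b, ?_⟩
      rw [Submodule.mapQ_apply, Submodule.Quotient.eq, LinearMap.mulLeft_apply,
        Ideal.mem_span_pair]
      exact ⟨0, -c, by ring⟩
    · rintro ⟨y, hy⟩
      obtain ⟨b, rfl⟩ := Submodule.Quotient.mk_surjective _ y
      rw [Submodule.mapQ_apply, Submodule.Quotient.eq, LinearMap.mulLeft_apply,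
        Ideal.mem_span_pair] at hy
      obtain ⟨c, d, h⟩ := hy
      exact ⟨b - c * f, -d, by linear_combination -h⟩

theorem colength_prod_left [IsDomain S] {ι : Type*} (s : Finset ι) (p : ι → S) (g : S)
    (hp : ∀ i ∈ s, Prime (p i)) (hg : ∀ i ∈ s, ¬ p i ∣ g) :
    colength (∏ i ∈ s, p i) g = ∑ i ∈ s, colength (p i) g := by
  classical
  induction s using Finset.induction_on with
  | empty => simp [colength_one_left]
  | insert i s hi ih =>
    rw [Finset.prod_insert hi, Finset.sum_insert hi, colength_mul_left, ih, add_comm]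
    · exact fun j hj => hp j (Finset.mem_insert_of_mem hj)
    · exact fun j hj => hg j (Finset.mem_insert_of_mem hj)
    · exact (hp i (Finset.mem_insert_self i s)).ne_zero
    · exact fun c hc => ((hp i (Finset.mem_insert_self i s)).dvd_or_dvd hc).resolve_left
        (hg i (Finset.mem_insert_self i s))

end Colength

section Ramification

theorem coeff_X_pow_mul_ramify {n : ℕ} (hn : 0 < n) {k : ℕ} (hk : k < n) (F : ConvergentSeries)
    (d : Fin 2 →₀ ℕ) :
    MvPowerSeries.coeff d ((seriesX ^ k * ramify hn F : ConvergentSeries) :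
      MvPowerSeries (Fin 2) ℂ) =
      if d 0 % n = k then MvPowerSeries.coeff (Finsupp.single 0 (d 0 / n) + Finsupp.single 1 (d 1))
        (F : MvPowerSeries (Fin 2) ℂ) else 0 := by
  classical
  rw [Subalgebra.coe_mul, Subalgebra.coe_pow, coe_seriesX, MvPowerSeries.X_pow_eq,
    MvPowerSeries.coeff_monomial_mul, one_mul, coeff_ramify]
  simp only [Finsupp.single_le_iff, Finsupp.coe_tsub, Pi.sub_apply, Finsupp.single_eq_same]
  have hd := Nat.div_add_mod (d 0) n
  by_cases h : d 0 % n = k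
  · rw [if_pos h]
    have h1 : d 0 - k = n * (d 0 / n) := by omega
    rw [if_pos (by omega), if_pos ⟨_, h1⟩, h1, Nat.mul_div_cancel_left _ hn]
    simp
  · rw [if_neg h]
    split_ifs with h1 h2
    · exfalso
      obtain ⟨m, hm⟩ := h2
      apply h
      rw [show d 0 = k + n * m by omega, Nat.add_mul_mod_self_left, Nat.mod_eq_of_lt hk]
    · rfl
    · rfl

theorem coe_sum_series {ι : Type*} (s : Finset ι) (F : ι → ConvergentSeries) :
    ((∑ i ∈ s, F i : ConvergentSeries) : MvPowerSeries (Fin 2) ℂ) =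
      ∑ i ∈ s, (F i : MvPowerSeries (Fin 2) ℂ) := map_sum ConvergentSeries.val F s

/-- `ℂ{x, y}` is free over the image of the ramification `x ↦ x ^ n`, with basis the `x ^ k`,
`k < n`. -/
theorem sum_X_pow_mul_ramify_extractPart {n : ℕ} (hn : 0 < n) (G : ConvergentSeries) :
    ∑ k : Fin n, seriesX ^ (k : ℕ) * ramify hn (extractPart hn k G) = G := by
  apply Subtype.ext
  ext d
  rw [coe_sum_series, map_sum, Finset.sum_eq_single ⟨d 0 % n, Nat.mod_lt _ hn⟩]
  · rw [coeff_X_pow_mul_ramify hn (Nat.mod_lt _ hn), if_pos rfl, coeff_extractPart]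
    congr 2
    rw [← single_add_single d]
    simp [Nat.div_add_mod]
  · intro k _ hk
    rw [coeff_X_pow_mul_ramify hn k.2, if_neg]
    rintro h
    exact hk (Fin.ext h.symm)
  · simp

theorem extractPart_sum {n : ℕ} (hn : 0 < n) (F : Fin n → ConvergentSeries) (i : Fin n) :
    extractPart hn i (∑ k : Fin n, seriesX ^ (k : ℕ) * ramify hn (F k)) = F i := by
  apply Subtype.ext
  ext d
  rw [coeff_extractPart, coe_sum_series, map_sum, Finset.sum_eq_single i]
  · rw [coeff_X_pow_mul_ramify hn i.2, if_pos]
    · congr 2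
      conv_rhs => rw [← single_add_single d]
      simp [Nat.mul_add_div hn, Nat.div_eq_of_lt i.2]
    · simp [Nat.mod_eq_of_lt i.2]
  · intro k _ hk
    rw [coeff_X_pow_mul_ramify hn k.2, if_neg]
    intro h
    apply hk
    simp [Nat.mod_eq_of_lt i.2] at h
    exact Fin.ext h.symm
  · simp

theorem extractPart_ramify_mul {n : ℕ} (hn : 0 < n) (i : Fin n) (F G : ConvergentSeries) :
    extractPart hn i (ramify hn F * G) = F * extractPart hn i G := by
  conv_lhs => rw [← sum_X_pow_mul_ramify_extractPart hn G]
  rw [Finset.mul_sum]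
  simp_rw [mul_left_comm (ramify hn F), ← map_mul]
  rw [extractPart_sum hn (fun k => F * extractPart hn k G)]

/-- The linear map which extracts from a series the parts congruent to `0, …, n - 1`. -/
noncomputable def extractPartLinear {n : ℕ} (hn : 0 < n) (I : Ideal ConvergentSeries) :
    ConvergentSeries →ₗ[ℂ] (Fin n → ConvergentSeries ⧸ I) where
  toFun G i := Ideal.Quotient.mk I (extractPart hn i G)
  map_add' F G := by
    funext i
    rw [Pi.add_apply, ← map_add]
    congr 1
  map_smul' c F := by
    funext i
    rw [Pi.smul_apply, RingHom.id_apply, ← Ideal.Quotient.mkₐ_eq_mk ℂ, ← map_smul]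
    congr 1

theorem extractPart_add {n : ℕ} (hn : 0 < n) (k : ℕ) (F G : ConvergentSeries) :
    extractPart hn k (F + G) = extractPart hn k F + extractPart hn k G := rfl

/-- Ramification multiplies colengths by its degree, since it is free of rank `n`. -/
theorem colength_ramify {n : ℕ} (hn : 0 < n) (f g : ConvergentSeries) :
    colength (ramify hn f) (ramify hn g) = n * colength f g := by
  let Ψ := extractPartLinear hn (Ideal.span {f, g})
  have hsurj : Function.Surjective Ψ := by
    intro v
    choose F hF using fun i => Ideal.Quotient.mk_surjective (v i)
    refine ⟨∑ k : Fin n, seriesX ^ (k : ℕ) * ramify hn (F k), ?_⟩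
    funext i
    rw [← hF i]
    exact congrArg _ (extractPart_sum hn F i)
  have hker : LinearMap.ker Ψ =
      (Ideal.span {ramify hn f, ramify hn g}).restrictScalars ℂ := by
    ext G
    rw [LinearMap.mem_ker, Submodule.restrictScalars_mem, Ideal.mem_span_pair]
    constructor
    · intro h
      have h' : ∀ i : Fin n, extractPart hn i G ∈ Ideal.span {f, g} := fun i =>
        Ideal.Quotient.eq_zero_iff_mem.1 (congrFun h i)
      simp_rw [Ideal.mem_span_pair] at h'
      choose a b hab using h'
      refine ⟨∑ k : Fin n, seriesX ^ (k : ℕ) * ramify hn (a k),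
        ∑ k : Fin n, seriesX ^ (k : ℕ) * ramify hn (b k), ?_⟩
      rw [← sum_X_pow_mul_ramify_extractPart hn G, Finset.sum_mul, Finset.sum_mul,
        ← Finset.sum_add_distrib]
      refine Finset.sum_congr rfl fun k _ => ?_
      rw [← hab k, map_add, map_mul, map_mul]
      ring
    · rintro ⟨a, b, rfl⟩
      funext i
      refine Ideal.Quotient.eq_zero_iff_mem.2 ?_
      rw [extractPart_add, mul_comm a, mul_comm b, extractPart_ramify_mul,
        extractPart_ramify_mul, Ideal.mem_span_pair]
      exact ⟨extractPart hn i a, extractPart hn i b, by ring⟩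
  have e := (Submodule.quotEquivOfEq _ _ hker).symm.trans (Ψ.quotKerEquivOfSurjective hsurj)
  have e2 : Module.length ℂ (ConvergentSeries ⧸
      (Ideal.span {ramify hn f, ramify hn g}).restrictScalars ℂ) =
      colength (ramify hn f) (ramify hn g) := rfl
  rw [← e2, e.length_eq, Module.length_pi, colength]
  simp

end Ramification

section Arc

/-- The intersection number of the smooth branch `y = η(x)` with `Z(g)` is the order of
`g(x, η(x))`. -/
theorem colength_arcFactor [IsLocalRing ConvergentSeries] (η : ConvergentArc)
    {g : ConvergentSeries} (hg : evalArc η g ≠ 0) :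
    colength (arcFactor η) g = (evalArc η g).order := by
  set k := (evalArc η g).order.toNat with hk
  obtain ⟨u, hu⟩ := PowerSeries.X_pow_order_dvd (φ := evalArc η g)
  rw [← hk] at hu
  have hu0 : PowerSeries.constantCoeff u ≠ 0 := by
    have h1 := PowerSeries.coeff_order hg
    rw [← hk, hu] at h1
    simpa [PowerSeries.coeff_X_pow_mul'] using h1
  have huc : Converges u := by
    refine Converges.of_X_pow_mul (i := ()) (k := k) ?_
    have := converges_evalArc η g
    rwa [hu] at this
  have hunit : IsUnit (seriesOfX huc) := by
    rw [isUnit_iff_constantCoeff, seriesOfX, Converges.coe_toSeries, constantCoeff_ofX]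
    exact hu0
  obtain ⟨V, hV⟩ := hunit.exists_right_inv
  have hV' : u * evalArc η V = 1 := by
    have := congrArg (evalArc η) hV
    rwa [map_mul, evalArc_seriesOfX, map_one] at this
  -- The `k`-jet of `F(x, η(x))` identifies the quotient with `ℂ ^ k`.
  let Ψ : ConvergentSeries →ₗ[ℂ] (Fin k → ℂ) :=
    LinearMap.pi fun i => (PowerSeries.coeff (i : ℕ)).comp (evalArc η).toLinearMap
  have hΨ : ∀ F i, Ψ F i = PowerSeries.coeff (i : ℕ) (evalArc η F) := fun _ _ => rfl
  have hsurj : Function.Surjective Ψ := by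
    intro v
    refine ⟨∑ j : Fin k, v j • seriesX ^ (j : ℕ), ?_⟩
    funext i
    rw [hΨ, map_sum, map_sum, Finset.sum_eq_single i]
    · rw [map_smul, map_pow, evalArc_X, map_smul, PowerSeries.coeff_X_pow_self, smul_eq_mul,
        mul_one]
    · intro j _ hj
      rw [map_smul, map_pow, evalArc_X, map_smul, PowerSeries.coeff_X_pow, if_neg, smul_zero]
      exact fun h => hj (Fin.ext h.symm)
    · simp
  have hker : LinearMap.ker Ψ = (Ideal.span {arcFactor η, g}).restrictScalars ℂ := by
    ext F
    rw [LinearMap.mem_ker, Submodule.restrictScalars_mem, Ideal.mem_span_pair]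
    constructor
    · intro h
      have h1 : (PowerSeries.X : ℂ⟦X⟧) ^ k ∣ evalArc η F :=
        PowerSeries.X_pow_dvd_iff.2 fun m hm => congrFun h ⟨m, hm⟩
      obtain ⟨G, hG⟩ := h1
      have hGc : Converges G := by
        refine Converges.of_X_pow_mul (i := ()) (k := k) ?_
        have := converges_evalArc η F
        rwa [hG] at this
      obtain ⟨Q, hQ⟩ := (arcFactor_dvd_iff (η := η) (F := F - seriesOfX hGc * V * g)).2 (by
        rw [map_sub, map_mul, map_mul, evalArc_seriesOfX, hG, hu]
        linear_combination -(PowerSeries.X ^ k * G) * hV')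
      exact ⟨Q, seriesOfX hGc * V, by linear_combination -hQ⟩
    · rintro ⟨a, b, rfl⟩
      funext i
      rw [hΨ, map_add, map_mul, map_mul, evalArc_arcFactor, sub_self, mul_zero, zero_add, hu]
      exact PowerSeries.X_pow_dvd_iff.1 (dvd_mul_of_dvd_right (dvd_mul_right _ _) _) _ i.2
  have e := (Submodule.quotEquivOfEq _ _ hker).symm.trans (Ψ.quotKerEquivOfSurjective hsurj)
  have e2 : Module.length ℂ (ConvergentSeries ⧸
      (Ideal.span {arcFactor η, g}).restrictScalars ℂ) = colength (arcFactor η) g := rfl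
  rw [← e2, e.length_eq, Module.length_pi, ← PowerSeries.coe_toNat_order hg]
  simp [hk]

variable {A B : Ideal ConvergentSeries} {n : ℕ} {Z W : Finset ConvergentArc}

/-- The intersection number of two branches in terms of their Newton-Puiseux roots. -/
theorem IsPuiseuxModel.mul_intersectionNumber [IsLocalRing ConvergentSeries]
    (hA : IsPuiseuxModel A n Z) (hB : IsPuiseuxModel B n W) (hAB : A ≠ B) :
    n * intersectionNumber A B = ∑ ξ ∈ Z, ∑ η ∈ W, (ξ.1 - η.1).order := by
  obtain ⟨f, hf, hf'⟩ := hA.exists_generator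
  obtain ⟨g, hg, hg'⟩ := hB.exists_generator
  have hne : ∀ ξ ∈ Z, ∀ η ∈ W, ξ ≠ η := by
    rintro ξ hξ η hη rfl
    exact hAB (hA.eq_of_mem hB hξ hη)
  rw [hf, hg, intersectionNumber_span, ← colength_ramify hA.pos, hf', hg', colength_prod_left]
  · refine Finset.sum_congr rfl fun ξ hξ => ?_
    rw [colength_comm, colength_prod_left]
    · refine Finset.sum_congr rfl fun η hη => ?_
      rw [colength_comm, colength_arcFactor, evalArc_arcFactor]
      rw [evalArc_arcFactor, sub_ne_zero]
      exact fun h => hne ξ hξ η hη (Subtype.ext h)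
    · exact fun η _ => prime_arcFactor η
    · intro η hη h
      rw [arcFactor_dvd_arcFactor_iff] at h
      exact hne ξ hξ η hη h.symm
  · exact fun η _ => prime_arcFactor η
  · intro ξ hξ h
    obtain ⟨η, hη, h'⟩ := (prime_arcFactor ξ).exists_mem_finset_dvd h
    exact hne ξ hξ η hη (arcFactor_dvd_arcFactor_iff.1 h')

theorem IsPuiseuxModel.intersectionNumber_X [IsLocalRing ConvergentSeries]
    (hA : IsPuiseuxModel A n Z) : intersectionNumber (Ideal.span {seriesX}) A = Z.card := by
  obtain ⟨f, hf, hf'⟩ := hA.exists_generator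
  have hn := hA.pos
  have h1 : ∀ η : ConvergentArc, colength (arcFactor η) (seriesX ^ n) = n := by
    intro η
    have h0 : evalArc η (seriesX ^ n) = PowerSeries.X ^ n := by rw [map_pow, evalArc_X]
    rw [colength_arcFactor, h0, PowerSeries.order_X_pow]
    rw [h0]
    exact pow_ne_zero _ PowerSeries.X_ne_zero
  have h2 : (n : ℕ∞) * colength seriesX f = n * Z.card := by
    rw [← colength_ramify hn, hf', ramify_X, colength_comm, colength_prod_left]
    · simp_rw [h1]
      rw [Finset.sum_const, nsmul_eq_mul, mul_comm]
    · exact fun η _ => prime_arcFactor η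
    · intro η _ h
      have h3 := (prime_arcFactor η).dvd_of_dvd_pow h
      rw [arcFactor_dvd_iff, evalArc_X] at h3
      exact PowerSeries.X_ne_zero h3
  rw [hf, intersectionNumber_span]
  generalize colength seriesX f = c at h2
  induction c using ENat.recTopCoe with
  | top =>
    rw [ENat.mul_top (by exact_mod_cast hn.ne')] at h2
    exact absurd h2.symm (by exact_mod_cast ENat.natCast_ne_top (n * Z.card))
  | coe c => exact_mod_cast Nat.eq_of_mul_eq_mul_left hn (by exact_mod_cast h2)

end Arc

/-! ### Contact of conjugate roots and the ultrametric inequality -/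

section Contact

/-- The maximal order of a difference of an element of `Z` and an element of `W`. -/
noncomputable def contact (Z W : Finset ConvergentArc) : ℕ∞ :=
  Z.sup fun ξ => W.sup fun η => (ξ.1 - η.1).order

theorem order_sub_le_contact {Z W : Finset ConvergentArc} {ξ η : ConvergentArc} (hξ : ξ ∈ Z)
    (hη : η ∈ W) : (ξ.1 - η.1).order ≤ contact Z W :=
  (Finset.le_sup (f := fun η : ConvergentArc => (ξ.1 - η.1).order) hη).trans
    (Finset.le_sup (f := fun ξ : ConvergentArc => W.sup fun η => (ξ.1 - η.1).order) hξ)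

theorem order_sub_comm (a b : ℂ⟦X⟧) : (a - b).order = (b - a).order := by
  rw [← neg_sub, PowerSeries.order_neg]

theorem contact_comm (Z W : Finset ConvergentArc) : contact Z W = contact W Z := by
  rw [contact, contact, Finset.sup_comm]
  simp_rw [order_sub_comm]

theorem order_rescale {ζ : ℂ} (hζ : ζ ≠ 0) (f : ℂ⟦X⟧) :
    (PowerSeries.rescale ζ f).order = f.order := by
  refine le_antisymm ?_ (PowerSeries.le_order _ _ fun i hi => ?_)
  · refine PowerSeries.le_order _ _ fun i hi => ?_
    have := PowerSeries.coeff_of_lt_order i hi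
    rw [PowerSeries.coeff_rescale] at this
    exact (mul_eq_zero.1 this).resolve_left (pow_ne_zero _ hζ)
  · rw [PowerSeries.coeff_rescale, PowerSeries.coeff_of_lt_order i hi, mul_zero]

theorem order_rotate_sub {ζ : ℂ} (hζ : ζ ≠ 0) (ξ η : ConvergentArc) :
    ((ξ.rotate ζ).1 - (η.rotate ζ).1).order = (ξ.1 - η.1).order := by
  rw [← order_rescale hζ (ξ.1 - η.1), map_sub]
  rfl

theorem ne_zero_of_pow_eq_one {ζ : ℂ} {n : ℕ} (hn : 0 < n) (h : ζ ^ n = 1) : ζ ≠ 0 := by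
  rintro rfl
  rw [zero_pow hn.ne'] at h
  exact zero_ne_one h

variable {A B C : Ideal ConvergentSeries} {n : ℕ} {Z W V : Finset ConvergentArc}

/-- The contact is attained at any given root of the second branch. -/
theorem IsPuiseuxModel.exists_order_eq_contact (hA : IsPuiseuxModel A n Z)
    (hB : IsPuiseuxModel B n W) {η : ConvergentArc} (hη : η ∈ W) :
    ∃ ξ ∈ Z, (ξ.1 - η.1).order = contact Z W := by
  obtain ⟨ξ₁, hξ₁, h1⟩ := Finset.exists_mem_eq_sup Z hA.nonempty
    (fun ξ : ConvergentArc => W.sup fun η => (ξ.1 - η.1).order)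
  obtain ⟨η₁, hη₁, h2⟩ := Finset.exists_mem_eq_sup W hB.nonempty
    (fun η : ConvergentArc => (ξ₁.1 - η.1).order)
  obtain ⟨ζ, hζ, rfl⟩ := hB.exists_rotate η₁ hη₁ η hη
  refine ⟨ξ₁.rotate ζ, hA.rotate_mem ξ₁ hξ₁ ζ hζ, ?_⟩
  rw [order_rotate_sub (ne_zero_of_pow_eq_one hA.pos hζ), contact, h1, h2]

/-- The contact of branches satisfies the ultrametric inequality. -/
theorem IsPuiseuxModel.min_contact_le (hA : IsPuiseuxModel A n Z) (hB : IsPuiseuxModel B n W)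
    (hC : IsPuiseuxModel C n V) : min (contact Z V) (contact V W) ≤ contact Z W := by
  obtain ⟨θ, hθ⟩ := hC.nonempty
  obtain ⟨ξ, hξ, h1⟩ := hA.exists_order_eq_contact hC hθ
  obtain ⟨η, hη, h2⟩ := hB.exists_order_eq_contact hC hθ
  rw [← h1, contact_comm V W, ← h2, order_sub_comm η.1]
  refine (PowerSeries.min_order_le_order_add _ _).trans ?_
  rw [sub_add_sub_cancel]
  exact order_sub_le_contact hξ hη

theorem IsPuiseuxModel.contact_self (hA : IsPuiseuxModel A n Z) : contact Z Z = ⊤ := by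
  obtain ⟨ξ, hξ⟩ := hA.nonempty
  rw [← top_le_iff]
  refine le_trans ?_ (order_sub_le_contact hξ hξ)
  rw [sub_self, PowerSeries.order_zero]

/-- The sum of the orders `min(K, ord(η₀ - η))`, where `η` runs through `W`. -/
noncomputable def truncatedContact (W : Finset ConvergentArc) (η₀ : ConvergentArc) (K : ℕ) : ℕ :=
  ∑ η ∈ W, (min (K : ℕ∞) (η₀.1 - η.1).order).toNat

theorem min_natCast_ne_top (K : ℕ) (a : ℕ∞) : min (K : ℕ∞) a ≠ ⊤ :=
  ne_top_of_le_ne_top (ENat.natCast_ne_top K) (min_le_left _ _)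

/-- The term of index `η₀` of the truncated contact is `K` itself, whence strict monotonicity. -/
theorem truncatedContact_strictMono {η₀ : ConvergentArc} (h : η₀ ∈ W) :
    StrictMono (truncatedContact W η₀) := by
  intro K L hKL
  refine Finset.sum_lt_sum (fun η _ => ?_) ⟨η₀, h, ?_⟩
  · refine ENat.toNat_le_toNat (min_le_min_right _ (by exact_mod_cast hKL.le))
      (min_natCast_ne_top _ _)
  · rw [sub_self, PowerSeries.order_zero]
    simpa using hKL

theorem one_le_order_sub (ξ η : ConvergentArc) : 1 ≤ (ξ.1 - η.1).order := by
  rw [PowerSeries.one_le_order_iff_constCoeff_eq_zero, map_sub, ξ.2.2, η.2.2, sub_zero]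

theorem IsPuiseuxModel.exists_contact_eq (hA : IsPuiseuxModel A n Z) (hB : IsPuiseuxModel B n W)
    (hAB : A ≠ B) : ∃ K : ℕ, 0 < K ∧ contact Z W = K := by
  obtain ⟨η, hη⟩ := hB.nonempty
  obtain ⟨ξ, hξ, h⟩ := hA.exists_order_eq_contact hB hη
  have hne : ξ.1 - η.1 ≠ 0 := by
    rw [sub_ne_zero]
    intro h
    have : ξ = η := Subtype.ext h
    exact hAB (hA.eq_of_mem hB hξ (this ▸ hη))
  refine ⟨(ξ.1 - η.1).order.toNat, ?_, ?_⟩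
  · have h1 := one_le_order_sub ξ η
    rw [← PowerSeries.coe_toNat_order hne] at h1
    exact_mod_cast h1
  · rw [PowerSeries.coe_toNat_order hne, h]

/-- If `ξ₀` is a root of `A` closest to the root `η₀` of `B`, then
`ord(ξ₀ - η) = min(K, ord(η₀ - η))` for all the roots `η` of `B`, where `K` is the contact. The sum
over the other roots of `A` is the same, by conjugation. -/
theorem IsPuiseuxModel.sum_order_sub (hA : IsPuiseuxModel A n Z) (hB : IsPuiseuxModel B n W)
    {K : ℕ} (hK : contact Z W = K) {η₀ : ConvergentArc} (hη₀ : η₀ ∈ W) :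
    ∑ ξ ∈ Z, ∑ η ∈ W, (ξ.1 - η.1).order = (Z.card * truncatedContact W η₀ K : ℕ) := by
  obtain ⟨ξ₀, hξ₀, h0⟩ := hA.exists_order_eq_contact hB hη₀
  have h1 : ∀ η ∈ W, (ξ₀.1 - η.1).order = min (K : ℕ∞) (η₀.1 - η.1).order := by
    intro η hη
    have e : ξ₀.1 - η.1 = (ξ₀.1 - η₀.1) + (η₀.1 - η.1) := by ring
    by_cases h : (ξ₀.1 - η₀.1).order = (η₀.1 - η.1).order
    · refine le_antisymm (le_min ?_ ?_) ?_
      · rw [← hK]; exact order_sub_le_contact hξ₀ hη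
      · rw [← h, h0]; exact order_sub_le_contact hξ₀ hη
      · rw [← hK, ← h0, e]
        exact PowerSeries.min_order_le_order_add _ _
    · rw [e, PowerSeries.order_add_of_order_ne _ _ h, h0, hK]
  have h2 : ∑ η ∈ W, (ξ₀.1 - η.1).order = (truncatedContact W η₀ K : ℕ∞) := by
    rw [truncatedContact, Nat.cast_sum]
    refine Finset.sum_congr rfl fun η hη => ?_
    rw [h1 η hη, ENat.natCast_toNat (min_natCast_ne_top _ _)]
  have h3 : ∀ ξ ∈ Z, ∑ η ∈ W, (ξ.1 - η.1).order = (truncatedContact W η₀ K : ℕ∞) := by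
    intro ξ hξ
    obtain ⟨ζ, hζ, rfl⟩ := hA.exists_rotate ξ₀ hξ₀ ξ hξ
    have hζ0 := ne_zero_of_pow_eq_one hA.pos hζ
    rw [← h2]
    refine Finset.sum_nbij' (fun η => η.rotate ζ⁻¹) (fun η => η.rotate ζ)
      (fun η h => hB.rotate_mem η h _ (by rw [inv_pow, hζ, inv_one]))
      (fun η h => hB.rotate_mem η h ζ hζ) ?_ ?_ ?_
    · intro η _
      rw [ConvergentArc.rotate_rotate, inv_mul_cancel₀ hζ0, ConvergentArc.rotate_one]
    · intro η _
      rw [ConvergentArc.rotate_rotate, mul_inv_cancel₀ hζ0, ConvergentArc.rotate_one]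
    · intro η _
      rw [← order_rotate_sub hζ0 ξ₀, ConvergentArc.rotate_rotate, inv_mul_cancel₀ hζ0,
        ConvergentArc.rotate_one]
  rw [Finset.sum_congr rfl h3, Finset.sum_const, nsmul_eq_mul]
  push_cast
  rfl

/-- For a fixed branch `B`, the value `u(A, B)` depends only on the contact `K` of `A` and `B`: by
`truncatedContact_strictMono` it is a decreasing function of `K`. -/
theorem IsPuiseuxModel.uFunction_eq [IsLocalRing ConvergentSeries] (hA : IsPuiseuxModel A n Z)
    (hB : IsPuiseuxModel B n W) (hAB : A ≠ B) {K : ℕ} (hK : contact Z W = K) (hK0 : 0 < K)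
    {η₀ : ConvergentArc} (hη₀ : η₀ ∈ W) :
    0 < truncatedContact W η₀ K ∧
      uFunction (Ideal.span {seriesX}) A B = n * W.card / truncatedContact W η₀ K := by
  have hT : 0 < truncatedContact W η₀ K :=
    (Nat.zero_le _).trans_lt (truncatedContact_strictMono hη₀ hK0)
  refine ⟨hT, ?_⟩
  have h := hA.mul_intersectionNumber hB hAB
  rw [hA.sum_order_sub hB hK hη₀] at h
  have hn := hA.pos
  have hZ : 0 < Z.card := hA.nonempty.card_pos
  rw [uFunction, if_neg hAB, hA.intersectionNumber_X, hB.intersectionNumber_X]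
  generalize intersectionNumber A B = c at h
  induction c using ENat.recTopCoe with
  | top =>
    rw [ENat.mul_top (by exact_mod_cast hn.ne')] at h
    exact absurd h.symm (ENat.natCast_ne_top _)
  | coe c =>
    have h' : n * c = Z.card * truncatedContact W η₀ K := by exact_mod_cast h
    have hc : 0 < c := Nat.pos_of_mul_pos_left (by rw [h']; exact Nat.mul_pos hZ hT)
    have h'' : (n : ℝ) * c = Z.card * truncatedContact W η₀ K := by exact_mod_cast h'
    simp only [ENat.toNat_natCast]
    rw [div_eq_div_iff (by exact_mod_cast hc.ne') (by exact_mod_cast hT.ne')]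
    linear_combination -(W.card : ℝ) * h''

end Contact

/-! ### Hasse diagrams which are trees -/

section Hasse

variable {V : Type*} [PartialOrder V]

/-- In a finite poset with a greatest element in which the elements above a given one form a chain,
every edge `v ⋖ w` of the Hasse diagram is a bridge, since only this edge leaves the elements
below `v`. -/
theorem isTree_hasse_of_isChain_Ici [Finite V] (t : V) (ht : ∀ v : V, v ≤ t)
    (hchain : ∀ a b c : V, a ≤ b → a ≤ c → b ≤ c ∨ c ≤ b) : (SimpleGraph.hasse V).IsTree := by
  have hreach : ∀ v : V, (SimpleGraph.hasse V).Reachable v t := by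
    intro v
    induction v using WellFoundedGT.induction with
    | ind v ih =>
      rcases (ht v).eq_or_lt with rfl | hlt
      · rfl
      · obtain ⟨w, hvw, -⟩ := exists_covBy_le_of_lt hlt
        exact (SimpleGraph.Adj.reachable (Or.inl hvw)).trans (ih w hvw.lt)
  have hbridge : ∀ v w : V, v ⋖ w → (SimpleGraph.hasse V).IsBridge s(v, w) := by
    intro v w hvw
    rw [SimpleGraph.isBridge_iff]
    intro hr
    have key : ∀ x y : V, ((SimpleGraph.hasse V).deleteEdges {s(v, w)}).Walk x y →
        x ≤ v → y ≤ v := by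
      intro x y p
      induction p with
      | nil => exact id
      | @cons x y z hxy _ ih =>
        intro hx
        refine ih ?_
        rw [SimpleGraph.deleteEdges_adj] at hxy
        obtain ⟨hadj, hne⟩ := hxy
        rcases hadj with hc | hc
        -- An element has at most one cover, so an edge which leaves `v` upwards is the removed one.
        · rcases hx.eq_or_lt with rfl | hxv
          · refine absurd ?_ hne
            have : y = w := by
              rcases hchain x y w hc.le hvw.le with h | h
              · exact (hvw.eq_or_eq hc.le h).resolve_left hc.lt.ne'
              · exact ((hc.eq_or_eq hvw.le h).resolve_left hvw.lt.ne').symm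
            rw [this]; rfl
          · rcases hchain x y v hc.le hx with h | h
            · exact h
            · exact ((hc.eq_or_eq hx h).resolve_left hxv.ne').ge
        · exact hc.le.trans hx
    obtain ⟨p⟩ := hr
    exact absurd (key v w p le_rfl) hvw.lt.not_ge
  have : Nonempty V := ⟨t⟩
  refine ⟨⟨fun v w => (hreach v).trans (hreach w).symm⟩, ?_⟩
  rw [SimpleGraph.isAcyclic_iff_forall_adj_isBridge]
  rintro v w (h | h)
  · exact hbridge v w h
  · rw [Sym2.eq_swap]; exact hbridge w v h

theorem encard_neighborSet_hasse_eq_one_iff [Finite V] (t : V) (ht : ∀ v : V, v ≤ t)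
    (hchain : ∀ a b c : V, a ≤ b → a ≤ c → b ≤ c ∨ c ≤ b) {v : V} (hv : v ≠ t) :
    ((SimpleGraph.hasse V).neighborSet v).encard = 1 ↔ IsMin v := by
  obtain ⟨w, hvw, -⟩ := exists_covBy_le_of_lt ((ht v).lt_of_ne hv)
  rw [Set.encard_eq_one]
  constructor
  · rintro ⟨x, hx⟩
    by_contra hmin
    rw [not_isMin_iff] at hmin
    obtain ⟨b, hb⟩ := hmin
    obtain ⟨c, -, hcv⟩ := exists_le_covBy_of_lt hb
    have h1 : w ∈ (SimpleGraph.hasse V).neighborSet v := Or.inl hvw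
    have h2 : c ∈ (SimpleGraph.hasse V).neighborSet v := Or.inr hcv
    rw [hx, Set.mem_singleton_iff] at h1 h2
    exact absurd (hcv.lt.trans hvw.lt) (by rw [h1, h2]; exact lt_irrefl _)
  · intro hmin
    refine ⟨w, Set.eq_singleton_iff_unique_mem.2 ⟨Or.inl hvw, ?_⟩⟩
    rintro y (h | h)
    · rcases hchain v y w h.le hvw.le with h' | h'
      · exact (hvw.eq_or_eq h.le h').resolve_left h.lt.ne'
      · exact ((h.eq_or_eq hvw.le h').resolve_left hvw.lt.ne').symm
    · exact absurd h.lt (hmin.not_lt)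

end Hasse

/-! ### The tree of a finite ultrametric -/

theorem RootedGraph.Iso.isLeafLabelledTree {ι : Type*} {T T' : RootedGraph ι}
    (e : RootedGraph.Iso T T') (h : T.IsLeafLabelledTree) : T'.IsLeafLabelledTree where
  isTree := e.toIso.isTree_iff.1 h.isTree
  label_injective i j hij := h.label_injective <| e.toIso.injective <| by
    rw [e.map_label, e.map_label, hij]
  range_label := by
    have hr : Set.range T'.label = e.toIso '' Set.range T.label := by
      rw [← Set.range_comp]
      exact congrArg Set.range (funext fun i => (e.map_label i).symm)
    rw [hr, h.range_label]
    have hn : ∀ v, (T'.graph.neighborSet (e.toIso v)).encard = (T.graph.neighborSet v).encard :=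
      fun v => (Set.encard_congr (e.toIso.mapNeighborSet v)).symm
    ext w
    obtain ⟨v, rfl⟩ := e.toIso.surjective w
    rw [e.toIso.injective.mem_set_image, Set.mem_ofPred_eq, Set.mem_ofPred_eq, hn, ← e.map_root,
      e.toIso.injective.ne_iff]

section UltrametricTree

variable {M : Type*} {d : M → M → ℝ}

theorem IsUltrametric.isLeafLabelledTree_ultrametricTree [Finite M] (hd : IsUltrametric d) :
    (ultrametricTree d).IsLeafLabelledTree := by
  obtain ⟨m, hdist, hultra⟩ := hd
  have hself : ∀ a, d a a = 0 := fun a => by rw [← hdist, dist_self]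
  have hsymm : ∀ a b, d a b = d b a := fun a b => by rw [← hdist, dist_comm, hdist]
  have hzero : ∀ {a b}, d a b ≤ 0 → a = b := fun {a b} h => by
    rw [← hdist] at h; exact dist_le_zero.1 h
  have hmax : ∀ a b c, d a c ≤ max (d a b) (d b c) := fun a b c => by
    simp only [← hdist]; exact dist_triangle_max a b c
  have hball0 : ∀ a, ballIn d a 0 = {some a} := by
    intro a
    ext o
    constructor
    · rintro ⟨p, hp, rfl⟩
      rw [hzero hp]; rfl
    · rintro rfl
      exact ⟨a, (hself a).le, rfl⟩
  -- A ball is also the ball of the same radius around each of its points.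
  have hrecenter : ∀ a b r, d b a ≤ r → ballIn d a r = ballIn d b r := by
    intro a b r h
    have h' : d a b ≤ r := by rwa [hsymm]
    unfold ballIn
    congr 1
    ext p
    exact ⟨fun hp => (hmax p a b).trans (max_le hp h'), fun hp => (hmax p b a).trans (max_le hp h)⟩
  let t : ballVertices d := ⟨Set.univ, Or.inl rfl⟩
  have ht : ∀ v : ballVertices d, v ≤ t := fun v => Set.subset_univ v.1
  have hchain : ∀ a b c : ballVertices d, a ≤ b → a ≤ c → b ≤ c ∨ c ≤ b := by
    rintro ⟨A, hA⟩ ⟨B, hB⟩ ⟨C, hC⟩ hab hac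
    rcases hB with rfl | ⟨b, r, hr, rfl⟩
    · exact Or.inr (Set.subset_univ _)
    rcases hC with rfl | ⟨c, s, hs, rfl⟩
    · exact Or.inl (Set.subset_univ _)
    have hne : ∃ a, some a ∈ A := by
      rcases hA with rfl | ⟨a, q, hq, rfl⟩
      · exact ⟨b, Set.mem_univ _⟩
      · exact ⟨a, a, (hself a).le.trans hq, rfl⟩
    obtain ⟨a, ha⟩ := hne
    obtain ⟨_, h1, h1'⟩ := hab ha
    obtain ⟨_, h2, h2'⟩ := hac ha
    cases h1'
    cases h2'
    have e1 := hrecenter b a r h1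
    have e2 := hrecenter c a s h2
    change ballIn d b r ⊆ ballIn d c s ∨ ballIn d c s ⊆ ballIn d b r
    rw [e1, e2]
    rcases le_total r s with h | h
    · exact Or.inl (Set.image_mono fun p hp => le_trans hp h)
    · exact Or.inr (Set.image_mono fun p hp => le_trans hp h)
  refine ⟨isTree_hasse_of_isChain_Ici t ht hchain, ?_, ?_⟩
  · intro a b hab
    have := congrArg Subtype.val hab
    change ballIn d a 0 = ballIn d b 0 at this
    rw [hball0, hball0] at this
    exact Option.some_injective _ (Set.singleton_injective this)
  · ext v
    constructor
    · rintro ⟨a, rfl⟩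
      have hnt : (ultrametricTree d).label a ≠ t := by
        intro h
        have := congrArg Subtype.val h
        change ballIn d a 0 = Set.univ at this
        rw [hball0] at this
        exact absurd (this ▸ Set.mem_univ none : none ∈ ({some a} : Set (Option M))) (by simp)
      refine ⟨hnt, (encard_neighborSet_hasse_eq_one_iff t ht hchain hnt).2 ?_⟩
      rintro ⟨B, hB⟩ hle
      change B ⊆ ballIn d a 0 at hle
      change ballIn d a 0 ⊆ B
      rw [hball0] at hle ⊢
      rcases hB with rfl | ⟨b, r, hr, rfl⟩
      · exact Set.subset_univ _
      · have hb : some b ∈ ballIn d b r := ⟨b, (hself b).le.trans hr, rfl⟩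
        have : b = a := by simpa using hle hb
        rw [← this, Set.singleton_subset_iff]
        exact hb
    · rintro ⟨hv, hcard⟩
      have hmin := (encard_neighborSet_hasse_eq_one_iff t ht hchain hv).1 hcard
      obtain ⟨B, hB⟩ := v
      rcases hB with rfl | ⟨b, r, hr, rfl⟩
      · exact absurd rfl hv
      · have hle : ballIn d b 0 ⊆ ballIn d b r := Set.image_mono fun p hp => le_trans hp hr
        have hge : ballIn d b r ⊆ ballIn d b 0 :=
          hmin (b := ⟨ballIn d b 0, Or.inr ⟨b, 0, le_rfl, rfl⟩⟩) hle
        exact ⟨b, Subtype.ext (hle.antisymm hge)⟩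

end UltrametricTree

/-! ### Points and vertices of a glued tree -/

/-- The properties of the orders of coincidence which make the gluing of the segments a tree:
`k A A = ∞`, and `k` satisfies the ultrametric inequality (with the order reversed). -/
structure IsCoincidenceFunction {ι : Type*} (k : ι → ι → ℝ≥0∞) : Prop where
  self : ∀ A, k A A = ⊤
  symm : ∀ A B, k A B = k B A
  pos : ∀ A B, 0 < k A B
  lt_top : ∀ A B, A ≠ B → k A B < ⊤
  min_le : ∀ A B C, min (k A B) (k B C) ≤ k A C

theorem ENat.three_le_card_of_ne {α : Type*} {a b c : α} (hab : a ≠ b) (hac : a ≠ c)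
    (hbc : b ≠ c) : 3 ≤ ENat.card α := by
  rw [← Set.encard_univ]
  have h : ({a, b, c} : Set α).encard = 3 := Set.encard_eq_three.2 ⟨a, b, c, hab, hac, hbc, rfl⟩
  rw [← h]
  exact Set.encard_le_encard (Set.subset_univ _)

theorem ConnectedComponents.mk_ne_mk_of_isClopen {X : Type*} [TopologicalSpace X] {W : Set X}
    (hW : IsClopen W) {x y : X} (hx : x ∈ W) (hy : y ∉ W) :
    (ConnectedComponents.mk x) ≠ ConnectedComponents.mk y := by
  intro h
  have h' : connectedComponent x = connectedComponent y := ConnectedComponents.coe_eq_coe.1 h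
  exact hy (hW.connectedComponent_subset hx (h' ▸ mem_connectedComponent))

theorem ConnectedComponents.mk_eq_mk_of_isPreconnected {X : Type*} [TopologicalSpace X]
    {P : X → Prop} {S : Set X} (hS : IsPreconnected S) (hP : ∀ x ∈ S, P x) {x y : {x // P x}}
    (hx : x.1 ∈ S) (hy : y.1 ∈ S) : ConnectedComponents.mk x = ConnectedComponents.mk y := by
  have h : IsPreconnected (Subtype.val ⁻¹' S : Set {x // P x}) := by
    refine Topology.IsInducing.subtypeVal.isPreconnected_image.1 ?_
    convert hS using 1
    ext z
    exact ⟨fun ⟨w, hw, hz⟩ => hz ▸ hw, fun hz => ⟨⟨z, hP z hz⟩, hz, rfl⟩⟩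
  exact ConnectedComponents.coe_eq_coe'.2 (h.subset_connectedComponent hy hx)

namespace GluedTree

variable {ι : Type*} {k : ι → ι → ℝ≥0∞}

/-- The exponent of a point of a glued tree. -/
def height : GluedTree k → ℝ≥0∞ :=
  Quot.lift (Sum.elim (fun _ => 0) fun x => x.2) (by rintro _ _ (_ | _) <;> rfl)

theorem point_zero (A : ι) : point k A 0 = root k := (Quot.sound (GlueRel.origin A)).symm

theorem root_or_point (p : GluedTree k) : p = root k ∨ ∃ A s, p = point k A s := by
  induction p using Quot.ind with
  | mk x =>
    rcases x with ⟨⟩ | ⟨A, s⟩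
    · exact Or.inl rfl
    · exact Or.inr ⟨A, s, rfl⟩

theorem point_eq_of_le {A B : ι} {s : ℝ≥0∞} (h : s ≤ k A B) : point k A s = point k B s :=
  Quot.sound (GlueRel.segment A B s h)

/-- The set of segments on which a point of a glued tree lies. -/
def segments (hk : IsCoincidenceFunction k) : GluedTree k → Set ι :=
  Quot.lift (Sum.elim (fun _ => Set.univ) fun x => {C | x.2 ≤ k x.1 C}) (by
    rintro _ _ (A | ⟨A, B, s, hs⟩)
    · ext C; simp
    · ext C
      exact ⟨fun h => (le_min (hk.symm A B ▸ hs) h).trans (hk.min_le B A C),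
        fun h => (le_min hs h).trans (hk.min_le A B C)⟩)

theorem mem_segments_point (hk : IsCoincidenceFunction k) {A C : ι} {s : ℝ≥0∞} :
    C ∈ segments hk (point k A s) ↔ s ≤ k A C := Iff.rfl

theorem segments_root (hk : IsCoincidenceFunction k) : segments hk (root k) = Set.univ := rfl

theorem point_eq_point_iff (hk : IsCoincidenceFunction k) {A B : ι} {s t : ℝ≥0∞} :
    point k A s = point k B t ↔ s = t ∧ s ≤ k A B := by
  constructor
  · intro h
    have hst : s = t := congrArg height h
    have hB : B ∈ segments hk (point k A s) := by
      rw [h, mem_segments_point, hk.self]; exact le_top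
    exact ⟨hst, hB⟩
  · rintro ⟨rfl, h⟩
    exact point_eq_of_le h

theorem continuous_point (A : ι) : Continuous (point k A) :=
  continuous_quot_mk.comp (continuous_inr.comp continuous_sigmaMk)

theorem isOpen_iff {U : Set (GluedTree k)} :
    IsOpen U ↔ ∀ A, IsOpen (point k A ⁻¹' U) := by
  rw [← isQuotientMap_quot_mk.isOpen_preimage, isOpen_sum_iff, isOpen_sigma_iff]
  exact and_iff_right (isOpen_discrete _)

theorem isClosed_iff {U : Set (GluedTree k)} :
    IsClosed U ↔ ∀ A, IsClosed (point k A ⁻¹' U) := by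
  simp only [← isOpen_compl_iff, isOpen_iff, Set.preimage_compl]

/-- The part of the tree which lies above height `s` on the same side as the tip of the segment
of index `B`. -/
def branchAbove (hk : IsCoincidenceFunction k) (B : ι) (s : ℝ≥0∞) : Set (GluedTree k) :=
  {q | s < height q ∧ ∃ C ∈ segments hk q, s < k B C}

theorem point_mem_branchAbove_iff (hk : IsCoincidenceFunction k) {B E : ι} {s t : ℝ≥0∞} :
    point k E t ∈ branchAbove hk B s ↔ s < t ∧ s < k B E := by
  refine and_congr_right fun hst => ⟨?_, fun h => ⟨E, ?_, h⟩⟩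
  · rintro ⟨C, hC, hs⟩
    rw [mem_segments_point] at hC
    exact (lt_min hs (hst.trans_le (hk.symm E C ▸ hC))).trans_le (hk.min_le B C E)
  · rw [mem_segments_point, hk.self]; exact le_top

theorem isOpen_branchAbove (hk : IsCoincidenceFunction k) (B : ι) (s : ℝ≥0∞) :
    IsOpen (branchAbove hk B s) := by
  refine isOpen_iff.2 fun E => ?_
  by_cases h : s < k B E
  · convert isOpen_Ioi (a := s) using 1
    ext t
    exact (point_mem_branchAbove_iff hk).trans (and_iff_left h)
  · convert isOpen_empty using 1
    ext t
    exact (point_mem_branchAbove_iff hk).trans ⟨fun h' => h h'.2, fun h' => h'.elim⟩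

theorem isClosed_insert_branchAbove (hk : IsCoincidenceFunction k) (B : ι) (s : ℝ≥0∞) :
    IsClosed (insert (point k B s) (branchAbove hk B s)) := by
  refine isClosed_iff.2 fun E => ?_
  have hmem : ∀ t, t ∈ point k E ⁻¹' insert (point k B s) (branchAbove hk B s) ↔
      (t = s ∧ s ≤ k B E) ∨ (s < t ∧ s < k B E) := by
    intro t
    refine or_congr ?_ (point_mem_branchAbove_iff hk)
    rw [eq_comm, point_eq_point_iff hk, eq_comm]
  rcases lt_trichotomy s (k B E) with h | h | h
  · convert isClosed_Ici (a := s) using 1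
    ext t
    rw [hmem, Set.mem_Ici, le_iff_eq_or_lt (b := t), eq_comm (a := s)]
    exact or_congr (and_iff_left h.le) (and_iff_left h)
  · convert isClosed_singleton (x := s) using 1
    ext t
    rw [hmem, Set.mem_singleton_iff]
    simp [← h]
  · convert isClosed_empty using 1
    ext t
    rw [hmem]
    simp [h.not_ge, h.le]

theorem isClopen_branchAbove (hk : IsCoincidenceFunction k) (B : ι) (s : ℝ≥0∞) :
    IsClopen (Subtype.val ⁻¹' branchAbove hk B s : Set {q : GluedTree k // q ≠ point k B s}) := by
  refine ⟨?_, (isOpen_branchAbove hk B s).preimage continuous_subtype_val⟩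
  convert (isClosed_insert_branchAbove hk B s).preimage continuous_subtype_val using 1
  ext q
  exact ⟨fun h => Or.inr h, fun h => h.resolve_left q.2⟩

section Valency

variable {A : ι} {s : ℝ≥0∞}

theorem root_ne_point (h0 : 0 < s) : root k ≠ point k A s := by
  intro h
  have : 0 = s := congrArg height h
  exact h0.ne this

theorem tip_ne_point (B : ι) (ht : s < ⊤) : point k B ⊤ ≠ point k A s := by
  intro h
  have : ⊤ = s := congrArg height h
  exact ht.ne' this

theorem root_notMem_branchAbove (hk : IsCoincidenceFunction k) (B : ι) :
    root k ∉ branchAbove hk B s := fun h => not_lt_bot h.1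

/-- If a point lies strictly between the root and a tip, its complement is disconnected. -/
theorem valency_point_ne_one (hk : IsCoincidenceFunction k) (h0 : 0 < s) (ht : s < ⊤) :
    valency k (point k A s) ≠ 1 := by
  intro h
  have hs : Subsingleton (ConnectedComponents {q : GluedTree k // q ≠ point k A s}) :=
    (ENat.card_le_one_iff_subsingleton _).1 h.le
  refine ConnectedComponents.mk_ne_mk_of_isClopen (isClopen_branchAbove hk A s)
    (x := ⟨point k A ⊤, tip_ne_point A ht⟩) (y := ⟨root k, root_ne_point h0⟩) ?_
    (root_notMem_branchAbove hk A) (Subsingleton.elim _ _)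
  exact (point_mem_branchAbove_iff hk).2 ⟨ht, by rwa [hk.self]⟩

/-- Where the segments `A` and `B` separate, the root and the tips of the two segments lie in
different components of the complement. -/
theorem three_le_valency (hk : IsCoincidenceFunction k) {A B : ι} (hAB : A ≠ B) :
    3 ≤ valency k (point k A (k A B)) := by
  have h0 := hk.pos A B
  have ht := hk.lt_top A B hAB
  have hp : point k A (k A B) = point k B (k A B) := point_eq_of_le le_rfl
  have hcA := isClopen_branchAbove hk A (k A B)
  have hcB := isClopen_branchAbove hk B (k A B)
  rw [← hp] at hcB
  have hA : point k A ⊤ ∈ branchAbove hk A (k A B) :=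
    (point_mem_branchAbove_iff hk).2 ⟨ht, by rwa [hk.self]⟩
  have hB : point k B ⊤ ∈ branchAbove hk B (k A B) :=
    (point_mem_branchAbove_iff hk).2 ⟨ht, by rwa [hk.self]⟩
  have hAB' : point k B ⊤ ∉ branchAbove hk A (k A B) := fun h =>
    lt_irrefl _ ((point_mem_branchAbove_iff hk).1 h).2
  refine ENat.three_le_card_of_ne
    (a := ConnectedComponents.mk ⟨point k A ⊤, tip_ne_point A ht⟩)
    (b := ConnectedComponents.mk ⟨root k, root_ne_point h0⟩)
    (c := ConnectedComponents.mk ⟨point k B ⊤, tip_ne_point B ht⟩) ?_ ?_ ?_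
  · exact ConnectedComponents.mk_ne_mk_of_isClopen hcA hA (root_notMem_branchAbove hk A)
  · exact ConnectedComponents.mk_ne_mk_of_isClopen hcA hA hAB'
  · exact (ConnectedComponents.mk_ne_mk_of_isClopen hcB hB (root_notMem_branchAbove hk B)).symm

/-- Away from the points where two segments separate, the complement of a point has at most two
components: the one of the root and the one of the tip of the segment. -/
theorem valency_point_lt_three (hk : IsCoincidenceFunction k) (h0 : 0 < s) (ht : s < ⊤)
    (hs : ∀ B, k A B ≠ s) : valency k (point k A s) < 3 := by
  let c₀ := ConnectedComponents.mk
    (⟨root k, root_ne_point h0⟩ : {q : GluedTree k // q ≠ point k A s})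
  let c₁ := ConnectedComponents.mk
    (⟨point k A ⊤, tip_ne_point A ht⟩ : {q : GluedTree k // q ≠ point k A s})
  have hne : ∀ E t, t ≠ s → point k E t ≠ point k A s := fun E t h h' => h (congrArg height h')
  have hIoi : ∀ E, IsPreconnected (point k E '' Set.Ioi s) := fun E =>
    isPreconnected_Ioi.image _ (continuous_point E).continuousOn
  have hIoiP : ∀ E, ∀ q ∈ point k E '' Set.Ioi s, q ≠ point k A s := by
    rintro E _ ⟨t, h, rfl⟩; exact hne E t (ne_of_gt h)
  have hIio : ∀ E, IsPreconnected (point k E '' Set.Iio s) := fun E =>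
    isPreconnected_Iio.image _ (continuous_point E).continuousOn
  have hIioP : ∀ E, ∀ q ∈ point k E '' Set.Iio s, q ≠ point k A s := by
    rintro E _ ⟨t, h, rfl⟩; exact hne E t (ne_of_lt h)
  have hall : ∀ c : ConnectedComponents {q : GluedTree k // q ≠ point k A s}, c = c₀ ∨ c = c₁ := by
    intro c
    obtain ⟨⟨q, hq⟩, rfl⟩ := ConnectedComponents.surjective_coe c
    rcases root_or_point q with rfl | ⟨E, t, rfl⟩
    · exact Or.inl rfl
    rcases lt_or_gt_of_ne (hs E) with hE | hE
    · -- The segment of index `E` leaves the segment of index `A` below the point.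
      left
      refine ConnectedComponents.mk_eq_mk_of_isPreconnected (S := Set.range (point k E))
        (isPreconnected_range (continuous_point E)) ?_ ⟨t, rfl⟩ ⟨0, point_zero E⟩
      rintro _ ⟨t', rfl⟩ h
      obtain ⟨rfl, h2⟩ := (point_eq_point_iff hk).1 h
      rw [hk.symm] at h2
      exact absurd hE h2.not_gt
    · have hts : t ≠ s := by
        rintro rfl
        exact hq (point_eq_of_le (hk.symm A E ▸ hE.le))
      rcases lt_or_gt_of_ne hts with h | h
      · left
        exact ConnectedComponents.mk_eq_mk_of_isPreconnected (hIio E) (hIioP E)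
          ⟨t, h, rfl⟩ ⟨0, h0, point_zero E⟩
      · right
        have e : point k A (k A E) = point k E (k A E) := point_eq_of_le le_rfl
        refine (ConnectedComponents.mk_eq_mk_of_isPreconnected (hIoi E) (hIoiP E)
          (y := ⟨point k A (k A E), hne A _ hE.ne'⟩) ⟨t, h, rfl⟩ ⟨k A E, hE, e.symm⟩).trans ?_
        exact ConnectedComponents.mk_eq_mk_of_isPreconnected (hIoi A) (hIoiP A)
          ⟨k A E, hE, rfl⟩ ⟨⊤, ht, rfl⟩
  have hle : valency k (point k A s) ≤ 2 := by
    unfold valency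
    rw [← Set.encard_univ]
    refine (Set.encard_le_encard (t := {c₀, c₁}) fun c _ => hall c).trans ?_
    exact (Set.encard_insert_le _ _).trans (by rw [Set.encard_singleton]; norm_num)
  exact hle.trans_lt (by norm_num)

end Valency

/-- The vertices are the root, the tips (case `A = B`) and the points where two segments
separate. -/
theorem mem_vertices_iff (hk : IsCoincidenceFunction k) {p : GluedTree k} :
    p ∈ vertices k ↔ p = root k ∨ ∃ A B, p = point k A (k A B) := by
  constructor
  · rintro (rfl | ⟨A, rfl⟩ | h)
    · exact Or.inl rfl
    · exact Or.inr ⟨A, A, by rw [hk.self]⟩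
    · rcases root_or_point p with rfl | ⟨A, s, rfl⟩
      · exact Or.inl rfl
      rcases eq_or_ne s 0 with rfl | h0
      · exact Or.inl (point_zero A)
      rcases eq_or_ne s ⊤ with rfl | ht
      · exact Or.inr ⟨A, A, by rw [hk.self]⟩
      have h0' := pos_iff_ne_zero.2 h0
      by_contra! hc
      rcases h with h | h
      · exact valency_point_ne_one hk h0' (lt_top_iff_ne_top.2 ht) h
      · refine (valency_point_lt_three hk h0' (lt_top_iff_ne_top.2 ht) fun B hB => ?_).not_ge h
        exact hc.2 A B (by rw [hB])
  · rintro (rfl | ⟨A, B, rfl⟩)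
    · exact Or.inl rfl
    · rcases eq_or_ne A B with rfl | hAB
      · exact Or.inr (Or.inl ⟨A, by rw [hk.self]⟩)
      · exact Or.inr (Or.inr (Or.inr (three_le_valency hk hAB)))

theorem Precedes.antisymm {p q : GluedTree k} (hpq : Precedes k p q) (hqp : Precedes k q p) :
    p = q := by
  have hle : ∀ {p q : GluedTree k}, Precedes k p q → height p ≤ height q := by
    rintro p q (rfl | ⟨A, s, t, hst, rfl, rfl⟩)
    · exact zero_le
    · exact hst
  have hh := (hle hpq).antisymm (hle hqp)
  rcases hpq with rfl | ⟨A, s, t, hst, rfl, rfl⟩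
  · rcases root_or_point q with rfl | ⟨B, t, rfl⟩
    · rfl
    · have : 0 = t := hh
      rw [← this, point_zero]
  · have : s = t := hh
    rw [this]

end GluedTree

/-! ### The glued tree of an ultrametric -/

namespace GluedTree

variable {ι : Type*} {k : ι → ι → ℝ≥0∞} {u : ι → ι → ℝ}

theorem isUltrametric_of_le_iff_le (hk : IsCoincidenceFunction k) (hself : ∀ A, u A A = 0)
    (hsymm : ∀ A B, u A B = u B A)
    (hle : ∀ A B C, u A B ≤ u A C ↔ k A C ≤ k A B) : IsUltrametric u := by
  have hpos : ∀ A B, A ≠ B → 0 < u A B := by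
    intro A B h
    by_contra! h'
    rw [← hself A, hle, hk.self] at h'
    exact (hk.lt_top A B h).not_ge h'
  have hnonneg : ∀ A B, 0 ≤ u A B := by
    intro A B
    rcases eq_or_ne A B with rfl | h
    · exact (hself A).ge
    · exact (hpos A B h).le
  have hmax : ∀ A B C, u A C ≤ max (u A B) (u B C) := by
    intro A B C
    rcases le_total (k A B) (k B C) with h | h
    · refine le_max_of_le_left ((hle A C B).2 ?_)
      simpa [h] using hk.min_le A B C
    · refine le_max_of_le_right ?_
      rw [hsymm A C, hsymm B C, hle, hk.symm C B, hk.symm C A]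
      simpa [h] using hk.min_le A B C
  let m : MetricSpace ι :=
    { dist := u
      dist_self := hself
      dist_comm := hsymm
      dist_triangle := fun A B C =>
        (hmax A B C).trans (max_le_add_of_nonneg (hnonneg A B) (hnonneg B C))
      eq_of_dist_eq_zero := fun {A B} h => by
        by_contra hAB
        exact (hpos A B hAB).ne' h }
  exact ⟨m, fun _ _ => rfl, ⟨hmax⟩⟩

/-- The set of indices of the segments through a point, to which `none` is added at the root: for
a vertex, this is the corresponding vertex of the tree of balls. -/
def ballAt (hk : IsCoincidenceFunction k) (p : GluedTree k) : Set (Option ι) :=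
  {o | ∀ C, o = some C → C ∈ segments hk p} ∩ {o | o = none → p = root k}

theorem some_mem_ballAt (hk : IsCoincidenceFunction k) {p : GluedTree k} {C : ι} :
    some C ∈ ballAt hk p ↔ C ∈ segments hk p := by
  simp [ballAt]

theorem none_mem_ballAt (hk : IsCoincidenceFunction k) {p : GluedTree k} :
    none ∈ ballAt hk p ↔ p = root k := by
  simp [ballAt]

theorem ballAt_root (hk : IsCoincidenceFunction k) : ballAt hk (root k) = Set.univ := by
  ext (_ | C)
  · simp [none_mem_ballAt]
  · simp [some_mem_ballAt, segments_root]

theorem point_ne_root {A : ι} {s : ℝ≥0∞} (hs : 0 < s) : point k A s ≠ root k :=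
  fun h => hs.ne' (congrArg height h)

/-- The indices of the segments through the point where `A` and `B` separate form the ball of
center `A` whose boundary contains `B`. -/
theorem ballAt_point (hk : IsCoincidenceFunction k) (hsymm : ∀ A B, u A B = u B A)
    (hle : ∀ A B C, u A B ≤ u A C ↔ k A C ≤ k A B) (A B : ι) :
    ballAt hk (point k A (k A B)) = ballIn u A (u A B) := by
  ext (_ | C)
  · simp [none_mem_ballAt, point_ne_root (hk.pos A B), ballIn]
  · rw [some_mem_ballAt, mem_segments_point, ballIn, (Option.some_injective ι).mem_set_image,
      Set.mem_ofPred_eq, hsymm C A, hle]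

theorem precedes_iff_ballAt_subset (hk : IsCoincidenceFunction k) {p q : GluedTree k}
    (hp : p ∈ vertices k) (hq : q ∈ vertices k) :
    Precedes k p q ↔ ballAt hk q ⊆ ballAt hk p := by
  constructor
  · rintro (rfl | ⟨A, s, t, hst, rfl, rfl⟩)
    · rw [ballAt_root]; exact Set.subset_univ _
    · rintro (_ | C) h
      · rw [none_mem_ballAt] at h ⊢
        have ht : t = 0 := congrArg height h
        rw [ht, nonpos_iff_eq_zero] at hst
        rw [hst, point_zero]
      · rw [some_mem_ballAt, mem_segments_point] at h ⊢
        exact hst.trans h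
  · intro h
    rcases (mem_vertices_iff hk).1 hp with rfl | ⟨A, B, rfl⟩
    · exact Or.inl rfl
    rcases (mem_vertices_iff hk).1 hq with rfl | ⟨A', B', rfl⟩
    · rw [ballAt_root] at h
      exact absurd ((none_mem_ballAt hk).1 (h (Set.mem_univ none))) (point_ne_root (hk.pos A B))
    · have hA' : k A B ≤ k A A' := by
        rw [← mem_segments_point hk, ← some_mem_ballAt hk]
        apply h
        rw [some_mem_ballAt, mem_segments_point, hk.self]
        exact le_top
      have hB' : k A B ≤ k A B' := by
        rw [← mem_segments_point hk, ← some_mem_ballAt hk]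
        apply h
        rw [some_mem_ballAt, mem_segments_point]
      refine Or.inr ⟨A', k A B, k A' B', ?_, point_eq_of_le hA', rfl⟩
      exact (le_min (hk.symm A A' ▸ hA') hB').trans (hk.min_le A' A B')

theorem bijective_ballAt [Finite ι] (hk : IsCoincidenceFunction k) (hself : ∀ A, u A A = 0)
    (hsymm : ∀ A B, u A B = u B A) (hle : ∀ A B C, u A B ≤ u A C ↔ k A C ≤ k A B) :
    Set.BijOn (ballAt hk) (vertices k) (ballVertices u) := by
  refine ⟨?_, ?_, ?_⟩
  · intro p hp
    rcases (mem_vertices_iff hk).1 hp with rfl | ⟨A, B, rfl⟩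
    · exact Or.inl (ballAt_root hk)
    · refine Or.inr ⟨A, u A B, ?_, ballAt_point hk hsymm hle A B⟩
      rw [← hself A, hle, hk.self]
      exact le_top
  · intro p hp q hq h
    exact ((precedes_iff_ballAt_subset hk hp hq).2 h.ge).antisymm
      ((precedes_iff_ballAt_subset hk hq hp).2 h.le)
  · rintro _ (rfl | ⟨A, r, hr, rfl⟩)
    · exact ⟨root k, Or.inl rfl, ballAt_root hk⟩
    · -- The radius is replaced by the largest distance to the center in the ball.
      obtain ⟨B, hB, hmax⟩ := Set.exists_max_image {B | u A B ≤ r} (u A) (Set.toFinite _)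
        ⟨A, (hself A).le.trans hr⟩
      refine ⟨point k A (k A B), (mem_vertices_iff hk).2 (Or.inr ⟨A, B, rfl⟩), ?_⟩
      rw [ballAt_point hk hsymm hle]
      unfold ballIn
      congr 1
      ext C
      simp only [Set.mem_ofPred_eq, hsymm C A]
      exact ⟨fun h => h.trans hB, fun h => hmax C h⟩

/-- If the distance is a decreasing function of the coincidence, the tree of balls is the glued
tree. -/
theorem nonempty_iso_ultrametricTree [Finite ι] (hk : IsCoincidenceFunction k)
    (hself : ∀ A, u A A = 0) (hsymm : ∀ A B, u A B = u B A)
    (hle : ∀ A B C, u A B ≤ u A C ↔ k A C ≤ k A B) :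
    Nonempty (RootedGraph.Iso (ultrametricTree u) (toRootedGraph k)) := by
  let e : vertices k ≃ ballVertices u := (bijective_ballAt hk hself hsymm hle).equiv
  have hprec : ∀ v w : vertices k, Precedes k v w ↔ e w ≤ e v := fun v w =>
    precedes_iff_ballAt_subset hk v.2 w.2
  have hcov : ∀ v w : vertices k, (v ≠ w ∧ Precedes k v w ∧
      ∀ z : vertices k, Precedes k v z → Precedes k z w → z = v ∨ z = w) ↔ e w ⋖ e v := by
    intro v w
    rw [covBy_iff_lt_and_eq_or_eq, lt_iff_le_and_ne]
    constructor
    · rintro ⟨hne, h, hz⟩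
      refine ⟨⟨(hprec v w).1 h, fun h' => hne (e.injective h').symm⟩, fun c h1 h2 => ?_⟩
      obtain ⟨z, rfl⟩ := e.surjective c
      rcases hz z ((hprec v z).2 h2) ((hprec z w).2 h1) with h | h
      · exact Or.inr (congrArg e h)
      · exact Or.inl (congrArg e h)
    · rintro ⟨⟨h, hne⟩, hz⟩
      refine ⟨fun h' => hne (congrArg e h').symm, (hprec v w).2 h, fun z h1 h2 => ?_⟩
      rcases hz (e z) ((hprec z w).1 h2) ((hprec v z).1 h1) with h | h
      · exact Or.inr (e.injective h)
      · exact Or.inl (e.injective h)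
  refine ⟨RootedGraph.Iso.mk (T := ultrametricTree u) (T' := toRootedGraph k)
    { toEquiv := e.symm, map_rel_iff' := ?_ } ?_ ?_⟩
  · intro a b
    obtain ⟨v, rfl⟩ := e.surjective a
    obtain ⟨w, rfl⟩ := e.surjective b
    change (SimpleGraph.fromRel _).Adj (e.symm (e v)) (e.symm (e w)) ↔
      (SimpleGraph.hasse (ballVertices u)).Adj (e v) (e w)
    rw [e.symm_apply_apply, e.symm_apply_apply, SimpleGraph.hasse_adj, ← hcov, ← hcov,
      SimpleGraph.fromRel_adj, and_or_left, or_comm, ne_comm (a := w)]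
  · refine e.symm_apply_eq.2 (Subtype.ext ?_)
    exact (ballAt_root hk).symm
  · intro A
    refine e.symm_apply_eq.2 (Subtype.ext ?_)
    change ballIn u A 0 = ballAt hk (point k A ⊤)
    rw [← hk.self A, ballAt_point hk hsymm hle, hself]

end GluedTree

/-! ### Coordinates adapted to a smooth branch -/

/-- The exchange of the two coordinates. -/
noncomputable def swapHom : ConvergentSeries →ₐ[ℂ] ConvergentSeries :=
  substHom seriesY seriesX (by simp) (by simp)

theorem coe_swapHom (F : ConvergentSeries) : (swapHom F : MvPowerSeries (Fin 2) ℂ) =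
    MvPowerSeries.subst ![MvPowerSeries.X 1, MvPowerSeries.X 0] (F : MvPowerSeries (Fin 2) ℂ) := by
  rw [swapHom, coe_substHom]
  rfl

theorem swapHom_swapHom (F : ConvergentSeries) : swapHom (swapHom F) = F := by
  apply Subtype.ext
  rw [coe_swapHom, coe_swapHom, subst_subst_pair (by simp) (by simp)
    (hasSubst_pair (by simp) (by simp)), subst_pair_X_one (by simp) (by simp),
    subst_pair_X_zero (by simp) (by simp), subst_pair_self]

theorem swapHom_seriesY : swapHom seriesY = seriesX := by
  apply Subtype.ext
  rw [coe_swapHom, coe_seriesY, subst_pair_X_one (by simp) (by simp), coe_seriesX]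

theorem coeff_swapHom (F : ConvergentSeries) :
    MvPowerSeries.coeff (Finsupp.single 1 1) (swapHom F : MvPowerSeries (Fin 2) ℂ) =
      MvPowerSeries.coeff (Finsupp.single 0 1) (F : MvPowerSeries (Fin 2) ℂ) := by
  have h0 : PowerSeries.constantCoeff (0 : ℂ⟦X⟧) = 0 := map_zero _
  rw [← coeff_subst_zero_X, ← coeff_subst_X_zero, coe_swapHom,
    subst_subst_pair (by simp) (by simp) (hasSubst_pair h0 constantCoeff_PX),
    subst_pair_X_one h0 constantCoeff_PX, subst_pair_X_zero h0 constantCoeff_PX]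

/-- The exchange of the two coordinates, as an automorphism. -/
noncomputable def swapEquiv : ConvergentSeries ≃ₐ[ℂ] ConvergentSeries :=
  AlgEquiv.ofAlgHom swapHom swapHom (AlgHom.ext swapHom_swapHom) (AlgHom.ext swapHom_swapHom)

/-- The automorphism `F(x, y) ↦ F(x, y + α(x))`, with its inverse. -/
noncomputable def translateEquiv (α : ConvergentArc) : ConvergentSeries ≃ₐ[ℂ] ConvergentSeries :=
  AlgEquiv.ofAlgHom (translateHom α) (translateHom (-α))
    (AlgHom.ext (translateHom_translateHom_neg α)) (AlgHom.ext (translateHom_neg_translateHom α))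

/-- A convergent series without terms of degree at most one lies in the square of the maximal
ideal. -/
theorem exists_eq_add_of_coeff_eq_zero {F : ConvergentSeries}
    (h0 : MvPowerSeries.constantCoeff (F : MvPowerSeries (Fin 2) ℂ) = 0)
    (hx : MvPowerSeries.coeff (Finsupp.single 0 1) (F : MvPowerSeries (Fin 2) ℂ) = 0)
    (hy : MvPowerSeries.coeff (Finsupp.single 1 1) (F : MvPowerSeries (Fin 2) ℂ) = 0) :
    ∃ G H : ConvergentSeries, MvPowerSeries.constantCoeff (G : MvPowerSeries (Fin 2) ℂ) = 0 ∧
      F = seriesY * G + seriesX ^ 2 * H := by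
  let o : ConvergentArc := ⟨0, converges_zero, map_zero _⟩
  have ha : Converges (evalArc o F) := converges_evalArc o F
  have hc : ∀ i, PowerSeries.coeff i (evalArc o F) =
      MvPowerSeries.coeff (Finsupp.single 0 i) (F : MvPowerSeries (Fin 2) ℂ) := by
    intro i
    rw [evalArc_apply]
    exact coeff_subst_X_zero _ i
  have hX : seriesX ^ 2 ∣ seriesOfX ha := by
    refine dvd_of_X_pow_dvd (i := 0) ?_
    rw [MvPowerSeries.X_pow_dvd_iff]
    intro d hd
    rw [seriesOfX, Converges.coe_toSeries, coeff_ofX, hc]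
    split_ifs with h1
    · obtain h | h : d 0 = 0 ∨ d 0 = 1 := by omega
      · rw [h, Finsupp.single_zero, MvPowerSeries.coeff_zero_eq_constantCoeff_apply, h0]
      · rw [h, hx]
    · rfl
  have hY : seriesY ^ 1 ∣ F - seriesOfX ha := by
    refine dvd_of_X_pow_dvd (i := 1) ?_
    rw [MvPowerSeries.X_pow_dvd_iff]
    intro d hd
    have hd1 : d 1 = 0 := by omega
    have e : Finsupp.single 0 (d 0) = d := by
      conv_rhs => rw [← single_add_single d, hd1, Finsupp.single_zero, add_zero]
    rw [Subalgebra.coe_sub, map_sub, seriesOfX, Converges.coe_toSeries, coeff_ofX, hc, if_pos hd1,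
      e, sub_self]
  obtain ⟨H, hH⟩ := hX
  obtain ⟨G, hG⟩ := hY
  rw [pow_one] at hG
  have hF : F = seriesY * G + seriesX ^ 2 * H := by rw [← hG, ← hH, sub_add_cancel]
  refine ⟨G, H, ?_, hF⟩
  have hG1 : MvPowerSeries.coeff (Finsupp.single 1 1)
      ((F - seriesOfX ha : ConvergentSeries) : MvPowerSeries (Fin 2) ℂ) = 0 := by
    rw [Subalgebra.coe_sub, map_sub, hy, seriesOfX, Converges.coe_toSeries, coeff_ofX]
    simp
  rw [hG, Subalgebra.coe_mul, coe_seriesY, MvPowerSeries.X_def] at hG1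
  have := MvPowerSeries.coeff_add_monomial_mul (Finsupp.single (1 : Fin 2) 1) 0
    (G : MvPowerSeries (Fin 2) ℂ) (1 : ℂ)
  rw [add_zero, hG1, one_mul] at this
  exact this.symm

section Adapted

variable {O : Type*} [CommRing O] [IsLocalRing O] [Algebra ℂ O]

theorem LocalCoordinates.isLocalRing (φ : LocalCoordinates O) : IsLocalRing ConvergentSeries :=
  RingEquiv.isLocalRing φ.toRingEquiv

theorem LocalCoordinates.mem_maximalIdeal_iff (φ : LocalCoordinates O) {f : O} :
    f ∈ IsLocalRing.maximalIdeal O ↔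
      MvPowerSeries.constantCoeff (φ f : MvPowerSeries (Fin 2) ℂ) = 0 := by
  have := φ.isLocalRing
  rw [IsLocalRing.mem_maximalIdeal, mem_nonunits_iff, ← MulEquiv.isUnit_map φ,
    isUnit_iff_constantCoeff, not_not]

/-- The linear part of an equation of a smooth branch does not vanish, so that it contains `y`,
up to an exchange of the coordinates. -/
theorem LocalCoordinates.exists_coeff_ne_zero (φ : LocalCoordinates O) {f : O}
    (hf : f ∈ IsLocalRing.maximalIdeal O) (hf2 : f ∉ IsLocalRing.maximalIdeal O ^ 2) :
    ∃ ψ : LocalCoordinates O,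
      MvPowerSeries.coeff (Finsupp.single 1 1) (ψ f : MvPowerSeries (Fin 2) ℂ) ≠ 0 := by
  by_cases hy : MvPowerSeries.coeff (Finsupp.single 1 1) (φ f : MvPowerSeries (Fin 2) ℂ) = 0
  · refine ⟨φ.trans swapEquiv, ?_⟩
    change MvPowerSeries.coeff _ (swapHom (φ f) : MvPowerSeries (Fin 2) ℂ) ≠ 0
    rw [coeff_swapHom]
    intro hx
    obtain ⟨G, H, hG, h⟩ := exists_eq_add_of_coeff_eq_zero (φ.mem_maximalIdeal_iff.1 hf) hx hy
    apply hf2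
    have hf' : f = φ.symm seriesY * φ.symm G + φ.symm seriesX ^ 2 * φ.symm H := by
      rw [← map_mul, ← map_pow, ← map_mul, ← map_add, ← h, AlgEquiv.symm_apply_apply]
    rw [hf', pow_two]
    refine add_mem (Ideal.mul_mem_mul ?_ ?_) (Ideal.mul_mem_right _ _ ?_)
    · rw [φ.mem_maximalIdeal_iff, AlgEquiv.apply_symm_apply]; simp
    · rw [φ.mem_maximalIdeal_iff, AlgEquiv.apply_symm_apply, hG]
    · rw [pow_two]
      apply Ideal.mul_mem_mul <;>
      · rw [φ.mem_maximalIdeal_iff, AlgEquiv.apply_symm_apply]; simp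
  · exact ⟨φ, hy⟩

/-- A smooth branch is a coordinate axis: by the implicit function theorem it is parametrized by an
arc `y = η(x)`, up to the order of the coordinates. -/
theorem IsSmoothBranch.exists_isAdapted (hS : IsSmoothSurfaceGerm O) {L : Ideal O}
    (hL : IsSmoothBranch L) : ∃ φ : LocalCoordinates O, IsAdapted φ L := by
  obtain ⟨φ₀⟩ := hS
  obtain ⟨f, hf, hf2, rfl⟩ := hL
  obtain ⟨φ, hφ⟩ := φ₀.exists_coeff_ne_zero hf hf2
  obtain ⟨ξ, hξ, hξ0, hroot⟩ := exists_implicit_function (converges_coe (φ f))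
    (φ.mem_maximalIdeal_iff.1 hf) hφ
  let η : ConvergentArc := ⟨ξ, hξ, hξ0⟩
  obtain ⟨G, hG⟩ : arcFactor η ∣ φ f := by
    rw [arcFactor_dvd_iff, evalArc_apply]
    exact hroot
  have hf' : f = φ.symm (arcFactor η) * φ.symm G := by
    rw [← map_mul, ← hG, AlgEquiv.symm_apply_apply]
  -- The cofactor is invertible, since `f` has multiplicity one.
  have hunit : IsUnit (φ.symm G) := by
    by_contra h
    apply hf2
    rw [hf', pow_two]
    refine Ideal.mul_mem_mul ?_ ((IsLocalRing.mem_maximalIdeal _).2 h)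
    rw [φ.mem_maximalIdeal_iff, AlgEquiv.apply_symm_apply, constantCoeff_arcFactor]
  refine ⟨(φ.trans (translateEquiv η)).trans swapEquiv, φ.symm (arcFactor η), ?_, ?_⟩
  · have : ((φ.trans (translateEquiv η)).trans swapEquiv) (φ.symm (arcFactor η)) =
        swapHom (translateHom η (φ (φ.symm (arcFactor η)))) := rfl
    rw [this, AlgEquiv.apply_symm_apply, translateHom_arcFactor, swapHom_seriesY, coe_seriesX]
  · rw [hf', Ideal.span_singleton_mul_right_unit hunit]

end Adapted

/-! ### Branches in adapted coordinates -/

section Transport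

variable {O : Type*} [CommRing O] [Algebra ℂ O] (φ : LocalCoordinates O)

theorem map_coordinates_injective : Function.Injective (Ideal.map φ : Ideal O → Ideal _) := by
  intro A B h
  ext x
  have key : ∀ I : Ideal O, x ∈ I ↔ φ x ∈ I.map φ := by
    intro I
    rw [Ideal.mem_map_of_equiv]
    exact ⟨fun hx => ⟨x, hx, rfl⟩, fun ⟨y, hy, hyx⟩ => φ.injective hyx ▸ hy⟩
  rw [key, key, h]

theorem map_coordinates_span (f : O) : (Ideal.span {f}).map φ = Ideal.span {φ f} := by
  rw [Ideal.map_span, Set.image_singleton]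

theorem intersectionNumber_map (A B : Ideal O) :
    intersectionNumber (A.map φ) (B.map φ) = intersectionNumber A B := by
  rw [intersectionNumber, intersectionNumber, ← Module.length_eq_rank, ← Module.length_eq_rank]
  refine (LinearEquiv.length_eq (Ideal.quotientEquivAlg (A ⊔ B) _ φ ?_).toLinearEquiv).symm
  exact (Ideal.map_sup φ A B).symm

theorem uFunction_map (L A B : Ideal O) :
    uFunction (L.map φ) (A.map φ) (B.map φ) = uFunction L A B := by
  simp only [uFunction, intersectionNumber_map, (map_coordinates_injective φ).eq_iff]

theorem uFunction_comm (L A B : Ideal O) : uFunction L A B = uFunction L B A := by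
  have h : intersectionNumber A B = intersectionNumber B A := by
    rw [intersectionNumber, intersectionNumber, sup_comm]
  rw [uFunction, uFunction, h, mul_comm]
  simp only [eq_comm]

theorem uFunction_self (L A : Ideal O) : uFunction L A A = 0 := if_pos rfl

end Transport

/-! ### Simultaneous Newton-Puiseux parametrizations of the branches of a curve -/

section Branches

theorem IsAdapted.map_eq {O : Type*} [CommRing O] [Algebra ℂ O] {φ : LocalCoordinates O}
    {L : Ideal O} (hφ : IsAdapted φ L) :
    L.map φ = Ideal.span {seriesX} := by
  obtain ⟨x, hx, rfl⟩ := hφ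
  rw [map_coordinates_span]
  congr 2
  exact Subtype.ext hx

variable {O : Type*} [CommRing O] [IsLocalRing O] [Algebra ℂ O] {φ : LocalCoordinates O}
  {L D A : Ideal O}

theorem IsAdapted.exists_isPuiseuxModel (hφ : IsAdapted φ L) (hLD : L ∉ branchesOf D)
    (hA : A ∈ branchesOf D) : ∃ n Z, IsPuiseuxModel (A.map φ) n Z := by
  have := φ.isLocalRing
  obtain ⟨⟨f, hf, rfl⟩, hDA⟩ := hA
  rw [map_coordinates_span]
  have hφf : Irreducible (φ f) := (MulEquiv.irreducible_iff φ).2 hf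
  refine _root_.exists_isPuiseuxModel hφf fun hX => hLD ?_
  have hXu : ¬ IsUnit seriesX := by
    rw [isUnit_iff_constantCoeff]; simp
  have h : L.map φ = (Ideal.span {f}).map φ := by
    rw [hφ.map_eq, map_coordinates_span, Ideal.span_singleton_eq_span_singleton]
    exact ((hφf.dvd_iff.1 hX).resolve_left hXu).symm
  rw [map_coordinates_injective φ h]
  exact ⟨⟨f, hf, rfl⟩, hDA⟩

/-- The product of defining functions of distinct branches divides a defining function of the
curve, whose order therefore bounds the number of branches. -/
theorem IsAdapted.finite_branchesOf (hφ : IsAdapted φ L) (hD : IsCurveSingularity D)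
    (hLD : L ∉ branchesOf D) : (branchesOf D).Finite := by
  have := φ.isLocalRing
  obtain ⟨g, -, hg0, rfl⟩ := hD
  by_contra hinf
  have hG0 : (φ g : MvPowerSeries (Fin 2) ℂ) ≠ 0 := by
    intro h
    exact hg0 ((map_eq_zero_iff φ φ.injective).1 (Subtype.ext h))
  obtain ⟨N, hN⟩ := ENat.ne_top_iff_exists.1 (MvPowerSeries.order_eq_top_iff.not.2 hG0)
  have hinf' : (branchesOf (Ideal.span {g})).Infinite := hinf
  obtain ⟨s, hs, hcard⟩ := hinf'.exists_subset_card_eq (N + 1)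
  choose! f hf using fun (A : Ideal O) (hA : A ∈ s) => (hs hA).1
  have hirr : ∀ A ∈ s, Irreducible (φ (f A)) := fun A hA =>
    (MulEquiv.irreducible_iff φ).2 (hf A hA).1
  have hdvd : ∏ A ∈ s, φ (f A) ∣ φ g := by
    refine finset_prod_dvd_of_prime s _ _ ?_ ?_ ?_
    · intro A hA
      obtain ⟨n, Z, h⟩ := hφ.exists_isPuiseuxModel hLD (hs hA)
      have hp := h.isPrime
      rw [(hf A hA).2, map_coordinates_span] at hp
      exact (Ideal.span_singleton_prime (hirr A hA).ne_zero).1 hp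
    · intro A hA
      have h : g ∈ A := (hs hA).2 (Ideal.mem_span_singleton_self g)
      rw [(hf A hA).2, Ideal.mem_span_singleton] at h
      exact map_dvd φ h
    · intro A hA B hB hAB hd
      apply hAB
      apply map_coordinates_injective φ
      rw [(hf A hA).2, (hf B hB).2, map_coordinates_span, map_coordinates_span,
        Ideal.span_singleton_eq_span_singleton]
      exact (hirr A hA).associated_of_dvd (hirr B hB) hd
  obtain ⟨c, hc⟩ := hdvd
  have h1 : ((N + 1 : ℕ) : ℕ∞) ≤
      (∏ A ∈ s, (φ (f A) : MvPowerSeries (Fin 2) ℂ)).order := by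
    refine le_trans ?_ (MvPowerSeries.le_order_prod _ _)
    rw [← hcard, Finset.cast_card]
    refine Finset.sum_le_sum fun A hA => ?_
    rw [MvPowerSeries.one_le_order_iff_constCoeff_eq_zero]
    by_contra h
    exact (hirr A hA).not_isUnit (isUnit_iff_constantCoeff.2 h)
  have h2 : ((N + 1 : ℕ) : ℕ∞) ≤ N := by
    rw [hN, hc, Subalgebra.coe_mul, ← ConvergentSeries.val_apply (∏ A ∈ s, φ (f A)), map_prod]
    exact h1.trans (le_self_add.trans MvPowerSeries.le_order_mul)
  have h3 : N + 1 ≤ N := by exact_mod_cast h2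
  omega

/-- The branches have parametrizations with a common denominator. -/
theorem exists_isPuiseuxModel_common {ι : Type*} [Finite ι] {A : ι → Ideal ConvergentSeries}
    (h : ∀ i, ∃ n Z, IsPuiseuxModel (A i) n Z) :
    ∃ N, 0 < N ∧ ∃ Z : ι → Finset ConvergentArc, ∀ i, IsPuiseuxModel (A i) N (Z i) := by
  classical
  have := Fintype.ofFinite ι
  choose n Z hZ using h
  have hpos : 0 < ∏ i, n i := Finset.prod_pos fun i _ => (hZ i).pos
  have hex : ∀ i, ∃ Z', IsPuiseuxModel (A i) (∏ i, n i) Z' := by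
    intro i
    obtain ⟨k, hk⟩ := Finset.dvd_prod_of_mem n (Finset.mem_univ i)
    rw [hk]
    exact (hZ i).expand (Nat.pos_of_mul_pos_left (hk ▸ hpos))
  choose W hW using hex
  exact ⟨_, hpos, W, hW⟩

end Branches

/-! ### Orders of coincidence -/

theorem order_subst_X_pow {m : ℕ} (hm : 0 < m) (f : ℂ⟦X⟧) :
    PowerSeries.order (PowerSeries.subst ((PowerSeries.X : ℂ⟦X⟧) ^ m) f) = m * f.order := by
  rcases eq_or_ne f 0 with rfl | hf
  · have h : PowerSeries.subst ((PowerSeries.X : ℂ⟦X⟧) ^ m) (0 : ℂ⟦X⟧) = 0 := by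
      ext i
      rw [PowerSeries.coeff_subst_X_pow hm.ne']
      simp
    rw [h, PowerSeries.order_zero, ENat.mul_top (by exact_mod_cast hm.ne')]
  · obtain ⟨d, hd⟩ := ENat.ne_top_iff_exists.1 (PowerSeries.order_eq_top.not.2 hf)
    obtain ⟨h1, h2⟩ := PowerSeries.order_eq_nat.1 hd.symm
    rw [← hd, ← Nat.cast_mul, PowerSeries.order_eq_nat]
    constructor
    · rw [PowerSeries.coeff_subst_X_pow hm.ne', if_pos (dvd_mul_right m d),
        Nat.mul_div_cancel_left _ hm]
      simpa using h1
    · intro i hi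
      rw [PowerSeries.coeff_subst_X_pow hm.ne']
      split_ifs with h
      · obtain ⟨j, rfl⟩ := h
        rw [Nat.mul_div_cancel_left _ hm, h2 j (lt_of_mul_lt_mul_left hi (Nat.zero_le m))]
        simp
      · rfl

section Coincidence

variable {O : Type*} [CommRing O] [Algebra ℂ O] {φ : LocalCoordinates O} {A B : Ideal O} {N : ℕ}
  {Z W : Finset ConvergentArc}

theorem IsPuiseuxModel.mem_newtonPuiseuxRoots (h : IsPuiseuxModel (A.map φ) N Z)
    {η : ConvergentArc} (hη : η ∈ Z) : η.1 ∈ newtonPuiseuxRoots φ A N :=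
  ⟨η.2.2, fun _ hf => h.isRoot hη (Ideal.mem_map_of_mem φ hf)⟩

theorem IsPuiseuxModel.exists_of_mem_newtonPuiseuxRoots (h : IsPuiseuxModel (A.map φ) N Z) {m : ℕ}
    (hm : 0 < m) {ξ : ℂ⟦X⟧} (hξ : ξ ∈ newtonPuiseuxRoots φ A m) :
    ∃ η ∈ Z, PowerSeries.subst ((PowerSeries.X : ℂ⟦X⟧) ^ N) ξ =
      PowerSeries.subst ((PowerSeries.X : ℂ⟦X⟧) ^ m) η.1 := by
  refine h.exists_of_root hm hξ.1 fun F hF => ?_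
  obtain ⟨f, hf, rfl⟩ := (Ideal.mem_map_of_equiv φ F).1 hF
  exact hξ.2 f hf

/-- The order of coincidence can be computed from the roots with a given denominator. -/
theorem IsPuiseuxModel.coincidence_eq (hA : IsPuiseuxModel (A.map φ) N Z)
    (hB : IsPuiseuxModel (B.map φ) N W) :
    coincidence φ A B = (contact Z W : ℝ≥0∞) / N := by
  have hN : (N : ℝ≥0∞) ≠ 0 := by exact_mod_cast hA.pos.ne'
  have hN' : (N : ℝ≥0∞) ≠ ⊤ := ENNReal.natCast_ne_top N
  apply le_antisymm
  · refine iSup₂_le fun m hm => iSup₂_le fun ξ hξ => iSup₂_le fun η hη => ?_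
    obtain ⟨ξ', hξ', h1⟩ := hA.exists_of_mem_newtonPuiseuxRoots hm hξ
    obtain ⟨η', hη', h2⟩ := hB.exists_of_mem_newtonPuiseuxRoots hm hη
    have hord : (N : ℕ∞) * (ξ - η).order = m * (ξ'.1 - η'.1).order := by
      rw [← order_subst_X_pow hA.pos, ← order_subst_X_pow hm,
        PowerSeries.subst_sub (PowerSeries.HasSubst.X_pow hA.pos.ne'),
        PowerSeries.subst_sub (PowerSeries.HasSubst.X_pow hm.ne'), h1, h2]
    have hle : (N : ℕ∞) * (ξ - η).order ≤ m * contact Z W := by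
      rw [hord]
      gcongr
      exact order_sub_le_contact hξ' hη'
    have hle' : (N : ℝ≥0∞) * ((ξ - η).order : ℝ≥0∞) ≤ m * (contact Z W : ℝ≥0∞) := by
      exact_mod_cast ENat.toENNReal_le.2 hle
    have hm0 : (m : ℝ≥0∞) ≠ 0 := by exact_mod_cast hm.ne'
    rw [ENNReal.div_le_iff hm0 (ENNReal.natCast_ne_top m), mul_comm, ← mul_div_assoc,
      ENNReal.le_div_iff_mul_le (Or.inl hN) (Or.inl hN'), mul_comm]
    exact hle'
  · obtain ⟨η, hη⟩ := hB.nonempty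
    obtain ⟨ξ, hξ, h⟩ := hA.exists_order_eq_contact hB hη
    rw [← h]
    exact le_iSup₂_of_le N hA.pos (le_iSup₂_of_le ξ.1 (hA.mem_newtonPuiseuxRoots hξ)
      (le_iSup₂_of_le η.1 (hB.mem_newtonPuiseuxRoots hη) le_rfl))

end Coincidence

section Family

variable {O : Type*} [CommRing O] [Algebra ℂ O] {φ : LocalCoordinates O} {ι : Type*}
  {A : ι → Ideal O} {N : ℕ} {Z : ι → Finset ConvergentArc}

/-- The order of coincidence is the contact divided by the common denominator, and so inherits the
properties of the contact. -/
theorem isCoincidenceFunction_coincidence (hinj : Function.Injective A)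
    (hZ : ∀ i, IsPuiseuxModel ((A i).map φ) N (Z i)) :
    IsCoincidenceFunction fun i j => coincidence φ (A i) (A j) := by
  have hk : ∀ i j, coincidence φ (A i) (A j) = (contact (Z i) (Z j) : ℝ≥0∞) / N :=
    fun i j => (hZ i).coincidence_eq (hZ j)
  have hself : ∀ i, coincidence φ (A i) (A i) = ⊤ := by
    intro i
    rw [hk, (hZ i).contact_self, ENat.toENNReal_top, ENNReal.top_div_of_ne_top]
    exact ENNReal.natCast_ne_top N
  have hnat : ∀ i j, i ≠ j → ∃ K : ℕ, 0 < K ∧ contact (Z i) (Z j) = K := fun i j hij =>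
    (hZ i).exists_contact_eq (hZ j) fun h => hij (hinj (map_coordinates_injective φ h))
  refine ⟨hself, fun i j => ?_, fun i j => ?_, fun i j hij => ?_, fun i j l => ?_⟩
  · rw [hk, hk, contact_comm]
  · rcases eq_or_ne i j with rfl | hij
    · rw [hself]; exact ENNReal.zero_lt_top
    · obtain ⟨K, hK, h⟩ := hnat i j hij
      rw [hk, h]
      exact ENNReal.div_pos (by simpa using hK.ne') (ENNReal.natCast_ne_top N)
  · obtain ⟨K, -, h⟩ := hnat i j hij
    rw [hk, h]
    exact ENNReal.div_lt_top (by simp) (by exact_mod_cast (hZ i).pos.ne')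
  · have hmono : Monotone fun a : ℕ∞ => (a : ℝ≥0∞) / N := fun a b hab =>
      ENNReal.div_le_div_right (ENat.toENNReal_le.2 hab) _
    simp only [hk]
    rw [← hmono.map_min (a := contact (Z i) (Z j)) (b := contact (Z j) (Z l))]
    exact hmono ((hZ i).min_contact_le (hZ l) (hZ j))

/-- For a fixed branch `A i`, the number `u(A i, A j)` is a strictly decreasing function of the
order of coincidence of `A i` and `A j`. -/
theorem uFunction_le_iff_coincidence_le [IsLocalRing ConvergentSeries] {L : Ideal O}
    (hL : L.map φ = Ideal.span {seriesX}) (hinj : Function.Injective A)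
    (hZ : ∀ i, IsPuiseuxModel ((A i).map φ) N (Z i)) (i j l : ι) :
    uFunction L (A i) (A j) ≤ uFunction L (A i) (A l) ↔
      coincidence φ (A i) (A l) ≤ coincidence φ (A i) (A j) := by
  have hC := isCoincidenceFunction_coincidence hinj hZ
  obtain ⟨η₀, hη₀⟩ := (hZ i).nonempty
  have hN : (N : ℝ≥0∞) ≠ 0 := by exact_mod_cast (hZ i).pos.ne'
  have hc : (0 : ℝ) < N * (Z i).card := by
    have h1 := (hZ i).pos
    have h2 := (hZ i).nonempty.card_pos
    positivity
  have key : ∀ j, i ≠ j → ∃ K : ℕ, 0 < truncatedContact (Z i) η₀ K ∧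
      uFunction L (A i) (A j) = N * (Z i).card / truncatedContact (Z i) η₀ K ∧
      coincidence φ (A i) (A j) = (K : ℝ≥0∞) / N := by
    intro j hij
    have hne : (A j).map φ ≠ (A i).map φ := fun h =>
      hij (hinj (map_coordinates_injective φ h)).symm
    obtain ⟨K, hK0, hK⟩ := (hZ j).exists_contact_eq (hZ i) hne
    obtain ⟨hT, hu⟩ := (hZ j).uFunction_eq (hZ i) hne hK hK0 hη₀
    refine ⟨K, hT, ?_, ?_⟩
    · rw [uFunction_comm, ← uFunction_map φ, hL, hu]
    · rw [(hZ i).coincidence_eq (hZ j), contact_comm, hK, ENat.toENNReal_coe]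
  have hnonneg : ∀ l, 0 ≤ uFunction L (A i) (A l) := by
    intro l
    rcases eq_or_ne i l with rfl | hil
    · exact (uFunction_self _ _).ge
    · obtain ⟨K, hT, hu, -⟩ := key l hil
      rw [hu]
      positivity
  rcases eq_or_ne i j with rfl | hij
  · refine iff_of_true ?_ ?_
    · rw [uFunction_self]; exact hnonneg l
    · rw [hC.self i]; exact le_top
  obtain ⟨K, hT, hu, hk⟩ := key j hij
  have hT' : (0 : ℝ) < truncatedContact (Z i) η₀ K := by exact_mod_cast hT
  rcases eq_or_ne i l with rfl | hil
  · refine iff_of_false ?_ ?_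
    · rw [uFunction_self, hu, not_le]
      positivity
    · rw [hC.self i, not_le]; exact hC.lt_top i j hij
  obtain ⟨K', hS, hu', hk'⟩ := key l hil
  have hS' : (0 : ℝ) < truncatedContact (Z i) η₀ K' := by exact_mod_cast hS
  rw [hu, hu', hk, hk', div_le_div_iff_of_pos_left hc hT' hS', Nat.cast_le,
    (truncatedContact_strictMono hη₀).le_iff_le,
    ENNReal.div_le_iff hN (ENNReal.natCast_ne_top N),
    ENNReal.div_mul_cancel hN (ENNReal.natCast_ne_top N), Nat.cast_le]

end Family

theorem theorem4p4 {O : Type*} [CommRing O] [IsLocalRing O] [Algebra ℂ O]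
    (hS : IsSmoothSurfaceGerm O) (D L : Ideal O) (hD : IsCurveSingularity D)
    (hL : IsSmoothBranch L) (hLD : L ∉ branchesOf D) :
    IsUltrametric (fun A B : branchesOf D => uFunction L A B) ∧
    (∃ φ : LocalCoordinates O, IsAdapted φ L) ∧
    ∀ φ : LocalCoordinates O, IsAdapted φ L →
      (eggersWallTree φ D).IsLeafLabelledTree ∧
      Nonempty (RootedGraph.Iso
        (ultrametricTree fun A B : branchesOf D => uFunction L A B)
        (eggersWallTree φ D)) := by
  have main : ∀ φ : LocalCoordinates O, IsAdapted φ L → Finite (branchesOf D) ∧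
      IsCoincidenceFunction (fun A B : branchesOf D => coincidence φ A B) ∧
      ∀ A B C : branchesOf D, uFunction L A B ≤ uFunction L A C ↔
        coincidence φ A C ≤ coincidence φ A B := by
    intro φ hφ
    have := φ.isLocalRing
    have hfin : Finite (branchesOf D) := (hφ.finite_branchesOf hD hLD).to_subtype
    obtain ⟨N, -, Z, hZ⟩ := exists_isPuiseuxModel_common
      (A := fun A : branchesOf D => (A : Ideal O).map φ)
      fun A => hφ.exists_isPuiseuxModel hLD A.2
    exact ⟨hfin, isCoincidenceFunction_coincidence Subtype.val_injective hZ,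
      uFunction_le_iff_coincidence_le hφ.map_eq Subtype.val_injective hZ⟩
  have hself : ∀ A : branchesOf D, uFunction L (A : Ideal O) A = 0 := fun A => uFunction_self L A
  have hsymm : ∀ A B : branchesOf D, uFunction L (A : Ideal O) B = uFunction L B A := fun A B =>
    uFunction_comm L A B
  have hex := hL.exists_isAdapted hS
  have hu : IsUltrametric (fun A B : branchesOf D => uFunction L A B) := by
    obtain ⟨φ, hφ⟩ := hex
    obtain ⟨-, hk, hle⟩ := main φ hφ
    exact GluedTree.isUltrametric_of_le_iff_le hk hself hsymm hle
  refine ⟨hu, hex, fun φ hφ => ?_⟩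
  obtain ⟨hfin, hk, hle⟩ := main φ hφ
  obtain ⟨e⟩ := GluedTree.nonempty_iso_ultrametricTree hk hself hsymm hle
  exact ⟨e.isLeafLabelledTree hu.isLeafLabelledTree_ultrametricTree, ⟨e⟩⟩
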